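/- **Setting.** A *core graph of rank $n$* is a connected finite metric graph without valence-one vertices whose fundamental group is free of rank $n$; its *natural vertices* are the points of valence $>2$, and its *natural edges* are the closures of the components of the complement of the natural vertices. A *fold* is a quotient map between metric graphs which identifies, by arc length, initial segments of a common length $L>0$ of two directed natural edges issuing from one natural vertex (the half-open segments $(0,L]$ having disjoint images), identifies nothing else, and is isometric off the two segments. A *split sequence of rank $n$* is an inverse sequence of folds $\zeta: G_0 \xleftarrow{f_{-1}} G_{-1} \xleftarrow{f_{-2}} G_{-2}\leftarrow\cdots$ of rank $n$ core graphs such that every composition $f^j_0:G_j\to G_0$ is locally injective off the natural vertices of $G_j$; $f^k_j: G_k\to G_j$ ($k<j$) denotes the composition. It is *proper* if the set of images in $G_0$ of all natural vertices of all $G_j$, $j<0$, is finite. The *solenoid* $X=X(\zeta)=\varprojlim G_j$ carries the inverse limit topology; $\pi_j:X\to G_j$ are the projections. An *$n$-pronged star set* ($n\ge2$) is a homeomorphic copy of $n$ copies of $[0,1)$ glued at $0$ (the *center*); the copies of $(0,1)$ are its *open prongs*, and a *turn* is the union of two open prongs and the center. A point of $G_j$ is *special* if some image or preimage of it under the fold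 compositions is a natural vertex. A *standard star neighborhood* in $G_j$ is an open star set having no special point except possibly its center; a *standard turn* is a turn of one; a *standard neighborhood* in $X$ is the $\pi_j$-preimage of one; a *standard plaque* is a path component of a standard neighborhood. $\mathrm{Sing}(X)$ is the set of $x\in X$ such that in every standard neighborhood $O\ni x$ the path component of $x$ is an $n$-pronged star set for some $n>2$. A standard plaque is *singular* if it is a star set centered at a point of $\mathrm{Sing}(X)$; the other standard plaques are called *leaf segments*; a *singular segment* is a turn of a singular plaque. A leaf segment *takes* (a singular segment *sustains*) a subset $I$ of $G_j$ if $\pi_j$ maps it homeomorphically onto $I$. A *pre-singularity* is a point $x\in X$ such that $\pi_j(x)$ is a natural vertex for all sufficiently negative $j$. $\zeta$ is *stabilized* if for all $j\le0$: every fiber $\pi_j^{-1}(q)$ contains at most one pre-singularity, and none if $q$ is not a natural vertex; and for every standard turn $I$ in $G_j$: no $3$-pronged star set $U\subset X$ has $\pi_j(U)=I$; and for each singular segment $L$ sustaining $I$, exactly one of the following holds: for every $i\le 0$ some leaf segment takes $\pi_i(L)$; no leaf segment takes $\pi_0(L)$. *Partial leaves.* An *optimal point* of $G_0$ is a special point or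 the mid-point of a loop. An *optimal star neighborhood* is a standard star neighborhood in $G_0$ centered at an optimal point, containing no other optimal point, and maximal with these properties for its center. An *optimal leaf segment* is a non-singular path component of the $\pi_0$-preimage of an optimal star neighborhood. A *concatenation* is a union $L_1\cup\dots\cup L_m$, $m\ge1$, of optimal leaf segments such that each $L_i\cap L_{i+1}$ contains a leaf segment. Two points of $X\setminus\mathrm{Sing}(X)$ are leaf equivalent if some concatenation contains both; the equivalence classes are the *partial leaves*. A partial leaf is *finite* if it is itself a concatenation. *Transverse measures.* Let $I$ be a standard turn in $G_j$ with center $p$, let $\mathrm{Tun}_I$ be the union of the leaf segments taking $I$, and let $C_I=\mathrm{Tun}_I\cap\pi_j^{-1}(p)$. For $y\in C_I$, $t\in I$, let $h_I(y,t)$ be the point over $t$ of the leaf segment through $y$ taking $I$. A *turn transversal* is a set $h_I(C_I\times\{q\})$, $q\in I$. A *flow map* is a homeomorphism $\phi$ of $C_I$ onto its image in $\mathrm{Tun}_I$ of the form $\phi(y)=h_I(y,\sigma(y))$ with $\sigma:C_I\to I$ continuous. A *transversal* is the image under a flow map of a Borel subset of $C_I$. A *flow map composition* between transversals $F,F'$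 is a homeomorphism $F\to F'$ that is a composition of $m\ge1$ maps between transversals, each a restriction of a flow map or of the inverse of one, where the intermediate transversals lie in turn transversals. A *transverse semi-measure* is a function $\mu\ge0$ with finite values on the transversals of $X$ and the singletons of singularities such that: on the Borel subsets of each transversal it is a Borel measure; flow map compositions preserve these measures; and for each singular plaque $V$ centered at $s$ and each $A\subset V\setminus\{s\}$ with exactly one point on each open prong, $\mu(\{s\})=\frac12\sum_{y\in A}\mu(\{y\})$. Two open prongs $P,P'$ of singular plaques $V,V'$ centered at $s$ define the same *prong-germ* at $s$ if $\mathrm{Cl}_V(P)\cap \mathrm{Cl}_{V'}(P')$ is an embedded half-closed interval containing $s$. A *transverse measure* is a transverse semi-measure $\mu$ for which there are symmetric functions $W^s\ge0$ on pairs of prong-germs at $s$, $s\in \mathrm{Sing}(X)$, vanishing on the diagonal, such that $\mu(\{y\})=\sum_{P}W^s(P',P)$ whenever $y$ lies on a prong of the germ $P'$ at $s$. It is *non-atomic* if $\mu(\{y\})=0$ for every $y\in X$. *Mingling.* For $k<j$, a natural edge $E_k$ of $G_k$ *mingles* with a natural edge $E_j$ of $G_j$ if $f^k_j(\mathrm{int}\,E_k)\cap\mathrm{int}\,E_j\ne\emptyset$.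 $\zeta$ is *fully mingling* if for each $j\le0$ there is $k<j$ such that each natural edge of $G_k$ mingles with each natural edge of $G_j$. $\zeta$ is *expanding* if for each $j\le0$ and each natural edge $E_j$ of $G_j$ there is $k<j$ such that for no natural edge $E_k$ of $G_k$ mingling with $E_j$ is $f^k_j|_{E_k}$ a homeomorphism onto its image. **Statement.** Let $\zeta$ be a stabilized proper split sequence of rank $n$ and $X=X(\zeta)$. 1. If $\zeta$ is expanding, then $X$ has no finite partial leaf, and every transverse measure on $X$ is non-atomic. 2. If $\zeta$ is fully mingling, then $\zeta$ is expanding; hence every transverse measure on $X$ is non-atomic. -/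

import Mathlib

open Set Topology
open scoped NNReal ENNReal

noncomputable section

/-! ### Metric graphs -/

/-- A finite metric graph in its natural cell structure: finitely many vertices, finitely many
edges, each with a chosen orientation and a positive length, and every vertex has valence at
least three. Vertices of valence two are not recorded, so the vertices are the natural vertices and
the edges are the natural edges of the underlying metric space. -/
structure MetricGraph where
  V : Type
  E : Type
  finite_V : Finite V
  finite_E : Finite E
  src : E → V
  tgt : E → V
  len : E → ℝ
  len_pos : ∀ e, 0 < len e
  /-- At least three directed edges start at every vertex (a loop contributes two). -/
  three_le_valence : ∀ v, 3 ≤ Nat.card {d : E × Bool // (if d.2 then src d.1 else tgt d.1) = v}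

namespace MetricGraph

/-- The points of the metric graph: its vertices and the interior points of its edges. -/
inductive Point (G : MetricGraph) : Type
  | vertex (v : G.V) : Point G
  | inner (e : G.E) (t : ℝ) (h0 : 0 < t) (h1 : t < G.len e) : Point G

variable (G : MetricGraph)

open Classical in
/-- The unit speed parameterization of the closed edge `e` by `[0, len e]`
(extended by constants outside this interval). -/
def path (e : G.E) (t : ℝ) : G.Point :=
  if h0 : 0 < t then
    if h1 : t < G.len e then .inner e t h0 h1 else .vertex (G.tgt e)
  else .vertex (G.src e)

/-- The topology of the graph: the quotient topology of the disjoint union of the closed edges. -/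
instance : TopologicalSpace G.Point :=
  ⨆ e : G.E, TopologicalSpace.coinduced (G.path e) inferInstance

/-- The natural vertices, as a set of points. -/
def naturalVertices : Set G.Point := range Point.vertex

/-- The interior of a natural edge. -/
def openEdge (e : G.E) : Set G.Point := G.path e '' Ioo 0 (G.len e)

/-- The natural edge, with its end points. -/
def closedEdge (e : G.E) : Set G.Point := G.path e '' Icc 0 (G.len e)

/-- The initial vertex of a directed edge; the flag says whether the chosen orientation is kept. -/
def start (d : G.E × Bool) : G.V := if d.2 then G.src d.1 else G.tgt d.1

/-- The unit speed parameterization of a directed edge. -/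
def along (d : G.E × Bool) (t : ℝ) : G.Point :=
  if d.2 then G.path d.1 t else G.path d.1 (G.len d.1 - t)

/-- The mid-points of the loops of the graph. -/
def loopMidpoints : Set G.Point :=
  {x | ∃ e, G.src e = G.tgt e ∧ x = G.path e (G.len e / 2)}

/-- Core graphs of rank `n`: connected, without vertices of valence one (this is part of
`MetricGraph`), and with fundamental group free of rank `n`. -/
def IsCoreGraph (n : ℕ) : Prop :=
  PathConnectedSpace G.Point ∧
    ∀ x : G.Point, Nonempty (FundamentalGroup G.Point x ≃* FreeGroup (Fin n))

/-- `f` is a fold from `G` to `H`: a quotient map which identifies the initial segments of length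
`L` of two directed edges `d₁`, `d₂` with the same initial vertex, and nothing else, where these
segments are disjoint except for the initial vertex (end points included), and which is isometric
off the two segments. Isometry refers to the length metrics: off the segments, `f` is injective
by the first part, and it carries arc length on edges of `G` to arc length on edges of `H`. -/
def IsFold (G H : MetricGraph) (f : G.Point → H.Point) : Prop :=
  ∃ (d₁ d₂ : G.E × Bool) (L : ℝ),
    G.start d₁ = G.start d₂ ∧
    0 < L ∧ L ≤ G.len d₁.1 ∧ L ≤ G.len d₂.1 ∧
    Disjoint (G.along d₁ '' Ioc 0 L) (G.along d₂ '' Ioc 0 L) ∧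
    IsQuotientMap f ∧
    (∀ x y, f x = f y ↔ x = y ∨ ∃ t ∈ Icc 0 L,
      (x = G.along d₁ t ∧ y = G.along d₂ t) ∨ (x = G.along d₂ t ∧ y = G.along d₁ t)) ∧
    (∀ e, ∀ t ∈ Ioo 0 (G.len e),
      G.path e t ∉ G.along d₁ '' Icc 0 L ∪ G.along d₂ '' Icc 0 L →
      ∃ e', ∃ s ∈ Ioo 0 (H.len e'), ∃ σ : ℝ, (σ = 1 ∨ σ = -1) ∧ ∃ ε > 0,
        ∀ u : ℝ, |u| < ε → f (G.path e (t + u)) = H.path e' (s + σ * u))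

end MetricGraph

/-! ### Star sets -/

section Star

/-- The model `n`-pronged star: `n` copies of `[0, 1)` glued at `0`, realized as the union of the
segments `[0, 1)` of the coordinate axes of `ℝⁿ`. -/
def starModel (n : ℕ) : Set (Fin n → ℝ) :=
  {x | ∃ i : Fin n, ∃ t ∈ Ico (0 : ℝ) 1, x = Pi.single i t}

/-- The open prongs of the model star. -/
def modelProng {n : ℕ} (i : Fin n) : Set (starModel n) :=
  {x | ∃ t ∈ Ioo (0 : ℝ) 1, (x : Fin n → ℝ) = Pi.single i t}

variable {Y : Type*} [TopologicalSpace Y]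

/-- `h` identifies the model `n`-pronged star with `S`, and its center with `p`. -/
def IsStarChart (n : ℕ) (p : Y) (S : Set Y) (h : starModel n → Y) : Prop :=
  2 ≤ n ∧ IsEmbedding h ∧ range h = S ∧ ∀ x, h x = p ↔ (x : Fin n → ℝ) = 0

/-- `S` is an `n`-pronged star set with center `p`. -/
def IsStarSet (n : ℕ) (p : Y) (S : Set Y) : Prop := ∃ h, IsStarChart n p S h

/-- `P` is an open prong of the star set `S` with center `p`. -/
def IsProng (p : Y) (S P : Set Y) : Prop :=
  ∃ (n : ℕ) (h : starModel n → Y) (i : Fin n), IsStarChart n p S h ∧ P = h '' modelProng i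

/-- `I` is a turn of the star set `S` with center `p`: two distinct open prongs and the center. -/
def IsTurn (p : Y) (S I : Set Y) : Prop :=
  ∃ (n : ℕ) (h : starModel n → Y) (i j : Fin n), IsStarChart n p S h ∧ i ≠ j ∧
    I = h '' modelProng i ∪ h '' modelProng j ∪ {p}

/-- `P` is a plaque (that is, a path component) of the subspace `O`. -/
def IsPlaqueOf (O P : Set Y) : Prop := ∃ x ∈ O, P = pathComponentIn O x

end Star

/-! ### Split sequences and solenoids -/

/-- An inverse sequence of metric graphs and maps. The index `j : ℕ` stands for the level `-j`. -/
structure GraphTower where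
  graph : ℕ → MetricGraph
  bond : ∀ j, (graph (j + 1)).Point → (graph j).Point

namespace GraphTower

/-- The points of the level `-j` graph. -/
abbrev Level (ζ : GraphTower) (j : ℕ) : Type := (ζ.graph j).Point

variable (ζ : GraphTower)

/-- The composition of bonding maps from level `-k` to level `-j`. -/
def down {j k : ℕ} (h : j ≤ k) : ζ.Level k → ζ.Level j :=
  Nat.leRecOn (C := fun i => ζ.Level i → ζ.Level j) h (fun {i} g => g ∘ ζ.bond i) id

/-- The images in the level `0` graph of the natural vertices of all lower levels form a
finite set. -/
def IsProper : Prop :=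
  {x : ζ.Level 0 | ∃ k, 0 < k ∧ ∃ v ∈ (ζ.graph k).naturalVertices,
    ζ.down (Nat.zero_le k) v = x}.Finite

/-- The solenoid: the inverse limit of the tower, as a subspace of the product. -/
def Solenoid : Type := {x : ∀ j, ζ.Level j // ∀ j, ζ.bond j (x (j + 1)) = x j}

instance : TopologicalSpace ζ.Solenoid :=
  inferInstanceAs (TopologicalSpace {x : ∀ j, ζ.Level j // ∀ j, ζ.bond j (x (j + 1)) = x j})

/-- The projection of the solenoid to the level `-j` graph. -/
def proj (j : ℕ) (x : ζ.Solenoid) : ζ.Level j := x.1 j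

/-- The fiber of the solenoid over a point of a level graph. -/
def fiber (j : ℕ) (q : ζ.Level j) : Set ζ.Solenoid := {x | ζ.proj j x = q}

/-- Special points: points with an image or a preimage (in some level) which is a natural vertex. -/
def IsSpecial (j : ℕ) (x : ζ.Level j) : Prop :=
  (∃ i, ∃ h : i ≤ j, ζ.down h x ∈ (ζ.graph i).naturalVertices) ∨
  (∃ k, ∃ h : j ≤ k, ∃ v ∈ (ζ.graph k).naturalVertices, ζ.down h v = x)

/-- `V` is a standard star neighborhood with center `p` of the level `-j` graph. -/
def IsStandardStarNhd (j : ℕ) (p : ζ.Level j) (V : Set (ζ.Level j)) : Prop :=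
  (∃ n, IsStarSet n p V) ∧ IsOpen V ∧ ∀ x ∈ V, x ≠ p → ¬ ζ.IsSpecial j x

/-- `I` is a level `-j` standard turn: a turn of a standard star neighborhood with center `p`. -/
def IsStandardTurn (j : ℕ) (p : ζ.Level j) (I : Set (ζ.Level j)) : Prop :=
  ∃ V, ζ.IsStandardStarNhd j p V ∧ IsTurn p V I

/-- Standard neighborhoods of the solenoid. -/
def IsStandardNhd (O : Set ζ.Solenoid) : Prop :=
  ∃ j p V, ζ.IsStandardStarNhd j p V ∧ O = ζ.proj j ⁻¹' V

/-- Standard plaques: path components of standard neighborhoods. -/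
def IsStandardPlaque (P : Set ζ.Solenoid) : Prop :=
  ∃ O, ζ.IsStandardNhd O ∧ IsPlaqueOf O P

/-- The set of singularities of the solenoid: the points `x` such that in each standard
neighborhood of `x` the plaque of `x` is an `n`-pronged star set for some `n > 2`. -/
def sing : Set ζ.Solenoid :=
  {x | ∀ O, ζ.IsStandardNhd O → x ∈ O → ∃ n > 2, ∃ p, IsStarSet n p (pathComponentIn O x)}

/-- Pre-singularities: points all of whose projections from some level on are natural vertices. -/
def IsPreSingularity (x : ζ.Solenoid) : Prop :=
  ∃ K, ∀ j ≥ K, ζ.proj j x ∈ (ζ.graph j).naturalVertices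

/-- `P` is a singular plaque centered at the singularity `s`. -/
def IsSingularPlaque (s : ζ.Solenoid) (P : Set ζ.Solenoid) : Prop :=
  ζ.IsStandardPlaque P ∧ s ∈ ζ.sing ∧ ∃ n, IsStarSet n s P

/-- Leaf segments: the standard plaques that are not singular plaques. -/
def IsLeafSegment (L : Set ζ.Solenoid) : Prop :=
  ζ.IsStandardPlaque L ∧ ¬ ∃ s, ζ.IsSingularPlaque s L

/-- Singular segments: turns of singular plaques. -/
def IsSingularSegment (L : Set ζ.Solenoid) : Prop :=
  ∃ s P, ζ.IsSingularPlaque s P ∧ IsTurn s P L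

/-- `L` lies over the subset `I` of the level `-j` graph via a homeomorphism inverse to the
projection. A singular segment (leaf segment) with this property sustains (takes) the turn `I`. -/
def LiesOver (j : ℕ) (I : Set (ζ.Level j)) (L : Set ζ.Solenoid) : Prop :=
  ∃ l : I ≃ₜ L, ∀ t : I, ζ.proj j (l t : ζ.Solenoid) = t

/-- The leaf segment `L` takes the turn `I`. -/
def Takes (j : ℕ) (I : Set (ζ.Level j)) (L : Set ζ.Solenoid) : Prop :=
  ζ.IsLeafSegment L ∧ ζ.LiesOver j I L

/-- The stabilizing hypotheses: two criteria on vertices and two criteria on turns. -/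
structure IsStabilized : Prop where
  natural_vertex : ∀ j, ∀ q ∈ (ζ.graph j).naturalVertices,
    ∀ x ∈ ζ.fiber j q, ∀ y ∈ ζ.fiber j q,
      ζ.IsPreSingularity x → ζ.IsPreSingularity y → x = y
  not_natural_vertex : ∀ j, ∀ q ∉ (ζ.graph j).naturalVertices,
    ∀ x ∈ ζ.fiber j q, ¬ ζ.IsPreSingularity x
  no_three_star : ∀ j p I, ζ.IsStandardTurn j p I →
    ¬ ∃ c U, IsStarSet 3 c U ∧ ζ.proj j '' U = I
  turns : ∀ j p I, ζ.IsStandardTurn j p I →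
    ∀ L, ζ.IsSingularSegment L → ζ.LiesOver j I L →
      Xor (∀ i, ∃ L', ζ.Takes i (ζ.proj i '' L) L') (¬ ∃ L', ζ.Takes 0 (ζ.proj 0 '' L) L')

/-! ### Partial leaves -/

/-- Optimal points of a level graph: special points and mid-points of loops. -/
def IsOptimalPoint (j : ℕ) (x : ζ.Level j) : Prop :=
  ζ.IsSpecial j x ∨ x ∈ (ζ.graph j).loopMidpoints

/-- Pre-optimal star neighborhoods `V` with center `p`. -/
def IsPreOptimalStarNhd (j : ℕ) (p : ζ.Level j) (V : Set (ζ.Level j)) : Prop :=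
  ζ.IsStandardStarNhd j p V ∧ ζ.IsOptimalPoint j p ∧ ∀ x ∈ V, x ≠ p → ¬ ζ.IsOptimalPoint j x

/-- Optimal star neighborhoods: maximal pre-optimal ones with given center. -/
def IsOptimalStarNhd (j : ℕ) (p : ζ.Level j) (V : Set (ζ.Level j)) : Prop :=
  ζ.IsPreOptimalStarNhd j p V ∧ ∀ V', ζ.IsPreOptimalStarNhd j p V' → V ⊆ V' → V' = V

/-- Optimal leaf segments: non-singular plaques of level `0` optimal neighborhoods. -/
def IsOptimalLeafSegment (L : Set ζ.Solenoid) : Prop :=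
  (∃ p V, ζ.IsOptimalStarNhd 0 p V ∧ IsPlaqueOf (ζ.proj 0 ⁻¹' V) L) ∧
    ¬ ∃ s, ζ.IsSingularPlaque s L

/-- Concatenations of leaf segments: finite unions of optimal leaf segments, consecutive ones
overlapping at least in a leaf segment. -/
def IsConcatenation (S : Set ζ.Solenoid) : Prop :=
  ∃ (m : ℕ) (W : Fin (m + 1) → Set ζ.Solenoid),
    (∀ i, ζ.IsOptimalLeafSegment (W i)) ∧
    (∀ i : Fin m, ∃ N, ζ.IsLeafSegment N ∧ N ⊆ W i.castSucc ∩ W i.succ) ∧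
    S = ⋃ i, W i

/-- Leaf equivalence of points of the complement of the singularities. -/
def LeafEquivalent (x y : ζ.Solenoid) : Prop :=
  ∃ S, ζ.IsConcatenation S ∧ x ∈ S ∧ y ∈ S

/-- Partial leaves: leaf equivalence classes in the complement of the singularities. -/
def IsPartialLeaf (L : Set ζ.Solenoid) : Prop :=
  ∃ x ∉ ζ.sing, L = {y | y ∉ ζ.sing ∧ ζ.LeafEquivalent x y}

/-- Finite partial leaves: partial leaves that are covered by one concatenation of finitely
many optimal leaf segments. -/
def IsFinitePartialLeaf (L : Set ζ.Solenoid) : Prop :=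
  ζ.IsPartialLeaf L ∧ ζ.IsConcatenation L

/-! ### Transversals -/

/-- The turn tunnel of `I`: the union of the leaf segments that take `I`. -/
def tunnel (j : ℕ) (I : Set (ζ.Level j)) : Set ζ.Solenoid :=
  {x | ∃ L, ζ.Takes j I L ∧ x ∈ L}

/-- The central cross-section of the turn tunnel of `I`, where `p` is the center of `I`. -/
def crossSection (j : ℕ) (p : ζ.Level j) (I : Set (ζ.Level j)) : Set ζ.Solenoid :=
  ζ.fiber j p ∩ ζ.tunnel j I

/-- The canonical parameterization of the turn tunnel of `I`, as a relation: the parameter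
`(y, t)` is sent to the point `z` of the leaf segment through `y` that projects to `t`. -/
def TunnelParam (j : ℕ) (I : Set (ζ.Level j)) (y : ζ.Solenoid) (t : ζ.Level j)
    (z : ζ.Solenoid) : Prop :=
  ∃ L, ζ.Takes j I L ∧ y ∈ L ∧ z ∈ L ∧ ζ.proj j z = t

/-- The turn transversal over a point `q` of `I`. -/
def turnTransversal (j : ℕ) (p : ζ.Level j) (I : Set (ζ.Level j)) (q : ζ.Level j) :
    Set ζ.Solenoid :=
  {z | ∃ y ∈ ζ.crossSection j p I, ζ.TunnelParam j I y q z}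

/-- Flow maps of the turn tunnel of `I`: homeomorphisms `φ` from the central cross-section onto
a subset of the tunnel that move each `y` along its leaf segment to the parameter `σ y`. -/
def IsFlowMap (j : ℕ) (p : ζ.Level j) (I : Set (ζ.Level j))
    (φ : ζ.crossSection j p I → ζ.Solenoid) : Prop :=
  IsEmbedding φ ∧ ∃ σ : ζ.crossSection j p I → I, Continuous σ ∧
    ∀ y : ζ.crossSection j p I, ζ.TunnelParam j I y (σ y) (φ y)

/-- Transversals: images under flow maps of Borel subsets of central cross-sections. -/
def IsTransversal (F : Set ζ.Solenoid) : Prop :=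
  ∃ j p I, ζ.IsStandardTurn j p I ∧ ∃ φ, ζ.IsFlowMap j p I φ ∧
    ∃ H : Set (ζ.crossSection j p I), @MeasurableSet _ (borel (ζ.crossSection j p I)) H ∧ φ '' H = F

/-- `φ : F → F'` is a restriction of a flow map or of the inverse of a flow map. -/
def IsFlowStep {F F' : Set ζ.Solenoid} (φ : F ≃ₜ F') : Prop :=
  ∃ j p I, ζ.IsStandardTurn j p I ∧ ∃ Φ, ζ.IsFlowMap j p I Φ ∧
    ((∀ x : F, ∃ h : (x : ζ.Solenoid) ∈ ζ.crossSection j p I, (φ x : ζ.Solenoid) = Φ ⟨x, h⟩) ∨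
     (∀ x : F, ∃ h : (φ x : ζ.Solenoid) ∈ ζ.crossSection j p I, Φ ⟨φ x, h⟩ = x))

/-- Flow map compositions between transversals: finite compositions of one or more flow steps,
passing only through transversals that are contained in turn transversals. -/
inductive IsFlowComposition : {F F' : Set ζ.Solenoid} → (F ≃ₜ F') → Prop
  | single {F F' : Set ζ.Solenoid} (φ : F ≃ₜ F') (hF : ζ.IsTransversal F)
      (hF' : ζ.IsTransversal F') (hφ : ζ.IsFlowStep φ) : IsFlowComposition φ
  | cons {F F' F'' : Set ζ.Solenoid} (φ : F ≃ₜ F') (ψ : F' ≃ₜ F'') (hF : ζ.IsTransversal F)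
      (hF' : ∃ j p I, ζ.IsStandardTurn j p I ∧ ∃ q ∈ I, F' ⊆ ζ.turnTransversal j p I q)
      (hφ : ζ.IsFlowStep φ) (hψ : IsFlowComposition ψ) : IsFlowComposition (φ.trans ψ)

/-! ### Transverse measures -/

/-- Transverse semi-measures. Only the values of `μ` on transversals and on the singletons of
singularities are relevant. -/
structure IsTransverseSemiMeasure (μ : Set ζ.Solenoid → ℝ≥0) : Prop where
  /-- On the Borel subsets of a transversal, `μ` is a (finite) Borel measure. -/
  measure : ∀ F, ζ.IsTransversal F →
    ∃ m : @MeasureTheory.Measure F (borel F), ∀ B : Set F, @MeasurableSet _ (borel F) B →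
      m B = (μ (Subtype.val '' B) : ℝ≥0∞)
  /-- Flow map compositions preserve the measures. -/
  flow_invariant : ∀ (F F' : Set ζ.Solenoid) (φ : F ≃ₜ F'), ζ.IsFlowComposition φ →
    ∀ B : Set F, @MeasurableSet _ (borel F) B →
      μ (Subtype.val '' (φ '' B)) = μ (Subtype.val '' B)
  /-- The mass of a singularity is half the sum of the masses of points chosen one on each
  prong of a singular plaque. -/
  singular_mass : ∀ s P, ζ.IsSingularPlaque s P → ∀ A ⊆ P \ {s},
    (∀ Q, IsProng s P Q → ∃! y, y ∈ A ∩ Q) →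
      μ {s} = (∑ᶠ y ∈ A, μ {y}) / 2

/-- The open prongs of the singular plaques centered at `s`. -/
structure ProngAt (s : ζ.Solenoid) where
  plaque : Set ζ.Solenoid
  prong : Set ζ.Solenoid
  isSingularPlaque : ζ.IsSingularPlaque s plaque
  isProng : IsProng s plaque prong

/-- Prong-germ equivalence: the closures of the prongs in their plaques intersect in
an embedded half-closed interval containing `s`. -/
def ProngGermEquiv (s : ζ.Solenoid) (P Q : ζ.ProngAt s) : Prop :=
  s ∈ (closure P.prong ∩ P.plaque) ∩ (closure Q.prong ∩ Q.plaque) ∧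
    Nonempty (↥((closure P.prong ∩ P.plaque) ∩ (closure Q.prong ∩ Q.plaque)) ≃ₜ Ico (0 : ℝ) 1)

/-- The prong-germs attached to `s`. -/
def ProngGerm (s : ζ.Solenoid) : Type := Quot (ζ.ProngGermEquiv s)

/-- Turn weight systems: symmetric nonnegative functions, zero on the diagonal, on pairs of
prong-germs attached to the same singularity. -/
structure TurnWeightSystem where
  weight : ∀ s : ζ.sing, ζ.ProngGerm s → ζ.ProngGerm s → ℝ≥0
  diag : ∀ s P, weight s P P = 0
  symm : ∀ s P Q, weight s P Q = weight s Q P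

/-- Compatibility of a transverse semi-measure with a turn weight system. -/
def IsCompatible (μ : Set ζ.Solenoid → ℝ≥0) (W : ζ.TurnWeightSystem) : Prop :=
  ∀ (s : ζ.sing) (P : ζ.ProngAt s), ∀ y ∈ P.prong,
    HasSum (fun Q : ζ.ProngGerm s => W.weight s (Quot.mk _ P) Q) (μ {y})

/-- Transverse measures on the solenoid. -/
def IsTransverseMeasure (μ : Set ζ.Solenoid → ℝ≥0) : Prop :=
  ζ.IsTransverseSemiMeasure μ ∧ ∃ W : ζ.TurnWeightSystem, ζ.IsCompatible μ W

/-- Non-atomic: every point has mass zero. -/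
def IsNonAtomic (μ : Set ζ.Solenoid → ℝ≥0) : Prop := ∀ y : ζ.Solenoid, μ {y} = 0

/-! ### Mingling and expansion -/

/-- The natural edge `e'` of level `-k` mingles with the natural edge `e` of level `-j`. -/
def Mingles {j k : ℕ} (h : j ≤ k) (e' : (ζ.graph k).E) (e : (ζ.graph j).E) : Prop :=
  (ζ.down h '' (ζ.graph k).openEdge e' ∩ (ζ.graph j).openEdge e).Nonempty

/-- Full mingling. -/
def IsFullyMingling : Prop :=
  ∀ j, ∃ k, ∃ h : j < k, ∀ e' e, ζ.Mingles h.le e' e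

/-- Expanding: for each natural edge `e` of each level there is a lower level none of whose
natural edges mingling with `e` is mapped homeomorphically onto its image. -/
def IsExpanding : Prop :=
  ∀ j, ∀ e : (ζ.graph j).E, ∃ k, ∃ h : j < k, ∀ e' : (ζ.graph k).E, ζ.Mingles h.le e' e →
    ¬ IsEmbedding (((ζ.graph k).closedEdge e').domRestrict (ζ.down h.le))

end GraphTower

/-- Split sequences of rank `n`: inverse sequences of folds between core graphs of rank `n`, such
that no composition to level `0` has backtracking. -/
structure SplitSequence (n : ℕ) extends GraphTower where
  core : ∀ j, (graph j).IsCoreGraph n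
  fold : ∀ j, MetricGraph.IsFold (graph (j + 1)) (graph j) (bond j)
  no_backtracking : ∀ k, ∀ x ∉ (graph k).naturalVertices,
    ∃ U ∈ 𝓝 x, InjOn (toGraphTower.down (Nat.zero_le k)) U

end

/-! The index `j` stands for level `-j`, so larger indices are lower levels. Both conclusions of the
first part come from one obstruction, the leafwise set: a set `M` of regular points that contains
each plaque of a regular point over a fine star neighborhood which it meets, and that is finite on
the fibers of `π₀` over non-optimal points. An expanding sequence admits no nonempty leafwise set
(`IsLeafwise.not_isExpanding`). Over a fine star only finitely many lifts of prongs run inside `M`,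
and they cover the part of its closure over the star. By compactness finitely many lifts cover the
closure, so some projection `π_J` is injective on it. Now let `k > J` and let `e'` be an edge of
`G_k` whose interior meets `π_k(M)`. The image of the closure of `M` is open near its points inside
edges, and it is closed, so it contains all of `e'`. Since `π_J` factors through `π_k`, the map `G_k
→ G_J` is injective on `e'`, hence an embedding of it. So the edge of `G_J` through the image of a
suitable point of `M` violates expansion for every `k`.

A finite partial leaf is leafwise (`isLeafwise_of_isFinitePartialLeaf`): it is closed under leaf
equivalence and is a finite union of plaques. For a transverse measure and `c ≠ 0`, the regular
points of mass `c` form a leafwise set (`isLeafwise_mass`): flow invariance makes point masses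
constant along leaf segments, and a transversal has finite mass. So regular points have mass zero,
and a singularity has half the sum of the masses of regular points on its prongs.

These arguments rest on a description of plaques. Absence of backtracking gives unique path lifting
over the prongs of a standard star neighborhood, to lower levels and to the solenoid (`lift_unique`,
`exists_lift`, `exists_xlift`). At a point of level `m` over the center, the lifts correspond to the
directed edges leaving that point (`ncard_raysAt`). The stabilizing hypotheses imply that finitely
many and at least two lifts start at each point of the solenoid over the center
(`exists_ne_xraysAt`, `finite_xraysAt`), and that three or more lifts occur exactly at singularities
(`mem_sing_iff`). Plaques are the stars formed by these lifts.

For the second part (`isExpanding_of_isFullyMingling`), suppose first that arbitrarily low levels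
have a single natural vertex. An edge of such a level is a loop; were it embedded, its images would
be simple closed paths. One image covers an edge of an intermediate level, and by mingling a further
image meets several edges of a graph with one natural vertex. A simple closed path there stays in
one edge, a contradiction. Otherwise all low levels have at least three edges. An edge mingling with
all of them crosses one completely and passes a natural vertex besides, so the number of optimal
points over its interior grows without bound as the level drops. An edge embedded in `G_j` can only
pass boundedly many. -/

noncomputable section

/-! ### Topology of metric graphs -/

namespace MetricGraph

variable {G : MetricGraph}

theorem isOpen_iff {U : Set G.Point} : IsOpen U ↔ ∀ e, IsOpen (G.path e ⁻¹' U) := by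
  rw [isOpen_iSup_iff]; simp only [isOpen_coinduced]

theorem continuous_path (e : G.E) : Continuous (G.path e) :=
  continuous_def.2 fun _ hU => isOpen_iff.1 hU e

theorem continuous_of_path {Y : Type*} [TopologicalSpace Y] {f : G.Point → Y}
    (h : ∀ e, Continuous (f ∘ G.path e)) : Continuous f :=
  continuous_def.2 fun U hU => isOpen_iff.2 fun e => (h e).isOpen_preimage U hU

theorem continuous_along (d : G.E × Bool) : Continuous (G.along d) := by
  rcases d with ⟨e, _ | _⟩
  · have : G.along (e, false) = fun t => G.path e (G.len e - t) := by funext t; simp [along]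
    rw [this]; exact (continuous_path e).comp (continuous_sub_left (G.len e))
  · have : G.along (e, true) = G.path e := by funext t; simp [along]
    rw [this]; exact continuous_path e

theorem path_of_mem {e : G.E} {t : ℝ} (h : t ∈ Ioo 0 (G.len e)) :
    G.path e t = .inner e t h.1 h.2 := by simp [path, h.1, h.2]

theorem path_of_nonpos {e : G.E} {t : ℝ} (h : t ≤ 0) : G.path e t = .vertex (G.src e) := by
  simp [path, h.not_gt]

theorem path_of_len_le {e : G.E} {t : ℝ} (h : G.len e ≤ t) : G.path e t = .vertex (G.tgt e) := by
  simp [path, h.not_gt, (G.len_pos e).trans_le h]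

theorem mem_Ioo_of_path_eq_inner {e e' : G.E} {s t : ℝ} {h0 h1}
    (h : G.path e s = .inner e' t h0 h1) : e = e' ∧ s = t := by
  by_cases a : 0 < s
  · by_cases b : s < G.len e
    · rw [path_of_mem ⟨a, b⟩] at h; cases h; exact ⟨rfl, rfl⟩
    · rw [path_of_len_le (not_lt.1 b)] at h; cases h
  · rw [path_of_nonpos (not_lt.1 a)] at h; cases h

/-- The coordinate on the underlying edge of a parameter on a directed edge. -/
def coord (G : MetricGraph) (d : G.E × Bool) (t : ℝ) : ℝ := if d.2 then t else G.len d.1 - t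

theorem along_eq (d : G.E × Bool) (t : ℝ) : G.along d t = G.path d.1 (G.coord d t) := by
  unfold along coord; split_ifs <;> rfl

theorem coord_mem {d : G.E × Bool} {t : ℝ} :
    G.coord d t ∈ Ioo 0 (G.len d.1) ↔ t ∈ Ioo 0 (G.len d.1) := by
  unfold coord; split_ifs
  · rfl
  · constructor <;> rintro ⟨a, b⟩ <;> constructor <;> linarith

theorem coord_coord (d : G.E × Bool) (t : ℝ) : G.coord d (G.coord d t) = t := by
  unfold coord; split_ifs <;> simp

theorem coord_injective (d : G.E × Bool) : Function.Injective (G.coord d) :=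
  Function.LeftInverse.injective (coord_coord d)

theorem along_eq_inner {d : G.E × Bool} {t : ℝ} (h : t ∈ Ioo 0 (G.len d.1)) :
    G.along d t = .inner d.1 (G.coord d t) (coord_mem.2 h).1 (coord_mem.2 h).2 := by
  rw [along_eq, path_of_mem (coord_mem.2 h)]

theorem along_zero (d : G.E × Bool) : G.along d 0 = .vertex (G.start d) := by
  rcases d with ⟨e, _ | _⟩ <;> simp [along, start, path]
  simpa using fun h => absurd h (not_le.2 (G.len_pos e))

theorem along_eq_along {d d' : G.E × Bool} {t t' : ℝ} (ht : t ∈ Ioo 0 (G.len d.1))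
    (h : G.along d t = G.along d' t') : d.1 = d'.1 ∧ G.coord d t = G.coord d' t' := by
  rw [along_eq_inner ht, along_eq] at h
  obtain ⟨a, b⟩ := mem_Ioo_of_path_eq_inner h.symm
  exact ⟨a.symm, b.symm⟩

theorem along_injOn {d : G.E × Bool} {t t' : ℝ} (ht : t ∈ Ioo 0 (G.len d.1))
    (h : G.along d t = G.along d t') : t = t' :=
  coord_injective d (along_eq_along ht h).2

theorem along_mem_naturalVertices {d : G.E × Bool} {t : ℝ} :
    G.along d t ∈ G.naturalVertices ↔ t ∉ Ioo 0 (G.len d.1) := by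
  constructor
  · rintro ⟨v, hv⟩ ht
    rw [along_eq_inner ht] at hv; cases hv
  · intro h
    rw [← coord_mem, mem_Ioo, not_and_or, not_lt, not_lt] at h
    rw [along_eq]
    rcases h with h | h
    · rw [path_of_nonpos h]; exact ⟨_, rfl⟩
    · rw [path_of_len_le h]; exact ⟨_, rfl⟩

theorem isOpen_path_image {e : G.E} {O : Set ℝ} (hO : IsOpen O) (h : O ⊆ Ioo 0 (G.len e)) :
    IsOpen (G.path e '' O) := by
  refine isOpen_iff.2 fun e' => ?_
  by_cases he : e' = e
  · subst he
    convert hO using 1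
    ext t
    constructor
    · rintro ⟨s, hs, hst⟩
      rw [path_of_mem (h hs)] at hst
      rwa [(mem_Ioo_of_path_eq_inner hst.symm).2]
    · exact fun ht => ⟨t, ht, rfl⟩
  · convert isOpen_empty using 1
    ext t
    simp only [mem_preimage, mem_empty_iff_false, iff_false]
    rintro ⟨s, hs, hst⟩
    rw [path_of_mem (h hs)] at hst
    exact he (mem_Ioo_of_path_eq_inner hst.symm).1

theorem isOpen_along_image {d : G.E × Bool} {O : Set ℝ} (hO : IsOpen O)
    (h : O ⊆ Ioo 0 (G.len d.1)) : IsOpen (G.along d '' O) := by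
  have : G.along d '' O = G.path d.1 '' (G.coord d ⁻¹' O) := by
    ext x; constructor
    · rintro ⟨t, ht, rfl⟩
      exact ⟨G.coord d t, by simpa [coord_coord] using ht, (along_eq d t).symm⟩
    · rintro ⟨t, ht, rfl⟩
      exact ⟨_, ht, by rw [along_eq, coord_coord]⟩
  rw [this]
  refine isOpen_path_image (hO.preimage ?_) fun t ht => coord_mem.1 (h ht)
  unfold coord; split_ifs <;> fun_prop

theorem isOpen_openEdge (e : G.E) : IsOpen (G.openEdge e) := isOpen_path_image isOpen_Ioo subset_rfl

theorem exists_dart (v : G.V) : ∃ d : G.E × Bool, G.start d = v := by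
  have h := G.three_le_valence v
  have : Nonempty {d : G.E × Bool // (if d.2 then G.src d.1 else G.tgt d.1) = v} := by
    by_contra hn
    rw [not_nonempty_iff] at hn
    simp at h
  exact ⟨this.some.1, this.some.2⟩

theorem exists_along (x : G.Point) : ∃ d : G.E × Bool, ∃ t, 0 ≤ t ∧ t < G.len d.1 ∧ G.along d t = x := by
  rcases x with v | ⟨e, t, h0, h1⟩
  · obtain ⟨d, rfl⟩ := exists_dart v
    exact ⟨d, 0, le_rfl, G.len_pos _, along_zero d⟩
  · exact ⟨(e, true), t, h0.le, h1, by simp [along, path, h0, h1]⟩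

/-- The valence bound rules out isolated vertices, so the finitely many closed edges cover the
graph. -/
instance : CompactSpace G.Point := by
  have := G.finite_E
  refine ⟨?_⟩
  have : (univ : Set G.Point) = ⋃ d : G.E × Bool, G.along d '' Icc 0 (G.len d.1) := by
    symm; rw [eq_univ_iff_forall]
    intro x
    obtain ⟨d, t, h0, h1, rfl⟩ := exists_along x
    exact mem_iUnion.2 ⟨d, t, ⟨h0, h1.le⟩, rfl⟩
  rw [this]
  exact isCompact_iUnion fun d => isCompact_Icc.image (continuous_along d)

open Classical in
/-- A tent function supported near the point of parameter `t₀` of the edge `e₀`. -/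
def tent (e₀ : G.E) (t₀ δ : ℝ) : G.Point → ℝ
  | .vertex _ => 0
  | .inner e t _ _ => if e = e₀ then max 0 (1 - |t - t₀| / δ) else 0

theorem continuous_tent {e₀ : G.E} {t₀ δ : ℝ} (hδ : 0 < δ) (h0 : δ ≤ t₀) (h1 : δ ≤ G.len e₀ - t₀) :
    Continuous (tent (G := G) e₀ t₀ δ) := by
  refine continuous_of_path fun e => ?_
  by_cases he : e = e₀
  · subst he
    have : tent (G := G) e t₀ δ ∘ G.path e = fun t => max 0 (1 - |t - t₀| / δ) := by
      funext t
      by_cases ht : t ∈ Ioo 0 (G.len e)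
      · simp [path_of_mem ht, tent]
      · have hz : max 0 (1 - |t - t₀| / δ) = 0 := by
          refine max_eq_left ?_
          rw [sub_nonpos, one_le_div hδ]
          rw [mem_Ioo, not_and_or, not_lt, not_lt] at ht
          rcases ht with ht | ht
          · rw [abs_sub_comm]; exact le_trans (by linarith) (le_abs_self _)
          · exact le_trans (by linarith) (le_abs_self _)
        rw [hz]
        rw [mem_Ioo, not_and_or, not_lt, not_lt] at ht
        rcases ht with ht | ht
        · simp [path_of_nonpos ht, tent]
        · simp [path_of_len_le ht, tent]
    rw [this]; fun_prop
  · have : tent (G := G) e₀ t₀ δ ∘ G.path e = fun _ => 0 := by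
      funext t
      by_cases ht : t ∈ Ioo 0 (G.len e)
      · simp [path_of_mem ht, tent, he]
      · rw [mem_Ioo, not_and_or, not_lt, not_lt] at ht
        rcases ht with ht | ht
        · simp [path_of_nonpos ht, tent]
        · simp [path_of_len_le ht, tent]
    rw [this]; exact continuous_const

open Classical in
/-- The function with value one at a vertex, zero at the others, and affine on the edges. -/
def hat (v : G.V) : G.Point → ℝ
  | .vertex w => if w = v then 1 else 0
  | .inner e t _ _ => (1 - t / G.len e) * (if G.src e = v then 1 else 0) +
      t / G.len e * (if G.tgt e = v then 1 else 0)

theorem continuous_hat (v : G.V) : Continuous (hat v) := by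
  classical
  refine continuous_of_path fun e => ?_
  have hl := G.len_pos e
  have : hat v ∘ G.path e = fun t => (1 - max 0 (min 1 (t / G.len e))) *
      (if G.src e = v then 1 else 0) + max 0 (min 1 (t / G.len e)) *
      (if G.tgt e = v then 1 else 0) := by
    funext t
    by_cases ht : t ∈ Ioo 0 (G.len e)
    · have h1 : t / G.len e ≤ 1 := (div_le_one hl).2 ht.2.le
      have h0 : 0 ≤ t / G.len e := div_nonneg ht.1.le hl.le
      simp [path_of_mem ht, hat, h1, h0]
    · rw [mem_Ioo, not_and_or, not_lt, not_lt] at ht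
      rcases ht with ht | ht
      · have : t / G.len e ≤ 0 := div_nonpos_of_nonpos_of_nonneg ht hl.le
        simp [path_of_nonpos ht, hat, min_eq_right (this.trans zero_le_one), max_eq_left this]
      · have : 1 ≤ t / G.len e := (one_le_div hl).2 ht
        simp [path_of_len_le ht, hat, this]
  rw [this]; fun_prop

theorem exists_tent_ne {e : G.E} {t : ℝ} (h0 : 0 < t) (h1 : t < G.len e) {y : G.Point}
    (hy : Point.inner e t h0 h1 ≠ y) : ∃ f : G.Point → ℝ, Continuous f ∧ f (.inner e t h0 h1) ≠ f y := by
  have hδ : 0 < min t (G.len e - t) := lt_min h0 (sub_pos.2 h1)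
  -- This is the largest width for which the tent still vanishes at both ends of the edge.
  refine ⟨tent e t (min t (G.len e - t)), continuous_tent hδ (min_le_left _ _) (min_le_right _ _), ?_⟩
  rcases y with v | ⟨e', t', h0', h1'⟩
  · simp [tent]
  · by_cases he : e' = e
    · subst he
      have hne : t' ≠ t := by rintro rfl; exact hy rfl
      have : 0 < |t' - t| / min t (G.len e' - t) := div_pos (abs_pos.2 (sub_ne_zero.2 hne)) hδ
      simp only [tent, if_true, sub_self, abs_zero, zero_div, sub_zero, zero_le_one, max_eq_right]
      intro h
      rcases max_choice 0 (1 - |t' - t| / min t (G.len e' - t)) with h' | h' <;> rw [h'] at h <;>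
        linarith
    · simp [tent, he]

/-- Continuous real functions separate points: tents do so when one of the points is inside an edge,
and hats separate vertices. -/
instance : T2Space G.Point := by
  have key : ∀ x y : G.Point, x ≠ y → ∃ f : G.Point → ℝ, Continuous f ∧ f x ≠ f y := by
    intro x y hxy
    rcases x with v | ⟨e, t, h0, h1⟩
    · rcases y with w | ⟨e, t, h0, h1⟩
      · refine ⟨hat v, continuous_hat v, ?_⟩
        have : w ≠ v := by rintro rfl; exact hxy rfl
        simp [hat, this]
      · obtain ⟨f, hf, h⟩ := exists_tent_ne h0 h1 hxy.symm
        exact ⟨f, hf, h.symm⟩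
    · exact exists_tent_ne h0 h1 hxy
  refine ⟨fun x y hxy => ?_⟩
  obtain ⟨f, hf, h⟩ := key x y hxy
  exact separated_by_continuous hf h

/-! ### The arms at a point -/

/-- The directed edges that leave a point. -/
def arms : G.Point → Set (G.E × Bool)
  | .vertex v => {d | G.start d = v}
  | .inner e _ _ _ => {d | d.1 = e}

/-- The parameter of a point on a directed edge leaving it. -/
def armPos : G.Point → (G.E × Bool) → ℝ
  | .vertex _, _ => 0
  | .inner _ t _ _, d => G.coord d t

theorem armPos_nonneg {x : G.Point} {d} (hd : d ∈ arms x) : 0 ≤ armPos x d := by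
  rcases x with v | ⟨e, t, h0, h1⟩
  · exact le_rfl
  · cases hd; exact (coord_mem.2 ⟨h0, h1⟩).1.le

theorem armPos_lt {x : G.Point} {d} (hd : d ∈ arms x) : armPos x d < G.len d.1 := by
  rcases x with v | ⟨e, t, h0, h1⟩
  · exact G.len_pos _
  · cases hd; exact (coord_mem.2 ⟨h0, h1⟩).2

theorem along_armPos {x : G.Point} {d} (hd : d ∈ arms x) : G.along d (armPos x d) = x := by
  rcases x with v | ⟨e, t, h0, h1⟩
  · cases hd; exact along_zero d
  · cases hd; rw [armPos, along_eq, coord_coord, path_of_mem ⟨h0, h1⟩]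

theorem finite_arms (x : G.Point) : (arms x).Finite := by
  have := G.finite_E
  exact toFinite _

theorem two_le_ncard_arms (x : G.Point) : 2 ≤ (arms x).ncard := by
  have := G.finite_E
  rcases x with v | ⟨e, t, h0, h1⟩
  · exact le_trans (by norm_num) (G.three_le_valence v)
  · have : arms (.inner e t h0 h1) = {(e, true), (e, false)} := by
      ext ⟨e', b⟩; cases b <;> simp [arms]
    rw [this, ncard_pair (by simp)]

theorem ncard_arms_of_notMem {x : G.Point} (hx : x ∉ G.naturalVertices) : (arms x).ncard = 2 := by
  rcases x with v | ⟨e, t, h0, h1⟩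
  · exact absurd ⟨v, rfl⟩ hx
  · have : arms (.inner e t h0 h1) = {(e, true), (e, false)} := by
      ext ⟨e', b⟩; cases b <;> simp [arms]
    rw [this, ncard_pair (by simp)]

/-- The initial segment of length `r` of an arm, without its initial point. -/
def armSegment (x : G.Point) (d : G.E × Bool) (r : ℝ) : Set G.Point :=
  G.along d '' Ioo (armPos x d) (armPos x d + r)

/-- Openness is tested on the parameterizations of the edges. The delicate parameters are those of
`x` itself: inside the edge, or at or beyond one of its ends, where `path` is constant. In each case
the arms of `x` along that edge supply a neighborhood. -/
theorem isOpen_star {x : G.Point} {r : G.E × Bool → ℝ} (hr : ∀ d ∈ arms x, 0 < r d)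
    (hl : ∀ d ∈ arms x, armPos x d + r d ≤ G.len d.1) :
    IsOpen ({x} ∪ ⋃ d ∈ arms x, armSegment x d (r d)) := by
  set U := {x} ∪ ⋃ d ∈ arms x, armSegment x d (r d) with hU
  have hseg : ∀ d ∈ arms x, armSegment x d (r d) ⊆ U := fun d hd y hy =>
    Or.inr (mem_biUnion hd hy)
  refine isOpen_iff.2 fun e => isOpen_iff_mem_nhds.2 fun t ht => ?_
  by_cases hx : G.path e t = x
  · have key : ∀ b : Bool, (e, b) ∈ arms x → ∀ s, armPos x (e, b) < s →
        s < armPos x (e, b) + r (e, b) → G.path e (G.coord (e, b) s) ∈ U := by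
      intro b hb s h1 h2
      rw [← along_eq (e, b)]
      exact hseg _ hb ⟨s, ⟨h1, h2⟩, rfl⟩
    by_cases h : t ∈ Ioo 0 (G.len e)
    · rw [path_of_mem h] at hx
      have a1 : (e, true) ∈ arms x := by subst hx; simp [arms]
      have a2 : (e, false) ∈ arms x := by subst hx; simp [arms]
      have p1 : armPos x (e, true) = t := by subst hx; simp [armPos, coord]
      have p2 : armPos x (e, false) = G.len e - t := by subst hx; simp [armPos, coord]
      refine Filter.mem_of_superset (Ioo_mem_nhds (a := t - r (e, false)) (b := t + r (e, true))
        (by linarith [hr _ a2]) (by linarith [hr _ a1])) fun u hu => ?_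
      rcases lt_trichotomy u t with hut | rfl | hut
      · have := key false a2 (G.len e - u) (by rw [p2]; linarith) (by rw [p2]; linarith [hu.1])
        simpa [coord] using this
      · exact ht
      · have := key true a1 u (by rwa [p1]) (by rw [p1]; exact hu.2)
        simpa [coord] using this
    · rw [mem_Ioo, not_and_or, not_lt, not_lt] at h
      rcases h with h | h
      · rw [path_of_nonpos h] at hx
        have a1 : (e, true) ∈ arms x := by subst hx; simp [arms, start]
        have p1 : armPos x (e, true) = 0 := by subst hx; simp [armPos]
        refine Filter.mem_of_superset (Iio_mem_nhds
          (show t < r (e, true) from h.trans_lt (hr _ a1))) fun u hu => ?_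
        by_cases hu0 : u ≤ 0
        · left; simpa [path_of_nonpos hu0] using hx
        · have := key true a1 u (by rw [p1]; exact not_le.1 hu0) (by rw [p1, zero_add]; exact hu)
          simpa [coord] using this
      · rw [path_of_len_le h] at hx
        have a1 : (e, false) ∈ arms x := by subst hx; simp [arms, start]
        have p1 : armPos x (e, false) = 0 := by subst hx; simp [armPos]
        refine Filter.mem_of_superset (Ioi_mem_nhds
          (show G.len e - r (e, false) < t by linarith [hr _ a1])) fun u hu => ?_
        by_cases hu0 : G.len e ≤ u
        · left; simpa [path_of_len_le hu0] using hx
        · have hu' : G.len e - r (e, false) < u := hu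
          have := key false a1 (G.len e - u) (by rw [p1]; linarith) (by rw [p1]; linarith)
          simpa [coord] using this
  · rcases ht with ht | ht
    · exact absurd ht hx
    · obtain ⟨d, hd, hy⟩ := mem_iUnion₂.1 ht
      have ho : IsOpen (armSegment x d (r d)) := isOpen_along_image isOpen_Ioo
        (Ioo_subset_Ioo (armPos_nonneg hd) (hl d hd))
      exact Filter.mem_of_superset ((isOpen_iff.1 ho e).mem_nhds hy) fun u hu => hseg d hd hu

/-- Positive radii such that the arms of these lengths are disjoint. -/
structure IsArmRadius (x : G.Point) (r : G.E × Bool → ℝ) : Prop where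
  pos : ∀ d ∈ arms x, 0 < r d
  le_len : ∀ d ∈ arms x, armPos x d + r d ≤ G.len d.1
  le_half : ∀ d ∈ arms x, x ∈ G.naturalVertices → G.src d.1 = G.tgt d.1 → r d ≤ G.len d.1 / 2

/-- Distinct arms can only meet when they are the two directions of one edge. At a natural vertex
this edge is a loop, and the bound by half its length keeps the two ends apart; at an inner point
the arms move away from each other. -/
theorem IsArmRadius.eq_of_along_eq {x : G.Point} {r} (h : IsArmRadius x r) {d d'} (hd : d ∈ arms x)
    (hd' : d' ∈ arms x) {s s' : ℝ} (hs : s ∈ Ioo 0 (r d)) (hs' : s' ∈ Ioo 0 (r d'))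
    (he : G.along d (armPos x d + s) = G.along d' (armPos x d' + s')) : d = d' ∧ s = s' := by
  have hm : armPos x d + s ∈ Ioo 0 (G.len d.1) :=
    ⟨by linarith [armPos_nonneg hd, hs.1], by linarith [h.le_len d hd, hs.2]⟩
  obtain ⟨h1, h2⟩ := along_eq_along hm he
  by_cases hdd : d = d'
  · subst hdd
    have := along_injOn hm he
    exact ⟨rfl, by linarith⟩
  exfalso
  have hb : d.2 ≠ d'.2 := fun hb => hdd (Prod.ext h1 hb)
  obtain ⟨e, b⟩ := d
  obtain ⟨e', b'⟩ := d'
  obtain rfl : e = e' := h1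
  have ha := h.le_half _ hd
  have ha' := h.le_half _ hd'
  rcases x with v | ⟨e₀, t, h0, h1⟩
  · have e1 : G.start (e, b) = v := hd
    have e2 : G.start (e, b') = v := hd'
    have hloop : G.src e = G.tgt e := by
      cases b <;> cases b' <;> simp_all [start]
    have i1 := ha ⟨v, rfl⟩ hloop
    have i2 := ha' ⟨v, rfl⟩ hloop
    have i3 := hs.2
    have i4 := hs'.2
    simp only at i1 i2
    cases b <;> cases b' <;> simp_all [coord, armPos] <;> linarith
  · obtain rfl : e = e₀ := hd
    have i1 := hs.1
    have i2 := hs'.1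
    cases b <;> cases b' <;> simp_all [coord, armPos] <;> linarith

end MetricGraph

/-! ### Auxiliary results on the real line and on connected sets -/

/-- Equal values at two points force a local extremum strictly between them, but a continuous
function that is injective near a point is strictly monotone there. -/
theorem injOn_Ioo_of_locally_injOn {φ : ℝ → ℝ} {a b : ℝ} (hc : ContinuousOn φ (Ioo a b))
    (hl : ∀ u ∈ Ioo a b, ∃ U ∈ 𝓝 u, InjOn φ U) : InjOn φ (Ioo a b) := by
  have key : ∀ x ∈ Ioo a b, ∀ y ∈ Ioo a b, x < y → φ x ≠ φ y := by
    intro x hx y hy hxy he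
    have hsub : Icc x y ⊆ Ioo a b := fun z hz => ⟨hx.1.trans_le hz.1, hz.2.trans_lt hy.2⟩
    obtain ⟨c, hcm, hext⟩ := exists_isLocalExtr_Ioo hxy (hc.mono hsub) he
    have hcab : c ∈ Ioo a b := hsub ⟨hcm.1.le, hcm.2.le⟩
    obtain ⟨U, hU, hinj⟩ := hl c hcab
    obtain ⟨δ, hδ, hball⟩ := Metric.mem_nhds_iff.1 (Filter.inter_mem hU (isOpen_Ioo.mem_nhds hcab))
    have hI : Icc (c - δ / 2) (c + δ / 2) ⊆ U ∩ Ioo a b := fun z hz => hball (by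
      rw [Metric.mem_ball, Real.dist_eq, abs_lt]; constructor <;> linarith [hz.1, hz.2])
    have hmono := ContinuousOn.strictMonoOn_of_injOn_Icc' (by linarith)
      (hc.mono fun z hz => (hI hz).2) (hinj.mono fun z hz => (hI hz).1)
    have near : ∀ P : ℝ → Prop, (∀ᶠ z in 𝓝 c, P z) → ∃ z w, z ∈ Icc (c - δ / 2) (c + δ / 2) ∧
        w ∈ Icc (c - δ / 2) (c + δ / 2) ∧ z < c ∧ c < w ∧ P z ∧ P w := by
      intro P hP
      obtain ⟨ε, hε, hb⟩ := Metric.eventually_nhds_iff.1 hP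
      have h1 := min_le_left (δ / 2) (ε / 2)
      have h2 := min_le_right (δ / 2) (ε / 2)
      have h3 : 0 < min (δ / 2) (ε / 2) := lt_min (by linarith) (by linarith)
      refine ⟨c - min (δ / 2) (ε / 2), c + min (δ / 2) (ε / 2), ⟨by linarith, by linarith⟩,
        ⟨by linarith, by linarith⟩, by linarith, by linarith, hb ?_, hb ?_⟩
      · rw [Real.dist_eq, abs_lt]; constructor <;> linarith
      · rw [Real.dist_eq, abs_lt]; constructor <;> linarith
    have hcm' : c ∈ Icc (c - δ / 2) (c + δ / 2) := ⟨by linarith, by linarith⟩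
    rcases hext with hext | hext <;> obtain ⟨z, w, hz, hw, hzc, hcw, h1, h2⟩ := near _ hext <;>
      rcases hmono with hm | hm
    · exact absurd h1 (not_le.2 (hm hz hcm' hzc))
    · exact absurd h2 (not_le.2 (hm hcm' hw hcw))
    · exact absurd h2 (not_le.2 (hm hcm' hw hcw))
    · exact absurd h1 (not_le.2 (hm hz hcm' hzc))
  intro x hx y hy he
  rcases lt_trichotomy x y with h | h | h
  · exact absurd he (key x hx y hy h)
  · exact h
  · exact absurd he.symm (key y hy x hx h)

/-- Two paths in the line that start at the same point and stay on one side of it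
meet again. -/
theorem exists_common_value {f g : ℝ → ℝ} {δ ε c : ℝ} (hδ : 0 < δ) (hε : 0 < ε)
    (hf : ContinuousOn f (Icc 0 δ)) (hg : ContinuousOn g (Icc 0 ε)) (hf0 : f 0 = c) (hg0 : g 0 = c)
    (hfδ : c < f δ) (hgε : c < g ε) : ∃ s ∈ Ioc 0 δ, ∃ t ∈ Ioc 0 ε, f s = g t := by
  set v := min (f δ) (g ε)
  have hv : c < v := lt_min hfδ hgε
  obtain ⟨s, hs, hsv⟩ := intermediate_value_Icc hδ.le hf ⟨hf0.le.trans hv.le, min_le_left _ _⟩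
  obtain ⟨t, ht, htv⟩ := intermediate_value_Icc hε.le hg ⟨hg0.le.trans hv.le, min_le_right _ _⟩
  refine ⟨s, ⟨lt_of_le_of_ne hs.1 ?_, hs.2⟩, t, ⟨lt_of_le_of_ne ht.1 ?_, ht.2⟩, hsv.trans htv.symm⟩
  · rintro rfl; exact hv.ne (hf0.symm.trans hsv)
  · rintro rfl; exact hv.ne (hg0.symm.trans htv)

/-- Three paths in the line that start at the same point are not disjoint. -/
theorem not_three_disjoint_paths {g : Fin 3 → ℝ → ℝ} {δ c : ℝ} (hδ : 0 < δ)
    (hg : ∀ i, ContinuousOn (g i) (Icc 0 δ)) (h0 : ∀ i, g i 0 = c) (hne : ∀ i, g i δ ≠ c)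
    (hd : ∀ i k, i ≠ k → ∀ s ∈ Ioc 0 δ, ∀ t ∈ Ioc 0 δ, g i s ≠ g k t) : False := by
  have pos : ∀ i k, i ≠ k → c < g i δ → ¬ c < g k δ := by
    intro i k hik hi hk
    obtain ⟨s, hs, t, ht, h⟩ := exists_common_value hδ hδ (hg i) (hg k) (h0 i) (h0 k) hi hk
    exact hd i k hik s hs t ht h
  have neg : ∀ i k, i ≠ k → g i δ < c → ¬ g k δ < c := by
    intro i k hik hi hk
    obtain ⟨s, hs, t, ht, h⟩ := exists_common_value hδ hδ (f := fun s => -g i s) (g := fun s => -g k s) (c := -c)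
      (hg i).neg (hg k).neg (congrArg Neg.neg (h0 i)) (congrArg Neg.neg (h0 k))
      (neg_lt_neg hi) (neg_lt_neg hk)
    exact hd i k hik s hs t ht (neg_injective h)
  have := pos 0 1 (by decide); have := pos 0 2 (by decide); have := pos 1 2 (by decide)
  have := neg 0 1 (by decide); have := neg 0 2 (by decide); have := neg 1 2 (by decide)
  rcases (hne 0).lt_or_gt with a | a <;> rcases (hne 1).lt_or_gt with b | b <;>
    rcases (hne 2).lt_or_gt with d | d <;> tauto

section Cover
variable {Y : Type*} [TopologicalSpace Y]

/-- The open sets need only be disjoint on `Q`. This is the standard device below for confining a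
connected set to one prong, one lift or one star. -/
theorem IsPreconnected.subset_of_disjoint_cover {ι : Type*} {Q : Set Y} (hQ : IsPreconnected Q)
    {O : ι → Set Y} (hO : ∀ i, IsOpen (O i)) (hc : Q ⊆ ⋃ i, O i)
    (hd : ∀ i k, i ≠ k → ∀ y ∈ Q, y ∈ O i → y ∉ O k) {i : ι} {x : Y} (hx : x ∈ Q) (hxi : x ∈ O i) :
    Q ⊆ O i := by
  rcases isPreconnected_iff_subset_of_disjoint.1 hQ (O i) (⋃ k : {k // k ≠ i}, O k) (hO i)
    (isOpen_iUnion fun k => hO k) (fun y hy => by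
      obtain ⟨k, hk⟩ := mem_iUnion.1 (hc hy)
      by_cases h : k = i
      · exact Or.inl (h ▸ hk)
      · exact Or.inr (mem_iUnion.2 ⟨⟨k, h⟩, hk⟩)) (by
      rw [eq_empty_iff_forall_notMem]
      rintro y ⟨hy, hy1, hy2⟩
      obtain ⟨k, hk⟩ := mem_iUnion.1 hy2
      exact hd i k (fun h => k.2 h.symm) y hy hy1 hk) with h | h
  · exact h
  · obtain ⟨k, hk⟩ := mem_iUnion.1 (h hx)
    exact absurd hk (hd i k (fun h => k.2 h.symm) x hx hxi)

end Cover

/-! ### Star sets described by their prongs -/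

/-- The parameter interval of a half-open prong. -/
abbrev Ray : Type := Ico (0 : ℝ) 1

namespace Ray

/-- The initial parameter. -/
def zero : Ray := ⟨0, le_rfl, one_pos⟩

/-- The middle parameter. -/
def half : Ray := ⟨1 / 2, by norm_num, by norm_num⟩

theorem half_ne : half ≠ zero := fun h => by
  have := congrArg Subtype.val h; norm_num [half, zero] at this

theorem ne_zero_iff {t : Ray} : t ≠ zero ↔ 0 < (t : ℝ) := by
  rw [lt_iff_le_and_ne]
  exact ⟨fun h => ⟨t.2.1, fun h' => h (Subtype.ext h'.symm)⟩, fun h h' => h.2 (by rw [h']; rfl)⟩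

/-- The positive parameters are connected. -/
theorem isPreconnected_pos : IsPreconnected {t : Ray | t ≠ zero} := by
  rw [← IsInducing.subtypeVal.isPreconnected_image]
  have : Subtype.val '' {t : Ray | t ≠ zero} = Ioo (0 : ℝ) 1 := by
    ext t; constructor
    · rintro ⟨t, ht, rfl⟩; exact ⟨ne_zero_iff.1 ht, t.2.2⟩
    · rintro ht; exact ⟨⟨t, ht.1.le, ht.2⟩, ne_zero_iff.2 ht.1, rfl⟩
  rw [this]
  exact isPreconnected_Ioo

theorem isOpen_pos : IsOpen {t : Ray | t ≠ zero} := isOpen_ne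

/-- Two continuous maps to a Hausdorff space that agree at positive parameters agree. -/
theorem funext_of_pos {Y : Type*} [TopologicalSpace Y] [T2Space Y] {f g : Ray → Y}
    (hf : Continuous f) (hg : Continuous g) (h : ∀ t, t ≠ zero → f t = g t) : f = g := by
  refine hf.ext_on (s := {t : Ray | t ≠ zero}) ?_ hg h
  intro t
  by_cases ht : t = zero
  · subst ht
    rw [Metric.mem_closure_iff]
    intro ε hε
    have h1 := min_le_left (ε / 2) (1 / 2)
    have h2 := min_le_right (ε / 2) (1 / 2)
    have h3 : 0 < min (ε / 2) (1 / 2) := lt_min (by linarith) (by norm_num)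
    refine ⟨⟨min (ε / 2) (1 / 2), h3.le, by linarith⟩, ne_zero_iff.2 h3, ?_⟩
    rw [Subtype.dist_eq, Real.dist_eq]
    simp only [zero, zero_sub, abs_neg, abs_of_pos h3]; linarith
  · exact subset_closure ht

end Ray

section StarLemmas

variable {Y : Type*} [TopologicalSpace Y] {n : ℕ}

/-- The point at distance `t` on the prong `i` of the model star. -/
def starPoint (i : Fin n) (t : Ray) : starModel n := ⟨Pi.single i t, i, t, t.2, rfl⟩

theorem continuous_starPoint (i : Fin n) : Continuous (starPoint i) :=
  Continuous.subtype_mk (f := fun t : Ray => (Pi.single i (t : ℝ) : Fin n → ℝ))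
    ((continuous_single i).comp continuous_subtype_val) _

theorem exists_starPoint (x : starModel n) : ∃ i t, x = starPoint i t := by
  obtain ⟨i, t, ht, h⟩ := x.2
  exact ⟨i, ⟨t, ht⟩, Subtype.ext h⟩

theorem starPoint_apply_self (i : Fin n) (t : Ray) : (starPoint i t : Fin n → ℝ) i = t := by
  simp [starPoint]

theorem starPoint_apply_ne {i k : Fin n} (h : k ≠ i) (t : Ray) :
    (starPoint i t : Fin n → ℝ) k = 0 := by
  simp [starPoint, h]

theorem starPoint_zero (i k : Fin n) : starPoint i Ray.zero = starPoint k Ray.zero := by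
  refine Subtype.ext ?_; simp [starPoint, Ray.zero]

theorem starPoint_val_eq_zero {i : Fin n} {t : Ray} :
    (starPoint i t : Fin n → ℝ) = 0 ↔ t = Ray.zero := by
  constructor
  · intro h
    have := congrFun h i
    rw [starPoint_apply_self] at this
    exact Subtype.ext this
  · rintro rfl; simp [starPoint, Ray.zero]

theorem starPoint_inj {i k : Fin n} {s t : Ray} (h : starPoint i s = starPoint k t) :
    s = t ∧ (s = Ray.zero ∨ i = k) := by
  by_cases hik : i = k
  · subst hik
    have := congrFun (congrArg Subtype.val h) i
    rw [starPoint_apply_self, starPoint_apply_self] at this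
    exact ⟨Subtype.ext this, Or.inr rfl⟩
  · have h1 := congrFun (congrArg Subtype.val h) i
    have h2 := congrFun (congrArg Subtype.val h) k
    rw [starPoint_apply_self, starPoint_apply_ne hik] at h1
    rw [starPoint_apply_self, starPoint_apply_ne (Ne.symm hik)] at h2
    have e1 : s = Ray.zero := Subtype.ext h1
    have e2 : t = Ray.zero := Subtype.ext h2.symm
    exact ⟨e1.trans e2.symm, Or.inl e1⟩

theorem modelProng_eq (i : Fin n) : modelProng i = starPoint i '' {t | t ≠ Ray.zero} := by
  ext x
  constructor
  · rintro ⟨t, ht, h⟩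
    exact ⟨⟨t, ht.1.le, ht.2⟩, Ray.ne_zero_iff.2 ht.1, Subtype.ext h.symm⟩
  · rintro ⟨t, ht, rfl⟩
    exact ⟨t, ⟨Ray.ne_zero_iff.1 ht, t.2.2⟩, rfl⟩

theorem image_modelProng {Z : Type*} (h : starModel n → Z) (i : Fin n) :
    h '' modelProng i = (fun t => h (starPoint i t)) '' {t | t ≠ Ray.zero} := by
  rw [modelProng_eq, image_image]

theorem isOpen_starPoint_image (i : Fin n) {O : Set Ray} (hO : IsOpen O) (h0 : Ray.zero ∉ O) :
    IsOpen (starPoint i '' O) := by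
  obtain ⟨O', hO', rfl⟩ := isOpen_induced_iff.1 hO
  have : starPoint i '' (Subtype.val ⁻¹' O') =
      (fun x : starModel n => (x : Fin n → ℝ) i) ⁻¹' (O' ∩ Ioi 0) := by
    ext x
    constructor
    · rintro ⟨t, ht, rfl⟩
      simp only [mem_preimage, starPoint_apply_self]
      exact ⟨ht, Ray.ne_zero_iff.1 (by rintro rfl; exact h0 ht)⟩
    · obtain ⟨k, t, rfl⟩ := exists_starPoint x
      rintro ⟨h1, h2⟩
      by_cases hik : i = k
      · subst hik
        simp only [starPoint_apply_self] at h1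
        exact ⟨t, h1, rfl⟩
      · simp only [starPoint_apply_ne hik, mem_Ioi, lt_irrefl] at h2
  rw [this]
  exact (hO'.inter isOpen_Ioi).preimage ((continuous_apply i).comp continuous_subtype_val)

/-- For `r > 0` the core is cut out of the model by the conditions that all coordinates are less
than `r`. -/
theorem isOpen_starCore (r : ℝ) : IsOpen {x : starModel n | ∃ i, ∃ t : Ray, (t : ℝ) < r ∧ x = starPoint i t} := by
  by_cases hr : 0 < r
  · have : {x : starModel n | ∃ i, ∃ t : Ray, (t : ℝ) < r ∧ x = starPoint i t} =
        ⋂ i, (fun x : starModel n => (x : Fin n → ℝ) i) ⁻¹' Iio r := by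
      ext x
      obtain ⟨k, t, rfl⟩ := exists_starPoint x
      simp only [mem_iInter, mem_preimage, mem_Iio]
      constructor
      · rintro ⟨i, s, hs, h⟩ l
        rw [h]
        by_cases hil : l = i
        · subst hil; rwa [starPoint_apply_self]
        · rwa [starPoint_apply_ne hil]
      · intro h
        have := h k
        rw [starPoint_apply_self] at this
        exact ⟨k, t, this, rfl⟩
    rw [this]
    exact isOpen_iInter_of_finite fun i => isOpen_Iio.preimage
      ((continuous_apply i).comp continuous_subtype_val)
  · convert isOpen_empty using 1
    ext x
    simp only [mem_ofPred_eq, mem_empty_iff_false, iff_false]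
    rintro ⟨i, t, ht, -⟩
    exact hr (t.2.1.trans_lt ht)

/-- The chart glues the rays. It is continuous because the axes form a finite closed cover of the
model; continuity of the inverse is what `hpiece` and `hcore` provide. Both conditions are relative
to `S`, so that the criterion applies to open stars in graphs and also to stars in the solenoid that
need not be open. -/
theorem exists_isStarChart_of_rays (hn : 2 ≤ n) {p : Y} {S : Set Y} {β : Fin n → Ray → Y}
    (hc : ∀ i, Continuous (β i)) (h0 : ∀ i, β i Ray.zero = p)
    (hinj : ∀ i k s t, β i s = β k t → s = t ∧ (s = Ray.zero ∨ i = k))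
    (hS : S = {y | ∃ i t, β i t = y})
    (hpiece : ∀ i (t : Ray), t ≠ Ray.zero → ∀ N ∈ 𝓝 t, β i '' N ∈ 𝓝[S] (β i t))
    (hcore : ∀ r : ℝ, 0 < r → {y | ∃ i, ∃ t : Ray, (t : ℝ) < r ∧ β i t = y} ∈ 𝓝[S] p) :
    ∃ h, IsStarChart n p S h ∧ ∀ i t, h (starPoint i t) = β i t := by
  choose I R hIR using fun x : starModel n => exists_starPoint x
  set h : starModel n → Y := fun x => β (I x) (R x) with hh
  have hval : ∀ i t, h (starPoint i t) = β i t := by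
    intro i t
    obtain ⟨h1, h2⟩ := starPoint_inj (hIR (starPoint i t))
    simp only [hh, ← h1]
    rcases h2 with rfl | h2
    · rw [h0, h0]
    · rw [← h2]
  have hinj' : Function.Injective h := by
    intro x y hxy
    obtain ⟨h1, h2⟩ := hinj _ _ _ _ hxy
    rw [hIR x, hIR y, ← h1]
    rcases h2 with h2 | h2
    · rw [h2]; exact starPoint_zero _ _
    · rw [h2]
  have hcont : Continuous h := by
    let C : Fin n → Set (starModel n) := fun i => {x | ∀ k, k ≠ i → (x : Fin n → ℝ) k = 0}
    refine (locallyFinite_of_finite C).continuous ?_ ?_ ?_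
    · rw [eq_univ_iff_forall]
      intro x
      obtain ⟨i, t, rfl⟩ := exists_starPoint x
      exact mem_iUnion.2 ⟨i, fun k hk => starPoint_apply_ne hk t⟩
    · intro i
      have : C i = ⋂ k, ⋂ (_ : k ≠ i), (fun x : starModel n => (x : Fin n → ℝ) k) ⁻¹' {0} := by
        ext x; simp [C]
      rw [this]
      exact isClosed_iInter fun k => isClosed_iInter fun _ => isClosed_singleton.preimage
        ((continuous_apply k).comp continuous_subtype_val)
    · intro i
      have hx : ∀ x ∈ C i, (x : Fin n → ℝ) i ∈ Ico (0 : ℝ) 1 ∧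
          ∀ hm, h x = β i ⟨(x : Fin n → ℝ) i, hm⟩ := by
        intro x hx
        obtain ⟨k, t, rfl⟩ := exists_starPoint x
        by_cases hik : k = i
        · subst hik
          rw [starPoint_apply_self]
          exact ⟨t.2, fun _ => hval _ _⟩
        · have := hx k hik
          rw [starPoint_apply_self] at this
          have ht : t = Ray.zero := Subtype.ext this
          subst ht
          rw [starPoint_apply_ne (Ne.symm hik)]
          exact ⟨⟨le_rfl, one_pos⟩, fun _ => by rw [hval, h0]; exact (h0 i).symm⟩
      rw [continuousOn_iff_continuous_domRestrict]
      have : (C i).domRestrict h = fun x : C i => β i ⟨((x : starModel n) : Fin n → ℝ) i, (hx x.1 x.2).1⟩ := by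
        funext x; exact (hx x.1 x.2).2 _
      rw [this]
      exact (hc i).comp ((((continuous_apply i).comp continuous_subtype_val).comp
        continuous_subtype_val).subtype_mk _)
  refine ⟨h, ⟨hn, ⟨?_, hinj'⟩, ?_, ?_⟩, hval⟩
  · rw [Topology.isInducing_iff_nhds]
    intro x
    refine le_antisymm (Filter.map_le_iff_le_comap.1 hcont.continuousAt) fun N hN => ?_
    rw [Filter.mem_comap]
    obtain ⟨i, t, rfl⟩ := exists_starPoint x
    rw [hval]
    by_cases ht : t = Ray.zero
    · subst ht
      obtain ⟨O, hO, hON⟩ := mem_nhds_subtype _ _ _ |>.1 hN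
      obtain ⟨r, hr, hb⟩ := Metric.mem_nhds_iff.1 hO
      obtain ⟨U, hU, hUS⟩ := mem_nhdsWithin_iff_exists_mem_nhds_inter.1 (hcore r hr)
      rw [h0]
      refine ⟨U, hU, fun y hy => ?_⟩
      obtain ⟨k, s, rfl⟩ := exists_starPoint y
      rw [mem_preimage, hval] at hy
      obtain ⟨l, s', hs', he⟩ := hUS ⟨hy, hS ▸ ⟨k, s, rfl⟩⟩
      have hss := (hinj _ _ _ _ he).1
      subst hss
      refine hON (hb ?_)
      rw [starPoint_val_eq_zero.2 rfl, mem_ball_zero_iff, pi_norm_lt_iff hr]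
      intro l
      by_cases hl : l = k
      · subst hl; rw [starPoint_apply_self, Real.norm_of_nonneg s'.2.1]; exact hs'
      · rw [starPoint_apply_ne hl]; simpa using hr
    · have hN' : starPoint i ⁻¹' N ∩ {t | t ≠ Ray.zero} ∈ 𝓝 t :=
        Filter.inter_mem ((continuous_starPoint i).continuousAt hN) (Ray.isOpen_pos.mem_nhds ht)
      obtain ⟨U, hU, hUS⟩ := mem_nhdsWithin_iff_exists_mem_nhds_inter.1 (hpiece i t ht _ hN')
      refine ⟨U, hU, fun y hy => ?_⟩
      obtain ⟨k, s, rfl⟩ := exists_starPoint y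
      rw [mem_preimage, hval] at hy
      obtain ⟨s', hs', he⟩ := hUS ⟨hy, hS ▸ ⟨k, s, rfl⟩⟩
      obtain ⟨h1, h2⟩ := hinj _ _ _ _ he
      subst h1
      rcases h2 with h2 | h2
      · exact absurd h2 hs'.2
      · subst h2; exact hs'.1
  · rw [hS]
    ext y
    constructor
    · rintro ⟨x, rfl⟩; exact ⟨_, _, rfl⟩
    · rintro ⟨i, t, rfl⟩; exact ⟨_, hval i t⟩
  · intro x
    obtain ⟨i, t, rfl⟩ := exists_starPoint x
    rw [hval, starPoint_val_eq_zero, ← h0 i]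
    exact ⟨fun h => (hinj _ _ _ _ h).1, fun h => by rw [h]⟩

namespace IsStarChart

variable {p : Y} {S : Set Y} {h : starModel n → Y}

theorem apply_zero (H : IsStarChart n p S h) (i : Fin n) : h (starPoint i Ray.zero) = p :=
  (H.2.2.2 _).2 (starPoint_val_eq_zero.2 rfl)

theorem mem_iff (H : IsStarChart n p S h) {y : Y} : y ∈ S ↔ ∃ i t, h (starPoint i t) = y := by
  rw [← H.2.2.1]
  constructor
  · rintro ⟨x, rfl⟩
    obtain ⟨i, t, rfl⟩ := exists_starPoint x
    exact ⟨i, t, rfl⟩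
  · rintro ⟨i, t, rfl⟩; exact ⟨_, rfl⟩

theorem inj (H : IsStarChart n p S h) {i k : Fin n} {s t : Ray}
    (he : h (starPoint i s) = h (starPoint k t)) : s = t ∧ (s = Ray.zero ∨ i = k) :=
  starPoint_inj (H.2.1.injective he)

theorem center_mem (H : IsStarChart n p S h) : p ∈ S :=
  H.mem_iff.2 ⟨⟨0, two_pos.trans_le H.1⟩, Ray.zero, H.apply_zero _⟩

theorem isPreconnected_prong (H : IsStarChart n p S h) (i : Fin n) :
    IsPreconnected (h '' modelProng i) := by
  rw [image_modelProng]
  exact Ray.isPreconnected_pos.image _ (H.2.1.continuous.comp (continuous_starPoint i)).continuousOn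

theorem exists_isOpen_prong (H : IsStarChart n p S h) (i : Fin n) :
    ∃ O, IsOpen O ∧ ∀ y ∈ S, y ∈ O ↔ y ∈ h '' modelProng i := by
  have ho : IsOpen (modelProng i : Set (starModel n)) := by
    rw [modelProng_eq]; exact isOpen_starPoint_image i Ray.isOpen_pos (fun h => h rfl)
  obtain ⟨O, hO, hOe⟩ := H.2.1.isInducing.isOpen_iff.1 ho
  refine ⟨O, hO, fun y hy => ?_⟩
  rw [← H.2.2.1] at hy
  obtain ⟨x, rfl⟩ := hy
  rw [H.2.1.injective.mem_set_image, ← hOe, mem_preimage]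

/-- Away from the center the prongs are disjoint, relatively open and cover the star. -/
theorem subset_prong (H : IsStarChart n p S h) {Q : Set Y} (hQ : IsPreconnected Q)
    (hQS : Q ⊆ S) (hp : p ∉ Q) {i : Fin n} {x : Y} (hx : x ∈ Q) (hxi : x ∈ h '' modelProng i) :
    Q ⊆ h '' modelProng i := by
  choose O hO hOi using H.exists_isOpen_prong
  have hsub := hQ.subset_of_disjoint_cover hO (fun y hy => by
      obtain ⟨k, t, rfl⟩ := H.mem_iff.1 (hQS hy)
      refine mem_iUnion.2 ⟨k, (hOi k _ (hQS hy)).2 ?_⟩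
      rw [image_modelProng]
      exact ⟨t, fun ht => hp (by rw [ht, H.apply_zero] at hy; exact hy), rfl⟩) (fun k l hkl y hy hk hl => by
      rw [hOi _ _ (hQS hy), image_modelProng] at hk hl
      obtain ⟨s, hs, rfl⟩ := hk
      obtain ⟨t, ht, he⟩ := hl
      rcases (H.inj he).2 with h2 | h2
      · exact ht h2
      · exact hkl h2.symm) hx ((hOi i x (hQS hx)).2 hxi)
  exact fun y hy => (hOi i y (hQS hy)).1 (hsub hy)

/-- The prongs of a star set with given center do not depend on the chart. -/
theorem eq_prong (H : IsStarChart n p S h) {Q : Set Y} (hQ : IsProng p S Q) :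
    ∃ i, Q = h '' modelProng i := by
  obtain ⟨m, h', k, H', rfl⟩ := hQ
  have hx : h' (starPoint k Ray.half) ∈ S := H'.mem_iff.2 ⟨_, _, rfl⟩
  have hxk : h' (starPoint k Ray.half) ∈ h' '' modelProng k := by
    rw [image_modelProng]; exact ⟨_, Ray.half_ne, rfl⟩
  have notMem : ∀ {m : ℕ} {h' : starModel m → Y} (_ : IsStarChart m p S h') k,
      p ∉ h' '' modelProng k := by
    intro m h' H' k
    rw [image_modelProng]; rintro ⟨t, ht, he⟩
    rw [← H'.apply_zero k] at he
    exact ht (H'.inj he).1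
  have sub : ∀ {m : ℕ} {h' : starModel m → Y} (_ : IsStarChart m p S h') k,
      h' '' modelProng k ⊆ S := by
    rintro m h' H' k _ ⟨x, -, rfl⟩
    rw [← H'.2.2.1]; exact ⟨x, rfl⟩
  obtain ⟨i, t, ht⟩ := H.mem_iff.1 hx
  have hxi : h' (starPoint k Ray.half) ∈ h '' modelProng i := by
    rw [image_modelProng]
    refine ⟨t, fun h0 => ?_, ht⟩
    rw [h0, H.apply_zero] at ht
    exact notMem H' k (ht ▸ hxk)
  exact ⟨i, (H.subset_prong (H'.isPreconnected_prong k) (sub H' k) (notMem H' k) hxk hxi).antisymm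
    (H'.subset_prong (H.isPreconnected_prong i) (sub H i) (notMem H i) hxi hxk)⟩

end IsStarChart

/-- A two-pronged star set embeds in the line, with its center at zero. -/
theorem IsStarSet.exists_real {p : Y} {S : Set Y} (H : IsStarSet 2 p S) :
    ∃ κ : S → ℝ, Continuous κ ∧ Function.Injective κ := by
  obtain ⟨h, H⟩ := H
  have e : starModel 2 ≃ₜ S := H.2.1.toHomeomorph.trans (Homeomorph.setCongr H.2.2.1)
  -- The difference of the coordinates unrolls the two half-axes into a line.
  let f : starModel 2 → ℝ := fun x => (x : Fin 2 → ℝ) 0 - (x : Fin 2 → ℝ) 1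
  have hf : Continuous f := by
    refine Continuous.sub ?_ ?_ <;> exact (continuous_apply _).comp continuous_subtype_val
  refine ⟨f ∘ e.symm, hf.comp e.symm.continuous, Function.Injective.comp ?_ e.symm.injective⟩
  intro x y hxy
  have c : ∀ x : starModel 2, ((x : Fin 2 → ℝ) 0 = 0 ∧ 0 ≤ (x : Fin 2 → ℝ) 1) ∨
      ((x : Fin 2 → ℝ) 1 = 0 ∧ 0 ≤ (x : Fin 2 → ℝ) 0) := by
    intro x
    obtain ⟨i, t, rfl⟩ := exists_starPoint x
    have := t.2.1
    fin_cases i <;> simp [starPoint, this]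
  simp only [f] at hxy
  refine Subtype.ext (funext fun k => ?_)
  rcases c x with ⟨a, b⟩ | ⟨a, b⟩ <;> rcases c y with ⟨a', b'⟩ | ⟨a', b'⟩ <;>
    fin_cases k <;> simp <;> linarith

/-- No three disjoint paths issue from a point of a two-pronged star set. -/
theorem IsStarSet.not_three_rays {p : Y} {S : Set Y} (H : IsStarSet 2 p S) {β : Fin 3 → Ray → Y}
    {y : Y} {r : Ray} (hr : r ≠ Ray.zero) (hc : ∀ i, Continuous (β i)) (h0 : ∀ i, β i Ray.zero = y)
    (hinj : ∀ i k s t, β i s = β k t → s = t ∧ (s = Ray.zero ∨ i = k))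
    (hS : ∀ i t, t ≤ r → β i t ∈ S) : False := by
  obtain ⟨κ, hκ, hκi⟩ := H.exists_real
  have hr0 : 0 < (r : ℝ) := Ray.ne_zero_iff.1 hr
  have hm : ∀ s : ℝ, s ∈ Icc 0 (r : ℝ) → s ∈ Ico (0 : ℝ) 1 := fun s hs => ⟨hs.1, hs.2.trans_lt r.2.2⟩
  -- Clamping the parameter to `[0, r]` gives paths defined on the whole line that never leave `S`.
  let c : ℝ → Ray := fun s => ⟨max 0 (min s r), le_max_left _ _,
    max_lt one_pos ((min_le_right _ _).trans_lt r.2.2)⟩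
  have hcc : Continuous c := Continuous.subtype_mk (by fun_prop) _
  have hcr : ∀ s, c s ≤ r := fun s => max_le r.2.1 (min_le_right _ _)
  have hcs : ∀ s ∈ Icc 0 (r : ℝ), (c s : ℝ) = s := fun s hs => by
    simp [c, min_eq_left hs.2, max_eq_right hs.1]
  have hcz : c 0 = Ray.zero := Subtype.ext (hcs 0 ⟨le_rfl, hr0.le⟩)
  have hy : y ∈ S := h0 0 ▸ hS 0 Ray.zero r.2.1
  have hval : ∀ i s k t, κ ⟨β i (c s), hS i _ (hcr s)⟩ = κ ⟨β k (c t), hS k _ (hcr t)⟩ →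
      c s = c t ∧ (c s = Ray.zero ∨ i = k) := fun i s k t h =>
    hinj _ _ _ _ (congrArg Subtype.val (hκi h))
  refine not_three_disjoint_paths (g := fun i s => κ ⟨β i (c s), hS i _ (hcr s)⟩) (c := κ ⟨y, hy⟩)
    hr0 (fun i => ((hκ.comp (((hc i).comp hcc).subtype_mk _))).continuousOn) ?_ ?_ ?_
  · intro i
    congr 1
    exact Subtype.ext ((congrArg (β i) hcz).trans (h0 i))
  · intro i h
    have : β i (c r) = β i Ray.zero := (congrArg Subtype.val (hκi h)).trans (h0 i).symm
    have := congrArg Subtype.val (hinj _ _ _ _ this).1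
    rw [hcs _ ⟨hr0.le, le_rfl⟩] at this
    exact hr0.ne' this
  · intro i k hik s hs t ht h
    rcases (hval i s k t h).2 with h2 | h2
    · have := congrArg Subtype.val h2
      rw [hcs _ ⟨hs.1.le, hs.2⟩] at this
      exact hs.1.ne' this
    · exact hik h2

end StarLemmas

/-! ### Finite sets of points in graphs and fibers of folds -/

namespace MetricGraph

theorem finite_naturalVertices (G : MetricGraph) : G.naturalVertices.Finite := by
  have := G.finite_V
  exact finite_range _

theorem finite_loopMidpoints (G : MetricGraph) : G.loopMidpoints.Finite := by
  have := G.finite_E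
  refine (finite_range fun e => G.path e (G.len e / 2)).subset ?_
  rintro x ⟨e, -, rfl⟩
  exact ⟨e, rfl⟩

/-- A fold identifies at most two points. -/
theorem IsFold.two_to_one {G H : MetricGraph} {f : G.Point → H.Point} (hf : MetricGraph.IsFold G H f)
    {x y z : G.Point} (hxy : f x = f y) (hxz : f x = f z) : x = y ∨ x = z ∨ y = z := by
  obtain ⟨d₁, d₂, L, hs, hL, -, -, hdis, -, hid, -⟩ := hf
  by_contra! hne
  obtain ⟨h1, h2, h3⟩ := hne
  have key : ∀ x y, f x = f y → x ≠ y → ∃ t ∈ Ioc 0 L,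
      (x = G.along d₁ t ∧ y = G.along d₂ t) ∨ (x = G.along d₂ t ∧ y = G.along d₁ t) := by
    intro x y h hn
    obtain ⟨t, ht, h⟩ := ((hid x y).1 h).resolve_left hn
    refine ⟨t, ⟨lt_of_le_of_ne ht.1 ?_, ht.2⟩, h⟩
    rintro rfl
    rw [along_zero, along_zero, hs] at h
    rcases h with ⟨a, b⟩ | ⟨a, b⟩ <;> exact hn (a.trans b.symm)
  have dis : ∀ w, ∀ s ∈ Ioc 0 L, ∀ t ∈ Ioc 0 L, w = G.along d₁ s → w = G.along d₂ t → False := by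
    rintro w s hs t ht rfl h
    exact disjoint_left.1 hdis ⟨s, hs, rfl⟩ ⟨t, ht, h.symm⟩
  obtain ⟨r, hr, hr'⟩ := key x y hxy h1
  obtain ⟨s, hs, hs'⟩ := key x z hxz h2
  obtain ⟨t, ht, ht'⟩ := key y z (hxy.symm.trans hxz) h3
  -- There are three points and two segments: in each of the eight patterns one of the points lies
  -- on both segments at positive parameters.
  rcases hr' with ⟨a, b⟩ | ⟨a, b⟩ <;> rcases hs' with ⟨c, d⟩ | ⟨c, d⟩ <;>
    rcases ht' with ⟨e, g⟩ | ⟨e, g⟩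
  · exact dis y t ht r hr e b
  · exact dis z t ht s hs g d
  · exact dis x r hr s hs a c
  · exact dis x r hr s hs a c
  · exact dis x s hs r hr c a
  · exact dis x s hs r hr c a
  · exact dis z s hs t ht d g
  · exact dis y r hr t ht b e

end MetricGraph

/-! ### Bonding maps, projections and special points -/

namespace GraphTower

variable (ζ : GraphTower)

theorem down_self {j : ℕ} (h : j ≤ j) (x : ζ.Level j) : ζ.down h x = x := by
  unfold down; rw [Nat.leRecOn_self]; rfl

theorem down_succ {j k : ℕ} (h : j ≤ k) (h' : j ≤ k + 1) (x : ζ.Level (k + 1)) :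
    ζ.down h' x = ζ.down h (ζ.bond k x) := by
  unfold down; rw [Nat.leRecOn_succ h]; rfl

theorem down_down {i j k : ℕ} (hij : i ≤ j) (hjk : j ≤ k) (x : ζ.Level k) :
    ζ.down hij (ζ.down hjk x) = ζ.down (hij.trans hjk) x := by
  induction k, hjk using Nat.le_induction with
  | base => rw [down_self]
  | succ k hjk ih => rw [down_succ ζ hjk, down_succ ζ (hij.trans hjk), ih]

theorem bond_down {j k : ℕ} (h : j + 1 ≤ k) (x : ζ.Level k) :
    ζ.bond j (ζ.down h x) = ζ.down (Nat.le_of_succ_le h) x := by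
  rw [← down_down ζ (Nat.le_succ j) h, down_succ ζ le_rfl, down_self]

theorem down_proj {j k : ℕ} (h : j ≤ k) (x : ζ.Solenoid) : ζ.down h (ζ.proj k x) = ζ.proj j x := by
  induction k, h using Nat.le_induction with
  | base => rw [down_self]
  | succ k hjk ih => rw [down_succ ζ hjk, ← ih]; congr 1; exact x.2 k

theorem proj_eq_of_le {j k : ℕ} (h : j ≤ k) {x y : ζ.Solenoid} (hxy : ζ.proj k x = ζ.proj k y) :
    ζ.proj j x = ζ.proj j y := by
  rw [← down_proj ζ h, hxy, down_proj]

theorem ext_of_le (j : ℕ) {x y : ζ.Solenoid} (h : ∀ m, j ≤ m → ζ.proj m x = ζ.proj m y) : x = y := by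
  refine Subtype.ext (funext fun m => ?_)
  exact ζ.proj_eq_of_le (le_max_right j m) (h _ (le_max_left j m))

theorem exists_proj_ne {x y : ζ.Solenoid} (h : x ≠ y) : ∃ j, ∀ m, j ≤ m → ζ.proj m x ≠ ζ.proj m y := by
  by_contra! hc
  refine h (ζ.ext_of_le 0 fun m _ => ?_)
  obtain ⟨k, hk, he⟩ := hc m
  exact ζ.proj_eq_of_le hk he

/-- A finite set of points is separated by some projection. -/
theorem exists_injOn_proj {A : Set ζ.Solenoid} (hA : A.Finite) :
    ∃ j, ∀ m, j ≤ m → InjOn (ζ.proj m) A := by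
  induction A, hA using Set.Finite.induction_on with
  | empty => exact ⟨0, fun m _ => injOn_empty _⟩
  | @insert a s ha hs ih =>
    obtain ⟨j, hj⟩ := ih
    have : ∃ J, ∀ b ∈ s, ∀ m, J ≤ m → ζ.proj m a ≠ ζ.proj m b := by
      choose! J hJ using fun b (hb : b ∈ s) => ζ.exists_proj_ne (x := a) (y := b)
        (fun h => ha (h ▸ hb))
      obtain ⟨K, hK⟩ := (hs.image J).bddAbove
      exact ⟨K, fun b hb m hm => hJ b hb m ((hK (mem_image_of_mem _ hb)).trans hm)⟩
    obtain ⟨J, hJ⟩ := this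
    refine ⟨max j J, fun m hm => (injOn_insert ha).2 ⟨hj m ((le_max_left _ _).trans hm), ?_⟩⟩
    rintro ⟨b, hb, he⟩
    exact hJ b hb m ((le_max_right _ _).trans hm) he.symm

theorem continuous_proj (j : ℕ) : Continuous (ζ.proj j) :=
  (continuous_apply j).comp continuous_subtype_val

theorem continuous_rng {Y : Type*} [TopologicalSpace Y] {f : Y → ζ.Solenoid}
    (h : ∀ m, Continuous fun y => ζ.proj m (f y)) : Continuous f :=
  Continuous.subtype_mk (f := fun y m => ζ.proj m (f y)) (continuous_pi h) fun y => (f y).2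

instance : T2Space ζ.Solenoid :=
  inferInstanceAs (T2Space {x : ∀ j, ζ.Level j // ∀ j, ζ.bond j (x (j + 1)) = x j})

theorem IsSpecial.down {j i : ℕ} (h : i ≤ j) {x : ζ.Level j} (hx : ζ.IsSpecial j x) :
    ζ.IsSpecial i (ζ.down h x) := by
  rcases hx with ⟨k, hk, hv⟩ | ⟨k, hk, v, hv, rfl⟩
  · rcases le_total k i with hki | hik
    · exact Or.inl ⟨k, hki, by rwa [ζ.down_down]⟩
    · exact Or.inr ⟨k, hik, _, hv, ζ.down_down _ _ _⟩
  · exact Or.inr ⟨k, h.trans hk, v, hv, (ζ.down_down _ _ _).symm⟩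

theorem isSpecial_of_mem {j : ℕ} {x : ζ.Level j} (hx : x ∈ (ζ.graph j).naturalVertices) :
    ζ.IsSpecial j x := Or.inl ⟨j, le_rfl, by rwa [down_self]⟩

/-- If a point lies below a natural vertex, it is special. -/
theorem isSpecial_down {j k : ℕ} (h : j ≤ k) {v : ζ.Level k} (hv : v ∈ (ζ.graph k).naturalVertices) :
    ζ.IsSpecial j (ζ.down h v) := Or.inr ⟨k, h, v, hv, rfl⟩

/-- The optimal points of the top graph. -/
def opt : Set (ζ.Level 0) := {x | ζ.IsOptimalPoint 0 x}

variable {ζ}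

theorem IsSpecial.mem_opt {j : ℕ} {x : ζ.Level j} (h : ζ.IsSpecial j x) :
    ζ.down (Nat.zero_le j) x ∈ ζ.opt := Or.inl (IsSpecial.down ζ _ h)

/-- A special point of the top graph is one of its natural vertices or the image of a natural vertex
of a lower level. Properness bounds the latter. -/
theorem IsProper.finite_opt (h : ζ.IsProper) : ζ.opt.Finite := by
  have h1 := ((ζ.graph 0).finite_naturalVertices.union h).union (ζ.graph 0).finite_loopMidpoints
  refine h1.subset ?_
  rintro x (hx | hx)
  · left
    rcases hx with ⟨i, hi, hv⟩ | ⟨k, hk, v, hv, rfl⟩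
    · left
      obtain rfl : i = 0 := by omega
      rwa [ζ.down_self] at hv
    · rcases Nat.eq_zero_or_pos k with rfl | hk'
      · left; rwa [ζ.down_self]
      · exact Or.inr ⟨k, hk', v, hv, rfl⟩
  · exact Or.inr hx

end GraphTower

/-! ### Consequences of folding and of the absence of backtracking -/

namespace SplitSequence

variable {n : ℕ} (ζ : SplitSequence n)

theorem continuous_bond (j : ℕ) : Continuous (ζ.bond j) := by
  obtain ⟨-, -, -, -, -, -, -, -, h, -⟩ := ζ.fold j
  exact h.continuous

theorem surjective_bond (j : ℕ) : Function.Surjective (ζ.bond j) := by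
  obtain ⟨-, -, -, -, -, -, -, -, h, -⟩ := ζ.fold j
  exact h.surjective

theorem continuous_down {j k : ℕ} (h : j ≤ k) : Continuous (ζ.down h) := by
  induction k, h using Nat.le_induction with
  | base => exact continuous_id.congr fun x => (ζ.down_self _ x).symm
  | succ k h ih =>
    exact (ih.comp (ζ.continuous_bond k)).congr fun x => (ζ.down_succ h _ x).symm

/-- Each fold is at most two-to-one, so the fibers of a composition remain finite. -/
theorem finite_fiber {j k : ℕ} (h : j ≤ k) (y : ζ.Level j) : {x | ζ.down h x = y}.Finite := by
  induction k, h using Nat.le_induction with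
  | base => exact (finite_singleton y).subset fun x hx => by simpa [ζ.down_self] using hx
  | succ k h ih =>
    have : {x | ζ.down (Nat.le_succ_of_le h) x = y} ⊆
        ⋃ z ∈ {z | ζ.down h z = y}, {x | ζ.bond k x = z} := by
      intro x hx
      rw [mem_ofPred_eq, ζ.down_succ h] at hx
      exact mem_biUnion (x := ζ.bond k x) hx rfl
    refine (ih.biUnion fun z _ => ?_).subset this
    by_cases hz : ∃ a b, a ≠ b ∧ ζ.bond k a = z ∧ ζ.bond k b = z
    · obtain ⟨a, b, hab, ha, hb⟩ := hz
      refine (toFinite {a, b}).subset fun c hc => ?_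
      have hc' : ζ.bond k c = z := hc
      rcases (ζ.fold k).two_to_one (ha.trans hb.symm) (ha.trans hc'.symm) with h | h | h
      · exact absurd h hab
      · exact Or.inl h.symm
      · exact Or.inr h.symm
    · push Not at hz
      refine Set.Subsingleton.finite fun a ha b hb => ?_
      by_contra hab
      exact hz a b hab ha hb

theorem finite_preimage {j k : ℕ} (h : j ≤ k) {A : Set (ζ.Level j)} (hA : A.Finite) :
    {x | ζ.down h x ∈ A}.Finite :=
  (hA.biUnion fun y _ => ζ.finite_fiber h y).subset fun _ hx => mem_biUnion hx rfl

/-- Injectivity of the composition to level `0` on a set passes to its first factor. -/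
theorem exists_injOn_down {j k : ℕ} (h : j ≤ k) {x : ζ.Level k} (hx : x ∉ (ζ.graph k).naturalVertices) :
    ∃ U ∈ 𝓝 x, InjOn (ζ.down h) U := by
  obtain ⟨U, hU, hi⟩ := ζ.no_backtracking k x hx
  refine ⟨U, hU, fun a ha b hb hab => hi ha hb ?_⟩
  have := congrArg (ζ.down (Nat.zero_le j)) hab
  rwa [ζ.down_down, ζ.down_down] at this

instance : CompactSpace ζ.Solenoid := by
  refine isCompact_iff_compactSpace.1 (IsClosed.isCompact (X := ∀ j, ζ.Level j)
    (s := {x | ∀ j, ζ.bond j (x (j + 1)) = x j}) ?_)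
  rw [ofPred_forall]
  exact isClosed_iInter fun j => isClosed_eq ((ζ.continuous_bond j).comp (continuous_apply _))
    (continuous_apply j)

/-- Sections of the surjective bonding maps, iterated, provide the coordinates at indices above `k`;
the other coordinates are images of `x`. -/
theorem proj_surjective (k : ℕ) : Function.Surjective (ζ.proj k) := by
  intro x
  choose s hs using fun m => ζ.surjective_bond m
  let up : ∀ {m : ℕ}, k ≤ m → ζ.Level m := fun {m} h =>
    Nat.leRecOn (C := fun i => ζ.Level i) h (fun {i} g => s i g) x
  have hup : ∀ {m : ℕ} (h : k ≤ m), ζ.bond m (up (Nat.le_succ_of_le h)) = up h := by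
    intro m h
    simp only [up]
    rw [Nat.leRecOn_succ h, hs]
  refine ⟨⟨fun m => if h : k ≤ m then up h else ζ.down (not_le.1 h).le x, fun m => ?_⟩, ?_⟩
  · beta_reduce
    by_cases h : k ≤ m
    · rw [dif_pos (show k ≤ m + 1 from Nat.le_succ_of_le h), dif_pos h]
      exact hup h
    · rw [dif_neg h]
      by_cases h' : k ≤ m + 1
      · obtain rfl : k = m + 1 := by omega
        rw [dif_pos h', ζ.down_succ le_rfl, ζ.down_self]
        simp only [up, Nat.leRecOn_self]
      · rw [dif_neg h', ζ.bond_down]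
  · simp only [GraphTower.proj, le_refl, dif_pos, up]
    exact Nat.leRecOn_self _

end SplitSequence

/-! ### Standard star neighborhoods and paths crossing a prong -/

namespace GraphTower

/-- A standard star neighborhood of a level graph, presented by its half-open prongs. -/
structure StdStar (ζ : GraphTower) (j : ℕ) where
  N : ℕ
  two_le : 2 ≤ N
  center : ζ.Level j
  ray : Fin N → Ray → ζ.Level j
  continuous_ray : ∀ i, Continuous (ray i)
  ray_zero : ∀ i, ray i Ray.zero = center
  ray_inj : ∀ i k s t, ray i s = ray k t → s = t ∧ (s = Ray.zero ∨ i = k)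
  isOpen_piece : ∀ i O, IsOpen O → Ray.zero ∉ O → IsOpen (ray i '' O)
  isOpen_core : ∀ r : ℝ, 0 < r → IsOpen {x | ∃ i, ∃ t : Ray, (t : ℝ) < r ∧ ray i t = x}
  not_special : ∀ i t, t ≠ Ray.zero → ¬ ζ.IsSpecial j (ray i t)

namespace StdStar

variable {ζ : GraphTower} {j : ℕ} (V : ζ.StdStar j)

/-- The points of a standard star neighborhood. -/
def carrier : Set (ζ.Level j) := {x | ∃ i t, V.ray i t = x}

/-- Some prong of a standard star neighborhood. -/
def someRay : Fin V.N := ⟨0, two_pos.trans_le V.two_le⟩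

theorem ray_mem (i : Fin V.N) (t : Ray) : V.ray i t ∈ V.carrier := ⟨i, t, rfl⟩

theorem center_mem : V.center ∈ V.carrier := ⟨V.someRay, Ray.zero, V.ray_zero _⟩

theorem isOpen_carrier : IsOpen V.carrier := by
  convert V.isOpen_core 1 one_pos using 1
  ext x; constructor
  · rintro ⟨i, t, rfl⟩; exact ⟨i, t, t.2.2, rfl⟩
  · rintro ⟨i, t, -, rfl⟩; exact ⟨i, t, rfl⟩

theorem ray_eq_center {i : Fin V.N} {t : Ray} : V.ray i t = V.center ↔ t = Ray.zero := by
  constructor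
  · intro h; rw [← V.ray_zero i] at h; exact (V.ray_inj _ _ _ _ h).1
  · rintro rfl; exact V.ray_zero i

theorem exists_chart : ∃ h, IsStarChart V.N V.center V.carrier h ∧
    ∀ i t, h (starPoint i t) = V.ray i t := by
  refine exists_isStarChart_of_rays V.two_le V.continuous_ray V.ray_zero V.ray_inj rfl ?_ ?_
  · intro i t ht M hM
    obtain ⟨O, hOM, hO, htO⟩ := mem_nhds_iff.1 (Filter.inter_mem hM (Ray.isOpen_pos.mem_nhds ht))
    refine mem_nhdsWithin_of_mem_nhds (Filter.mem_of_superset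
      ((V.isOpen_piece i O hO fun h => (hOM h).2 rfl).mem_nhds ⟨t, htO, rfl⟩) ?_)
    exact image_mono fun s hs => (hOM hs).1
  · intro r hr
    exact mem_nhdsWithin_of_mem_nhds ((V.isOpen_core r hr).mem_nhds
      ⟨V.someRay, Ray.zero, hr, V.ray_zero _⟩)

theorem isStandardStarNhd : ζ.IsStandardStarNhd j V.center V.carrier := by
  obtain ⟨h, H, -⟩ := V.exists_chart
  refine ⟨⟨_, h, H⟩, V.isOpen_carrier, ?_⟩
  rintro _ ⟨i, t, rfl⟩ hne
  exact V.not_special i t fun h0 => hne (V.ray_eq_center.2 h0)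

theorem isStandardTurn {i k : Fin V.N} (hik : i ≠ k) :
    ζ.IsStandardTurn j V.center (range (V.ray i) ∪ range (V.ray k)) := by
  obtain ⟨h, H, hr⟩ := V.exists_chart
  refine ⟨_, V.isStandardStarNhd, _, h, i, k, H, hik, ?_⟩
  have : ∀ i, h '' modelProng i = V.ray i '' {t | t ≠ Ray.zero} := fun i => by
    rw [image_modelProng]; simp only [hr]
  have hc : ∀ i, range (V.ray i) = V.ray i '' {t | t ≠ Ray.zero} ∪ {V.center} := fun i => by
    ext x; constructor
    · rintro ⟨t, rfl⟩
      by_cases ht : t = Ray.zero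
      · right; exact V.ray_eq_center.2 ht
      · left; exact ⟨t, ht, rfl⟩
    · rintro (⟨t, -, rfl⟩ | rfl)
      · exact ⟨t, rfl⟩
      · exact ⟨_, V.ray_zero i⟩
  rw [this, this, hc, hc]
  ext x; simp only [mem_union]; tauto

theorem _root_.GraphTower.IsStandardStarNhd.exists_stdStar {p : ζ.Level j} {U : Set (ζ.Level j)}
    (h : ζ.IsStandardStarNhd j p U) : ∃ V : ζ.StdStar j, V.center = p ∧ V.carrier = U := by
  obtain ⟨⟨n, f, H⟩, hU, hs⟩ := h
  have hopen : IsOpenMap f := by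
    refine IsOpenEmbedding.isOpenMap ⟨H.2.1, ?_⟩
    rwa [H.2.2.1]
  refine ⟨⟨n, H.1, p, fun i t => f (starPoint i t), fun i => H.2.1.continuous.comp
    (continuous_starPoint i), H.apply_zero, fun i k s t he => H.inj he, ?_, ?_, ?_⟩, rfl, ?_⟩
  · intro i O hO h0
    have := hopen _ (isOpen_starPoint_image i hO h0)
    rwa [image_image] at this
  · intro r hr
    convert hopen _ (isOpen_starCore (n := n) r) using 1
    ext x; constructor
    · rintro ⟨i, t, ht, rfl⟩; exact ⟨_, ⟨i, t, ht, rfl⟩, rfl⟩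
    · rintro ⟨_, ⟨i, t, ht, rfl⟩, rfl⟩; exact ⟨i, t, ht, rfl⟩
  · intro i t ht
    refine hs _ (H.mem_iff.2 ⟨i, t, rfl⟩) fun h0 => ht ?_
    rw [← H.apply_zero i] at h0
    exact (H.inj h0).1
  · ext x; rw [H.mem_iff]; rfl

open Classical in
/-- The parameter of a point of a standard star neighborhood on its prong. -/
def rad (x : ζ.Level j) : Ray := if h : ∃ t, ∃ i, V.ray i t = x then h.choose else Ray.zero

theorem rad_ray (i : Fin V.N) (t : Ray) : V.rad (V.ray i t) = t := by
  have h : ∃ s, ∃ k, V.ray k s = V.ray i t := ⟨t, i, rfl⟩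
  rw [rad, dif_pos h]
  obtain ⟨k, hk⟩ := h.choose_spec
  exact (V.ray_inj _ _ _ _ hk).1

theorem continuousOn_rad : ContinuousOn V.rad V.carrier := by
  rintro _ ⟨i, t, rfl⟩
  refine ContinuousAt.continuousWithinAt ?_
  intro M hM
  rw [rad_ray] at hM
  rw [Filter.mem_map]
  by_cases ht : t = Ray.zero
  · subst ht
    obtain ⟨r, hr, hb⟩ := Metric.mem_nhds_iff.1 hM
    refine Filter.mem_of_superset ((V.isOpen_core r hr).mem_nhds ⟨i, Ray.zero, hr, rfl⟩) ?_
    rintro _ ⟨k, s, hs, rfl⟩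
    rw [mem_preimage, rad_ray]
    refine hb ?_
    rw [Metric.mem_ball, Subtype.dist_eq, Real.dist_eq]
    simpa [Ray.zero, abs_of_nonneg s.2.1] using hs
  · obtain ⟨O, hOM, hO, htO⟩ := mem_nhds_iff.1 (Filter.inter_mem hM (Ray.isOpen_pos.mem_nhds ht))
    refine Filter.mem_of_superset
      ((V.isOpen_piece i O hO fun h => (hOM h).2 rfl).mem_nhds ⟨t, htO, rfl⟩) ?_
    rintro _ ⟨s, hs, rfl⟩
    rw [mem_preimage, rad_ray]
    exact (hOM hs).1

/-- The open prong. -/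
def prong (i : Fin V.N) : Set (ζ.Level j) := V.ray i '' {t | t ≠ Ray.zero}

theorem isOpen_prong (i : Fin V.N) : IsOpen (V.prong i) :=
  V.isOpen_piece i _ Ray.isOpen_pos fun h => h rfl

theorem prong_subset (i : Fin V.N) : V.prong i ⊆ V.carrier := by
  rintro _ ⟨t, -, rfl⟩; exact V.ray_mem i t

theorem ray_rad {i : Fin V.N} {x : ζ.Level j} (hx : x ∈ V.prong i) : V.ray i (V.rad x) = x := by
  obtain ⟨t, -, rfl⟩ := hx
  rw [rad_ray]

theorem rad_ne_zero {i : Fin V.N} {x : ζ.Level j} (hx : x ∈ V.prong i) : V.rad x ≠ Ray.zero := by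
  obtain ⟨t, ht, rfl⟩ := hx
  rwa [rad_ray]

/-- A path crossing a prong monotonically can be reparameterized by the prong. -/
theorem exists_reparam_of_strictMonoOn {i : Fin V.N} {g : ℝ → ζ.Level j} (hg : Continuous g) {a b : ℝ}
    (hab : a < b) (ha : g a ∉ V.prong i) (hb : g b ∉ V.prong i) (hm : ∀ u ∈ Ioo a b, g u ∈ V.prong i)
    (hmono : StrictMonoOn (fun u => V.rad (g u)) (Ioo a b)) :
    ∃ ψ : Ray → ℝ, Continuous ψ ∧ (∀ t, t ≠ Ray.zero → ψ t ∈ Ioo a b) ∧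
      ∀ t, t ≠ Ray.zero → g (ψ t) = V.ray i t := by
  set φ : ℝ → Ray := fun u => V.rad (g u) with hφ
  have hφc : ContinuousOn φ (Ioo a b) := V.continuousOn_rad.comp hg.continuousOn
    fun u hu => V.prong_subset i (hm u hu)
  have hφg : ∀ u ∈ Ioo a b, V.ray i (φ u) = g u := fun u hu => V.ray_rad (hm u hu)
  have hφ0 : ∀ u ∈ Ioo a b, φ u ≠ Ray.zero := fun u hu => V.rad_ne_zero (hm u hu)
  -- a limit of parameters towards an end of the interval is not interior
  have lim : ∀ (e : ℝ) (l : Filter ℝ), l.NeBot → l ≤ 𝓝 e → Ioo a b ∈ l → g e ∉ V.prong i →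
      ∀ c d : Ray, c ≠ Ray.zero → (∀ᶠ u in l, φ u ∈ Icc c d) → False := by
    intro e l hl hle hI he c d hc hcd
    have hcpt : IsCompact (Icc c d) := by
      rw [Subtype.isCompact_iff]
      have : Subtype.val '' Icc c d = Icc (c : ℝ) d := by
        ext x; constructor
        · rintro ⟨x, hx, rfl⟩; exact hx
        · intro hx; exact ⟨⟨x, c.2.1.trans hx.1, hx.2.trans_lt d.2.2⟩, hx, rfl⟩
      rw [this]; exact isCompact_Icc
    obtain ⟨t, ht, hcl⟩ := hcpt (f := Filter.map φ l) (Filter.le_principal_iff.2 hcd)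
    have h1 : MapClusterPt (V.ray i t) l (V.ray i ∘ φ) :=
      MapClusterPt.continuousAt_comp (V.continuous_ray i).continuousAt hcl
    have h2 : Filter.Tendsto (V.ray i ∘ φ) l (𝓝 (g e)) := by
      refine (hg.continuousAt.mono_left hle).congr' ?_
      filter_upwards [hI] with u hu
      exact (hφg u hu).symm
    have h3 : V.ray i t = g e := by
      by_contra hne
      exact (h1.neBot.ne : _ ≠ ⊥) ((disjoint_nhds_nhds.2 hne).mono_right h2).eq_bot
    refine he (h3 ▸ ⟨t, fun h0 => hc ?_, rfl⟩)
    have := ht.1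
    rw [h0] at this
    exact Subtype.ext (le_antisymm this c.2.1)
  obtain ⟨m, hma, hmb⟩ := exists_between hab
  have hmI : m ∈ Ioo a b := ⟨hma, hmb⟩
  -- If the parameters stayed above `c` near `a`, they would lie in a compact interval of positive
  -- parameters, and a cluster point would place `g a` on the open prong.
  have low : ∀ c : Ray, c ≠ Ray.zero → ∃ u ∈ Ioo a b, φ u < c := by
    intro c hc
    by_contra! hcon
    refine lim a (𝓝[>] a) inferInstance nhdsWithin_le_nhds (Ioo_mem_nhdsGT hab) ha c (φ m) hc ?_
    filter_upwards [Ioo_mem_nhdsGT hma] with u hu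
    have huI : u ∈ Ioo a b := ⟨hu.1, hu.2.trans hmb⟩
    exact ⟨hcon u huI, (hmono huI hmI hu.2).le⟩
  have high : ∀ c : Ray, c ≠ Ray.zero → ∃ u ∈ Ioo a b, c < φ u := by
    intro c hc
    by_contra! hcon
    refine lim b (𝓝[<] b) inferInstance nhdsWithin_le_nhds (Ioo_mem_nhdsLT hab) hb (φ m) c
      (hφ0 m hmI) ?_
    filter_upwards [Ioo_mem_nhdsLT hmb] with u hu
    have huI : u ∈ Ioo a b := ⟨hma.trans hu.1, hu.2⟩
    exact ⟨(hmono hmI huI hu.1).le, hcon u huI⟩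
  have surj : ∀ c : Ray, c ≠ Ray.zero → ∃ u ∈ Ioo a b, φ u = c := by
    intro c hc
    obtain ⟨u, hu, huc⟩ := low c hc
    obtain ⟨w, hw, hwc⟩ := high c hc
    exact isPreconnected_Ioo.intermediate_value hu hw hφc ⟨huc.le, hwc.le⟩
  choose! u hu huφ using surj
  classical
  -- The inverse of `φ`, with the value `a` at the initial parameter. Continuity is automatic, as it
  -- is a monotone surjection onto `Ico a b`.
  let ψ : Ray → Ico a b := fun t => if h : t = Ray.zero then ⟨a, le_rfl, hab⟩ else
    ⟨u t, (hu t h).1.le, (hu t h).2⟩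
  have hψ : ∀ t, t ≠ Ray.zero → (ψ t : ℝ) = u t := fun t ht => by simp only [ψ, dif_neg ht]
  have hψ0 : (ψ Ray.zero : ℝ) = a := by simp only [ψ, dif_pos]
  have hψm : Monotone ψ := by
    intro s t hst
    by_cases hs : s = Ray.zero
    · subst hs
      refine (show (ψ Ray.zero : ℝ) ≤ ψ t from ?_)
      rw [hψ0]; exact (ψ t).2.1
    · have ht : t ≠ Ray.zero := Ray.ne_zero_iff.2 ((Ray.ne_zero_iff.1 hs).trans_le hst)
      refine (show (ψ s : ℝ) ≤ ψ t from ?_)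
      rw [hψ s hs, hψ t ht, ← hmono.le_iff_le (hu s hs) (hu t ht)]
      change φ (u s) ≤ φ (u t)
      rwa [huφ s hs, huφ t ht]
  have hψs : Function.Surjective ψ := by
    intro x
    by_cases hx : (x : ℝ) = a
    · exact ⟨Ray.zero, Subtype.ext (hψ0.trans hx.symm)⟩
    · have hxI : (x : ℝ) ∈ Ioo a b := ⟨lt_of_le_of_ne x.2.1 (Ne.symm hx), x.2.2⟩
      refine ⟨φ x, Subtype.ext ?_⟩
      rw [hψ _ (hφ0 _ hxI)]
      exact hmono.injOn (hu _ (hφ0 _ hxI)) hxI (huφ _ (hφ0 _ hxI))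
  refine ⟨fun t => ψ t, continuous_subtype_val.comp (hψm.continuous_of_surjective hψs), ?_, ?_⟩
  · intro t ht
    change (ψ t : ℝ) ∈ _
    rw [hψ t ht]; exact hu t ht
  · intro t ht
    change g (ψ t) = _
    rw [hψ t ht, ← hφg _ (hu t ht), huφ t ht]

/-- Local injectivity makes the radius strictly monotone along the path; when it is decreasing, time
is reversed. -/
theorem exists_reparam {i : Fin V.N} {g : ℝ → ζ.Level j} (hg : Continuous g) {a b : ℝ}
    (hab : a < b) (ha : g a ∉ V.prong i) (hb : g b ∉ V.prong i) (hm : ∀ u ∈ Ioo a b, g u ∈ V.prong i)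
    (hl : ∀ u ∈ Ioo a b, ∃ U ∈ 𝓝 u, InjOn g U) :
    ∃ ψ : Ray → ℝ, Continuous ψ ∧ (∀ t, t ≠ Ray.zero → ψ t ∈ Ioo a b) ∧
      ∀ t, t ≠ Ray.zero → g (ψ t) = V.ray i t := by
  have hc : ContinuousOn (fun u => (V.rad (g u) : ℝ)) (Ioo a b) :=
    continuous_subtype_val.comp_continuousOn (V.continuousOn_rad.comp hg.continuousOn
      fun u hu => V.prong_subset i (hm u hu))
  have hinj : InjOn (fun u => (V.rad (g u) : ℝ)) (Ioo a b) := by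
    refine injOn_Ioo_of_locally_injOn hc fun u hu => ?_
    obtain ⟨U, hU, hi⟩ := hl u hu
    refine ⟨U ∩ Ioo a b, Filter.inter_mem hU (isOpen_Ioo.mem_nhds hu), ?_⟩
    intro x hx y hy hxy
    refine hi hx.1 hy.1 ?_
    rw [← V.ray_rad (hm x hx.2), ← V.ray_rad (hm y hy.2), Subtype.ext hxy]
  rcases hc.strictMonoOn_of_injOn_Ioo hab hinj with h | h
  · exact V.exists_reparam_of_strictMonoOn hg hab ha hb hm fun x hx y hy hxy => h hx hy hxy
  · obtain ⟨ψ, h1, h2, h3⟩ := V.exists_reparam_of_strictMonoOn (g := fun u => g (-u)) (i := i)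
      (hg.comp continuous_neg) (neg_lt_neg hab) (by simpa using hb) (by simpa using ha)
      (fun u hu => hm _ ⟨by linarith [hu.2], by linarith [hu.1]⟩)
      (fun x hx y hy hxy => h ⟨by linarith [hy.2], by linarith [hy.1]⟩
        ⟨by linarith [hx.2], by linarith [hx.1]⟩ (neg_lt_neg hxy))
    exact ⟨fun t => -ψ t, h1.neg, fun t ht => ⟨by linarith [(h2 t ht).2], by linarith [(h2 t ht).1]⟩, h3⟩

end StdStar
end GraphTower

/-- The gap is bounded by the supremum of the part of `F` below `u` and the infimum of the part
above. -/
theorem exists_gap {F : Set ℝ} (hF : IsClosed F) {l u r : ℝ} (hl : l ∈ F) (hr : r ∈ F) (hu : u ∉ F)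
    (hlu : l ≤ u) (hur : u ≤ r) :
    ∃ a ∈ F, ∃ b ∈ F, l ≤ a ∧ a < u ∧ u < b ∧ b ≤ r ∧ ∀ v ∈ Ioo a b, v ∉ F := by
  have h1 : IsClosed (F ∩ Iic u) := hF.inter isClosed_Iic
  have h2 : IsClosed (F ∩ Ici u) := hF.inter isClosed_Ici
  have b1 : BddAbove (F ∩ Iic u) := ⟨u, fun v hv => hv.2⟩
  have b2 : BddBelow (F ∩ Ici u) := ⟨u, fun v hv => hv.2⟩
  have m1 := h1.csSup_mem ⟨l, hl, hlu⟩ b1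
  have m2 := h2.csInf_mem ⟨r, hr, hur⟩ b2
  have n1 : sSup (F ∩ Iic u) ≠ u := fun h => hu (h ▸ m1.1)
  have n2 : sInf (F ∩ Ici u) ≠ u := fun h => hu (h ▸ m2.1)
  refine ⟨_, m1.1, _, m2.1, le_csSup b1 ⟨hl, hlu⟩, lt_of_le_of_ne m1.2 n1,
    lt_of_le_of_ne m2.2 n2.symm, csInf_le b2 ⟨hr, hur⟩, fun v hv hvF => ?_⟩
  rcases le_total v u with h | h
  · exact absurd (le_csSup b1 ⟨hvF, h⟩) (not_le.2 hv.1)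
  · exact absurd (csInf_le b2 ⟨hvF, h⟩) (not_le.2 hv.2)

namespace MetricGraph

variable {G : MetricGraph}

theorem exists_isArmRadius {x : G.Point} {U : Set G.Point} (hU : U ∈ 𝓝 x) :
    ∃ δ > 0, IsArmRadius x (fun _ => δ) ∧
      ∀ d ∈ arms x, ∀ s, 0 < s → s < δ → G.along d (armPos x d + s) ∈ U := by
  have h1 : ∀ d ∈ arms x, ∀ᶠ δ in 𝓝[>] (0 : ℝ), armPos x d + δ ≤ G.len d.1 ∧ δ ≤ G.len d.1 / 2 := by
    intro d hd
    have a : ∀ᶠ δ in 𝓝 (0 : ℝ), δ < G.len d.1 - armPos x d :=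
      Iio_mem_nhds (sub_pos.2 (armPos_lt hd))
    have b : ∀ᶠ δ in 𝓝 (0 : ℝ), δ < G.len d.1 / 2 := Iio_mem_nhds (half_pos (G.len_pos _))
    filter_upwards [nhdsWithin_le_nhds a, nhdsWithin_le_nhds b] with δ h1 h2
    exact ⟨by linarith, h2.le⟩
  have h2 : ∀ d ∈ arms x, ∀ᶠ δ in 𝓝[>] (0 : ℝ), ∀ s, 0 < s → s < δ →
      G.along d (armPos x d + s) ∈ U := by
    intro d hd
    have hc : Continuous fun s => G.along d (armPos x d + s) := (continuous_along d).comp (by fun_prop)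
    have : ∀ᶠ s in 𝓝 (0 : ℝ), G.along d (armPos x d + s) ∈ U :=
      hc.continuousAt.eventually_mem (by rw [add_zero, along_armPos hd]; exact hU)
    obtain ⟨ε, hε, hb⟩ := Metric.eventually_nhds_iff.1 this
    filter_upwards [Ioo_mem_nhdsGT hε] with δ hδ s hs hsδ
    refine hb ?_
    rw [Real.dist_eq, sub_zero, abs_of_pos hs]; exact hsδ.trans hδ.2
  have h3 := (Filter.eventually_all_finite (finite_arms x)).2 h1
  have h4 := (Filter.eventually_all_finite (finite_arms x)).2 h2
  obtain ⟨δ, h5, h6, h7⟩ := (h3.and (h4.and self_mem_nhdsWithin)).exists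
  exact ⟨δ, h7, ⟨fun _ _ => h7, fun d hd => (h5 d hd).1, fun d hd _ _ => (h5 d hd).2⟩, h6⟩

theorem isPreconnected_armSegment (x : G.Point) (d : G.E × Bool) (r : ℝ) :
    IsPreconnected (armSegment x d r) :=
  isPreconnected_Ioo.image _ (continuous_along d).continuousOn

end MetricGraph

open MetricGraph

/-! ### Lifts of prongs to lower levels -/

namespace GraphTower.StdStar

section
variable {ζ : GraphTower} {j : ℕ} (V : ζ.StdStar j) {m : ℕ} (h : j ≤ m)

/-- The lifts of a prong to a lower level. -/
def lifts (i : Fin V.N) : Set (Ray → ζ.Level m) :=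
  {γ | Continuous γ ∧ ∀ t, ζ.down h (γ t) = V.ray i t}

/-- The lifts of the prongs that start at a given point. -/
def raysAt (x : ζ.Level m) : Set (Ray → ζ.Level m) := {γ | γ Ray.zero = x ∧ ∃ i, γ ∈ V.lifts h i}

/-- The lift of a star neighborhood (and of smaller star neighborhoods) centered at a point. -/
def levelStar (x : ζ.Level m) (r : ℝ) : Set (ζ.Level m) :=
  {x} ∪ {z | ∃ γ ∈ V.raysAt h x, ∃ t : Ray, (t : ℝ) < r ∧ γ t = z}

end

variable {n : ℕ} {ζ : SplitSequence n} {j : ℕ} (V : GraphTower.StdStar ζ.toGraphTower j) {m : ℕ}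
  {h : j ≤ m} {i k : Fin V.N} {γ γ' : Ray → ζ.Level m} {x : ζ.Level m}

/-- The absence of special points on open prongs enters here: over an open prong there are no
natural vertices, so the bonding maps are locally injective at all points there. -/
theorem notMem_of_down_eq {z : ζ.Level m} {t : Ray} (ht : t ≠ Ray.zero)
    (hz : ζ.down h z = V.ray i t) : z ∉ (ζ.graph m).naturalVertices := fun hv =>
  V.not_special i t ht (hz ▸ ζ.isSpecial_down h hv)

/-- The parameters of agreement form a closed set, which is open at positive parameters by local
injectivity. The positive parameters are connected, and continuity adds the initial one. -/
theorem lift_unique (hγ : γ ∈ V.lifts h i) (hγ' : γ' ∈ V.lifts h i) {t : Ray} (ht : t ≠ Ray.zero)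
    (he : γ t = γ' t) : γ = γ' := by
  refine Ray.funext_of_pos hγ.1 hγ'.1 ?_
  have hcl : IsClosed {s | γ s = γ' s} := isClosed_eq hγ.1 hγ'.1
  have hop : ∀ s, s ≠ Ray.zero → γ s = γ' s → ∀ᶠ r in 𝓝 s, γ r = γ' r := by
    intro s hs hes
    obtain ⟨U, hU, hi⟩ := ζ.exists_injOn_down h (V.notMem_of_down_eq hs (hγ.2 s))
    filter_upwards [hγ.1.continuousAt.eventually_mem hU,
      hγ'.1.continuousAt.eventually_mem (hes ▸ hU)] with r h1 h2
    exact hi h1 h2 ((hγ.2 r).trans (hγ'.2 r).symm)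
  have hopen : IsOpen {s | s ≠ Ray.zero ∧ γ s = γ' s} := by
    rw [isOpen_iff_mem_nhds]
    rintro s ⟨h1, h2⟩
    exact Filter.inter_mem (Ray.isOpen_pos.mem_nhds h1) (hop s h1 h2)
  have := Ray.isPreconnected_pos.subset_left_of_subset_union hopen hcl.isOpen_compl
    (by rw [disjoint_left]; exact fun s h1 h2 => h2 h1.2)
    (fun s hs => by
      by_cases hes : γ s = γ' s
      · exact Or.inl ⟨hs, hes⟩
      · exact Or.inr hes) ⟨t, ht, ht, he⟩
  exact fun s hs => (this hs).2

theorem lift_inj (hγ : γ ∈ V.lifts h i) (hγ' : γ' ∈ V.lifts h k) {s t : Ray} (he : γ s = γ' t) :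
    s = t ∧ (s = Ray.zero ∨ (i = k ∧ γ = γ')) := by
  have h1 := congrArg (ζ.down h) he
  rw [hγ.2, hγ'.2] at h1
  obtain ⟨h2, h3⟩ := V.ray_inj _ _ _ _ h1
  subst h2
  refine ⟨rfl, ?_⟩
  by_cases hs : s = Ray.zero
  · exact Or.inl hs
  · have hik := h3.resolve_left hs
    subst hik
    exact Or.inr ⟨rfl, V.lift_unique hγ hγ' hs he⟩

theorem down_center (hγ : γ ∈ V.lifts h i) : ζ.down h (γ Ray.zero) = V.center := by
  rw [hγ.2, V.ray_zero]

/-- On an edge through `z`, the maximal interval around `z` that maps into the open prong has ends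
mapping off it, since natural vertices never lie over an open prong. Hence the interval crosses the
prong once, monotonically, and can be reparameterized by it. -/
theorem exists_lift {z : ζ.Level m} {t : Ray} (ht : t ≠ Ray.zero) (hz : ζ.down h z = V.ray i t) :
    ∃ γ ∈ V.lifts h i, γ t = z := by
  obtain ⟨d, u, hu0, hu1, rfl⟩ := exists_along z
  set g : ℝ → ζ.Level j := fun s => ζ.down h ((ζ.graph m).along d s) with hg
  have hgc : Continuous g := (ζ.continuous_down h).comp (continuous_along d)
  have hFc : IsClosed {s | g s ∉ V.prong i} := ((V.isOpen_prong i).preimage hgc).isClosed_compl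
  have hend : ∀ s, s ∉ Ioo 0 ((ζ.graph m).len d.1) → g s ∉ V.prong i := by
    rintro s hs ⟨r, hr, he⟩
    exact V.notMem_of_down_eq hr he.symm (along_mem_naturalVertices.2 hs)
  have hu : g u ∈ V.prong i := ⟨t, ht, hz.symm⟩
  obtain ⟨a, ha, b, hb, h0a, hau, hub, hbl, hab⟩ := exists_gap hFc (l := 0) (r := (ζ.graph m).len d.1)
    (u := u) (hend 0 fun h => lt_irrefl _ h.1) (hend _ fun h => lt_irrefl _ h.2) (fun h => h hu) hu0 hu1.le
  have hmem : ∀ s ∈ Ioo a b, g s ∈ V.prong i := fun s hs => not_not.1 (hab s hs)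
  have hI : ∀ s ∈ Ioo a b, s ∈ Ioo 0 ((ζ.graph m).len d.1) := fun s hs =>
    ⟨h0a.trans_lt hs.1, hs.2.trans_le hbl⟩
  obtain ⟨ψ, hψ, hψI, hψg⟩ := V.exists_reparam hgc (hau.trans hub) ha hb hmem (by
    intro s hs
    have hn : (ζ.graph m).along d s ∉ (ζ.graph m).naturalVertices := by
      rw [along_mem_naturalVertices, not_not]; exact hI s hs
    obtain ⟨U, hU, hi⟩ := ζ.exists_injOn_down h hn
    refine ⟨(ζ.graph m).along d ⁻¹' U ∩ Ioo a b, Filter.inter_mem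
      ((continuous_along d).continuousAt hU) (isOpen_Ioo.mem_nhds hs), ?_⟩
    intro p hp q hq hpq
    exact along_injOn (hI p hp.2) (hi hp.1 hq.1 hpq))
  have hγ : (fun s => (ζ.graph m).along d (ψ s)) ∈ V.lifts h i := by
    refine ⟨(continuous_along d).comp hψ, ?_⟩
    have hc1 : Continuous fun s => ζ.down h ((ζ.graph m).along d (ψ s)) := hgc.comp hψ
    exact congrFun (Ray.funext_of_pos hc1 (V.continuous_ray i) hψg)
  refine ⟨_, hγ, ?_⟩
  -- the parameter of the given point on the lift
  have hinj : InjOn (fun s => (V.rad (g s) : ℝ)) (Ioo a b) := by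
    refine injOn_Ioo_of_locally_injOn (continuous_subtype_val.comp_continuousOn
      (V.continuousOn_rad.comp hgc.continuousOn fun s hs => V.prong_subset i (hmem s hs))) ?_
    intro s hs
    have hn : (ζ.graph m).along d s ∉ (ζ.graph m).naturalVertices := by
      rw [along_mem_naturalVertices, not_not]; exact hI s hs
    obtain ⟨U, hU, hi⟩ := ζ.exists_injOn_down h hn
    refine ⟨(ζ.graph m).along d ⁻¹' U ∩ Ioo a b, Filter.inter_mem
      ((continuous_along d).continuousAt hU) (isOpen_Ioo.mem_nhds hs), ?_⟩
    intro p hp q hq hpq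
    have hpq' : V.rad (g p) = V.rad (g q) := Subtype.ext hpq
    refine along_injOn (hI p hp.2) (hi hp.1 hq.1 ?_)
    change g p = g q
    rw [← V.ray_rad (hmem p hp.2), ← V.ray_rad (hmem q hq.2), hpq']
  have : ψ t = u := by
    refine hinj (hψI t ht) ⟨hau, hub⟩ ?_
    change ((V.rad (g (ψ t)) : Ray) : ℝ) = V.rad (g u)
    have e : g u = V.ray i t := hz
    rw [hψg t ht, e]
  change (ζ.graph m).along d (ψ t) = _
  rw [this]

/-- A lift is determined by its midpoint, which lies in a finite fiber. -/
theorem finite_lifts (h : j ≤ m) (i : Fin V.N) : (V.lifts h i).Finite := by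
  refine Set.Finite.of_finite_image (f := fun γ => γ Ray.half) ?_ fun γ hγ γ' hγ' he =>
    V.lift_unique hγ hγ' Ray.half_ne he
  refine (ζ.finite_fiber h (V.ray i Ray.half)).subset ?_
  rintro _ ⟨γ, hγ, rfl⟩
  exact hγ.2 _

theorem finite_iUnion_lifts (h : j ≤ m) : (⋃ i, V.lifts h i).Finite :=
  finite_iUnion fun i => V.finite_lifts h i

theorem finite_raysAt (h : j ≤ m) (x : ζ.Level m) : (V.raysAt h x).Finite :=
  (V.finite_iUnion_lifts h).subset fun _ hγ => mem_iUnion.2 hγ.2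

/-- Off a given lift means differing from the point of the lift at the same radius, which is an open
condition. With finitely many lifts this allows all but chosen ones to be deleted from an open set.
-/
theorem isOpen_offLift (hγ : γ ∈ V.lifts h i) :
    IsOpen {z | ζ.down h z ∈ V.carrier ∧ γ (V.rad (ζ.down h z)) ≠ z} := by
  have hc : ContinuousOn (fun z => (γ (V.rad (ζ.down h z)), z)) (ζ.down h ⁻¹' V.carrier) :=
    ContinuousOn.prodMk (hγ.1.comp_continuousOn (V.continuousOn_rad.comp
      (ζ.continuous_down h).continuousOn fun _ hz => hz)) continuousOn_id
  exact hc.isOpen_inter_preimage (V.isOpen_carrier.preimage (ζ.continuous_down h))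
    isClosed_diagonal.isOpen_compl

/-- The preimage of an open piece of a prong consists of pieces of finitely many disjoint lifts;
deleting all others leaves the given one. -/
theorem isOpen_lift_image (hγ : γ ∈ V.lifts h i) {O : Set Ray} (hO : IsOpen O) (h0 : Ray.zero ∉ O) :
    IsOpen (γ '' O) := by
  have : γ '' O = ζ.down h ⁻¹' (V.ray i '' O) ∩
      ⋂ γ' ∈ V.lifts h i \ {γ}, {z | ζ.down h z ∈ V.carrier ∧ γ' (V.rad (ζ.down h z)) ≠ z} := by
    ext z
    constructor
    · rintro ⟨t, ht, rfl⟩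
      refine ⟨⟨t, ht, (hγ.2 t).symm⟩, mem_iInter₂.2 fun γ' hγ' => ?_⟩
      rw [mem_ofPred_eq, hγ.2, V.rad_ray]
      refine ⟨V.ray_mem i t, fun he => hγ'.2 (V.lift_unique hγ'.1 hγ ?_ he)⟩
      rintro rfl; exact h0 ht
    · rintro ⟨⟨t, ht, he⟩, hz⟩
      have ht0 : t ≠ Ray.zero := by rintro rfl; exact h0 ht
      obtain ⟨γ', hγ', hγz⟩ := V.exists_lift ht0 he.symm
      by_cases hgg : γ' = γ
      · subst hgg; exact ⟨t, ht, hγz⟩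
      · refine absurd ?_ (mem_iInter₂.1 hz γ' ⟨hγ', hgg⟩).2
        rw [← he, V.rad_ray, hγz]
  rw [this]
  exact ((V.isOpen_piece i O hO h0).preimage (ζ.continuous_down h)).inter
    (((V.finite_lifts h i).subset sdiff_subset).isOpen_biInter fun γ' hγ' => V.isOpen_offLift hγ'.1)

/-- From the preimage of the core, the lifts starting elsewhere and the remaining points over the
center are deleted; there are finitely many of each. -/
theorem isOpen_levelStar (hx : ζ.down h x = V.center) {r : ℝ} (hr : 0 < r) :
    IsOpen (V.levelStar h x r) := by
  have : V.levelStar h x r = ζ.down h ⁻¹' {y | ∃ i, ∃ t : Ray, (t : ℝ) < r ∧ V.ray i t = y} ∩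
      ((⋂ γ' ∈ (⋃ i, V.lifts h i) \ V.raysAt h x,
        {z | ζ.down h z ∈ V.carrier ∧ γ' (V.rad (ζ.down h z)) ≠ z}) ∩
      ({z | ζ.down h z = V.center} \ {x})ᶜ) := by
    ext z
    constructor
    · rintro (rfl | ⟨γ, hγ, t, ht, rfl⟩)
      · refine ⟨⟨V.someRay, Ray.zero, hr, (V.ray_zero _).trans hx.symm⟩, mem_iInter₂.2 ?_,
          fun hz => hz.2 rfl⟩
        rintro γ' ⟨hγ', hne⟩
        obtain ⟨i, hi⟩ := mem_iUnion.1 hγ'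
        refine ⟨hx ▸ V.center_mem, fun he => hne ⟨?_, i, hi⟩⟩
        rw [← he, hx, ← V.ray_zero i, V.rad_ray]
      · obtain ⟨i, hi⟩ := hγ.2
        refine ⟨⟨i, t, ht, (hi.2 t).symm⟩, mem_iInter₂.2 ?_, ?_⟩
        · rintro γ' ⟨hγ', hne⟩
          obtain ⟨k, hk⟩ := mem_iUnion.1 hγ'
          refine ⟨hi.2 t ▸ V.ray_mem i t, fun he => hne ?_⟩
          rw [hi.2, V.rad_ray] at he
          rcases (V.lift_inj hk hi he).2 with h0 | h0
          · exact ⟨by rw [← hγ.1, ← h0, he], k, hk⟩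
          · rw [h0.2]; exact hγ
        · rintro ⟨h1, h2⟩
          rw [mem_ofPred_eq, hi.2, V.ray_eq_center] at h1
          exact h2 (by rw [h1]; exact hγ.1)
    · rintro ⟨⟨i, t, ht, he⟩, hz, hzx⟩
      by_cases ht0 : t = Ray.zero
      · left
        by_contra hne
        exact hzx ⟨by rw [mem_ofPred_eq, ← he, ht0, V.ray_zero], hne⟩
      · right
        obtain ⟨γ, hγ, hγz⟩ := V.exists_lift ht0 he.symm
        by_cases hm : γ ∈ V.raysAt h x
        · exact ⟨γ, hm, t, ht, hγz⟩
        · refine absurd ?_ (mem_iInter₂.1 hz γ ⟨mem_iUnion.2 ⟨i, hγ⟩, hm⟩).2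
          rw [← he, V.rad_ray, hγz]
  rw [this]
  refine ((V.isOpen_core r hr).preimage (ζ.continuous_down h)).inter (IsOpen.inter ?_ ?_)
  · refine ((V.finite_iUnion_lifts h).subset sdiff_subset).isOpen_biInter fun γ' hγ' => ?_
    obtain ⟨i, hi⟩ := mem_iUnion.1 hγ'.1
    exact V.isOpen_offLift hi
  · exact ((ζ.finite_fiber h V.center).subset sdiff_subset).isClosed.isOpen_compl

theorem raysAt_inj {γ γ' : Ray → ζ.Level m} (hγ : γ ∈ V.raysAt h x) (hγ' : γ' ∈ V.raysAt h x)
    {s t : Ray} (he : γ s = γ' t) : s = t ∧ (s = Ray.zero ∨ γ = γ') := by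
  obtain ⟨i, hi⟩ := hγ.2
  obtain ⟨k, hk⟩ := hγ'.2
  obtain ⟨h1, h2⟩ := V.lift_inj hi hk he
  exact ⟨h1, h2.imp_right And.right⟩

/-- Short arms at `x` and lifts starting at `x` are two descriptions of the same germs, so the
valence of the graph counts the lifts. -/
theorem ncard_raysAt (hx : ζ.down h x = V.center) : (V.raysAt h x).ncard = (arms x).ncard := by
  have hU : V.levelStar h x 1 ∈ 𝓝 x := (V.isOpen_levelStar hx one_pos).mem_nhds (Or.inl rfl)
  obtain ⟨δ, hδ, hrad, hδU⟩ := exists_isArmRadius hU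
  have hne : ∀ d ∈ arms x, ∀ s, 0 < s → s < δ → (ζ.graph m).along d (armPos x d + s) ≠ x := by
    intro d hd s hs hsδ he
    have hI : armPos x d + s ∈ Ioo 0 ((ζ.graph m).len d.1) :=
      ⟨by linarith [armPos_nonneg hd], by linarith [hrad.le_len d hd]⟩
    have := along_injOn hI (he.trans (along_armPos hd).symm)
    linarith
  have hsub : ∀ d ∈ arms x, ∀ y ∈ armSegment x d δ, ∃ γ ∈ V.raysAt h x,
      y ∈ γ '' {t | t ≠ Ray.zero} := by
    rintro d hd _ ⟨u, hu, rfl⟩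
    have hs : armPos x d + (u - armPos x d) = u := by ring
    have h1 := hδU d hd (u - armPos x d) (by linarith [hu.1]) (by linarith [hu.2])
    have h2 := hne d hd (u - armPos x d) (by linarith [hu.1]) (by linarith [hu.2])
    rw [hs] at h1 h2
    rcases h1 with h1 | ⟨γ, hγ, t, -, ht⟩
    · exact absurd h1 h2
    · refine ⟨γ, hγ, t, ?_, ht⟩
      rintro rfl
      exact h2 (ht.symm.trans hγ.1)
  -- A short arm without its initial point is connected and covered by the disjoint open images of
  -- the lifts at `x`, so a single lift contains it.
  have hex : ∀ d ∈ arms x, ∃ γ ∈ V.raysAt h x, armSegment x d δ ⊆ γ '' {t | t ≠ Ray.zero} := by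
    intro d hd
    have hy : (ζ.graph m).along d (armPos x d + δ / 2) ∈ armSegment x d δ :=
      ⟨_, ⟨by linarith, by linarith⟩, rfl⟩
    obtain ⟨γ, hγ, hγy⟩ := hsub d hd _ hy
    refine ⟨γ, hγ, ?_⟩
    refine (isPreconnected_armSegment x d δ).subset_of_disjoint_cover
      (O := fun γ : V.raysAt h x => (γ : Ray → ζ.Level m) '' {t | t ≠ Ray.zero}) (i := ⟨γ, hγ⟩)
      ?_ ?_ ?_ hy hγy
    · rintro ⟨γ, hγ⟩
      obtain ⟨i, hi⟩ := hγ.2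
      exact V.isOpen_lift_image hi Ray.isOpen_pos fun h => h rfl
    · intro y hy
      obtain ⟨γ, hγ, h'⟩ := hsub d hd y hy
      exact mem_iUnion.2 ⟨⟨γ, hγ⟩, h'⟩
    · rintro ⟨γ, hγ⟩ ⟨γ', hγ'⟩ hgg y - ⟨s, hs, rfl⟩ ⟨t, ht, he⟩
      rcases (V.raysAt_inj hγ' hγ he).2 with h0 | h0
      · exact ht h0
      · exact hgg (Subtype.ext h0.symm)
  have : Nonempty (Ray → ζ.Level m) := ⟨fun _ => x⟩
  choose! c hc hcs using hex
  refine le_antisymm ?_ ?_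
  · have : V.raysAt h x ⊆ c '' arms x := by
      intro γ hγ
      have hW := (isOpen_star (x := x) (r := fun _ => δ) (fun _ _ => hδ) hrad.le_len).mem_nhds
        (Or.inl rfl)
      obtain ⟨i, hi⟩ := hγ.2
      have h1 : γ ⁻¹' ({x} ∪ ⋃ d ∈ arms x, armSegment x d δ) ∈ 𝓝 Ray.zero :=
        hi.1.continuousAt (by rw [hγ.1]; exact hW)
      obtain ⟨ε, hε, hb⟩ := Metric.mem_nhds_iff.1 h1
      have e1 := min_le_left (ε / 2) (1 / 2)
      have e2 := min_le_right (ε / 2) (1 / 2)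
      have e3 : 0 < min (ε / 2) (1 / 2) := lt_min (by linarith) (by norm_num)
      let t : Ray := ⟨min (ε / 2) (1 / 2), e3.le, by linarith⟩
      have ht : t ≠ Ray.zero := Ray.ne_zero_iff.2 e3
      have htb : t ∈ Metric.ball Ray.zero ε := by
        rw [Metric.mem_ball, Subtype.dist_eq, Real.dist_eq]
        simp only [t, Ray.zero, sub_zero, abs_of_pos e3]; linarith
      rcases hb htb with hx' | hx'
      · exact absurd (V.raysAt_inj hγ hγ (hx'.trans hγ.1.symm)).1 ht
      · obtain ⟨d, hd, hy⟩ := mem_iUnion₂.1 hx'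
        obtain ⟨s, hs, he⟩ := hcs d hd hy
        refine ⟨d, hd, ?_⟩
        rcases (V.raysAt_inj (hc d hd) hγ he).2 with h0 | h0
        · exact absurd h0 hs
        · exact h0
    exact (ncard_le_ncard this ((finite_arms x).image c)).trans (ncard_image_le (finite_arms x))
  · refine ncard_le_ncard_of_injOn c hc ?_ (V.finite_raysAt h x)
    intro d hd d' hd' hcc
    -- The radius along an arm starts at zero and becomes positive. If two arms ran in the same
    -- lift, their radii would have a common positive value by the intermediate value theorem, and
    -- the arms would meet.
    have key : ∀ d ∈ arms x, ∃ f : ℝ → ℝ, ContinuousOn f (Icc 0 (δ / 2)) ∧ f 0 = 0 ∧ 0 < f (δ / 2) ∧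
        ∀ s ∈ Ioc 0 (δ / 2), ∃ t : Ray, (t : ℝ) = f s ∧
          (ζ.graph m).along d (armPos x d + s) = c d t := by
      intro d hd
      obtain ⟨i, hi⟩ := (hc d hd).2
      have hin : ∀ s ∈ Ioc 0 (δ / 2), ∃ t : Ray, t ≠ Ray.zero ∧
          c d t = (ζ.graph m).along d (armPos x d + s) := by
        intro s hs
        obtain ⟨t, ht, he⟩ := hcs d hd ⟨armPos x d + s, ⟨by linarith [hs.1], by linarith [hs.2]⟩, rfl⟩
        exact ⟨t, ht, he⟩
      refine ⟨fun s => V.rad (ζ.down h ((ζ.graph m).along d (armPos x d + s))), ?_, ?_, ?_, ?_⟩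
      · refine continuous_subtype_val.comp_continuousOn (V.continuousOn_rad.comp
          ((ζ.continuous_down h).comp ((continuous_along d).comp (by fun_prop))).continuousOn ?_)
        intro s hs
        rcases eq_or_lt_of_le hs.1 with h0 | h0
        · change ζ.down h ((ζ.graph m).along d (armPos x d + s)) ∈ _
          rw [← h0, add_zero, along_armPos hd, hx]; exact V.center_mem
        · obtain ⟨t, -, he⟩ := hin s ⟨h0, hs.2⟩
          change ζ.down h ((ζ.graph m).along d (armPos x d + s)) ∈ _
          rw [← he, hi.2]; exact V.ray_mem _ _
      · change ((V.rad (ζ.down h ((ζ.graph m).along d (armPos x d + 0))) : Ray) : ℝ) = 0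
        rw [add_zero, along_armPos hd, hx, ← V.ray_zero i, V.rad_ray]; rfl
      · obtain ⟨t, ht, he⟩ := hin (δ / 2) ⟨by linarith, le_rfl⟩
        change 0 < ((V.rad (ζ.down h ((ζ.graph m).along d (armPos x d + δ / 2))) : Ray) : ℝ)
        rw [← he, hi.2, V.rad_ray]
        exact Ray.ne_zero_iff.1 ht
      · intro s hs
        obtain ⟨t, ht, he⟩ := hin s hs
        refine ⟨t, ?_, he.symm⟩
        change _ = ((V.rad (ζ.down h ((ζ.graph m).along d (armPos x d + s))) : Ray) : ℝ)
        rw [← he, hi.2, V.rad_ray]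
    obtain ⟨f, f1, f2, f3, f4⟩ := key d hd
    obtain ⟨g, g1, g2, g3, g4⟩ := key d' hd'
    obtain ⟨s, hs, s', hs', hfg⟩ := exists_common_value (half_pos hδ) (half_pos hδ) f1 g1 f2 g2 f3 g3
    obtain ⟨t, ht, het⟩ := f4 s hs
    obtain ⟨t', ht', het'⟩ := g4 s' hs'
    have : t = t' := Subtype.ext (by rw [ht, ht', hfg])
    refine (hrad.eq_of_along_eq hd hd' (s := s) (s' := s') ⟨hs.1, by linarith [hs.2]⟩
      ⟨hs'.1, by linarith [hs'.2]⟩ ?_).1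
    rw [het, het', this, hcc]

theorem two_le_ncard_raysAt (hx : ζ.down h x = V.center) : 2 ≤ (V.raysAt h x).ncard :=
  V.ncard_raysAt hx ▸ two_le_ncard_arms x

theorem ncard_raysAt_of_notMem (hx : ζ.down h x = V.center)
    (hn : x ∉ (ζ.graph m).naturalVertices) : (V.raysAt h x).ncard = 2 :=
  V.ncard_raysAt hx ▸ ncard_arms_of_notMem hn

/-- At points that are not natural vertices, distinct lifts lie over distinct prongs. -/
theorem eq_of_type_eq (hn : x ∉ (ζ.graph m).naturalVertices) (hγ : γ ∈ V.lifts h i)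
    (hγ' : γ' ∈ V.lifts h i) (h0 : γ Ray.zero = x) (h0' : γ' Ray.zero = x) : γ = γ' := by
  obtain ⟨U, hU, hi⟩ := ζ.exists_injOn_down h hn
  have h1 : ∀ᶠ t in 𝓝 Ray.zero, γ t ∈ U ∧ γ' t ∈ U :=
    (hγ.1.continuousAt.eventually_mem (h0 ▸ hU)).and (hγ'.1.continuousAt.eventually_mem (h0' ▸ hU))
  obtain ⟨ε, hε, hb⟩ := Metric.eventually_nhds_iff.1 h1
  have e1 := min_le_left (ε / 2) (1 / 2)
  have e2 := min_le_right (ε / 2) (1 / 2)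
  have e3 : 0 < min (ε / 2) (1 / 2) := lt_min (by linarith) (by norm_num)
  let t : Ray := ⟨min (ε / 2) (1 / 2), e3.le, by linarith⟩
  have ht : t ≠ Ray.zero := Ray.ne_zero_iff.2 e3
  have htb : dist t Ray.zero < ε := by
    rw [Subtype.dist_eq, Real.dist_eq]
    simp only [t, Ray.zero, sub_zero, abs_of_pos e3]; linarith
  have := hb htb
  exact V.lift_unique hγ hγ' ht (hi this.1 this.2 ((hγ.2 t).trans (hγ'.2 t).symm))

/-- The lift of a standard star neighborhood to a lower level, as a standard star neighborhood. -/
def up (h : j ≤ m) (x : ζ.Level m) (hx : ζ.down h x = V.center) :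
    GraphTower.StdStar ζ.toGraphTower m where
  N := (V.raysAt h x).ncard
  two_le := V.two_le_ncard_raysAt hx
  center := x
  ray i := haveI := (V.finite_raysAt h x).to_subtype; ((Finite.equivFin (V.raysAt h x)).symm i).1
  continuous_ray i := by
    have := (V.finite_raysAt h x).to_subtype
    obtain ⟨k, hk⟩ := ((Finite.equivFin (V.raysAt h x)).symm i).2.2
    exact hk.1
  ray_zero i := by
    have := (V.finite_raysAt h x).to_subtype
    exact ((Finite.equivFin (V.raysAt h x)).symm i).2.1
  ray_inj i k s t he := by
    have := (V.finite_raysAt h x).to_subtype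
    obtain ⟨h1, h2⟩ := V.raysAt_inj ((Finite.equivFin (V.raysAt h x)).symm i).2
      ((Finite.equivFin (V.raysAt h x)).symm k).2 he
    exact ⟨h1, h2.imp_right fun h3 => (Finite.equivFin (V.raysAt h x)).symm.injective (Subtype.ext h3)⟩
  isOpen_piece i O hO h0 := by
    have := (V.finite_raysAt h x).to_subtype
    obtain ⟨k, hk⟩ := ((Finite.equivFin (V.raysAt h x)).symm i).2.2
    exact V.isOpen_lift_image hk hO h0
  isOpen_core r hr := by
    have := (V.finite_raysAt h x).to_subtype
    convert V.isOpen_levelStar hx hr using 1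
    ext z
    constructor
    · rintro ⟨i, t, ht, rfl⟩
      exact Or.inr ⟨_, ((Finite.equivFin (V.raysAt h x)).symm i).2, t, ht, rfl⟩
    · rintro (rfl | ⟨γ, hγ, t, ht, rfl⟩)
      · exact ⟨⟨0, two_pos.trans_le (V.two_le_ncard_raysAt hx)⟩, Ray.zero, hr,
          ((Finite.equivFin (V.raysAt h z)).symm _).2.1⟩
      · exact ⟨Finite.equivFin (V.raysAt h x) ⟨γ, hγ⟩, t, ht, by rw [Equiv.symm_apply_apply]⟩
  not_special i t ht hs := by
    have := (V.finite_raysAt h x).to_subtype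
    obtain ⟨k, hk⟩ := ((Finite.equivFin (V.raysAt h x)).symm i).2.2
    have := GraphTower.IsSpecial.down _ h hs
    rw [hk.2] at this
    exact V.not_special k t ht this

theorem exists_up_ray (hx : ζ.down h x = V.center) (hγ : γ ∈ V.raysAt h x) :
    ∃ i, (V.up h x hx).ray i = γ := by
  have := (V.finite_raysAt h x).to_subtype
  refine ⟨Finite.equivFin (V.raysAt h x) ⟨γ, hγ⟩, ?_⟩
  change ((Finite.equivFin (V.raysAt h x)).symm _).1 = _
  rw [Equiv.symm_apply_apply]

end GraphTower.StdStar

open MetricGraph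

/-! ### Lifts of prongs to the solenoid -/

namespace GraphTower.StdStar

section
variable {ζ : GraphTower} {j : ℕ} (V : ζ.StdStar j)

/-- The lifts of a prong to the solenoid. -/
def xlifts (i : Fin V.N) : Set (Ray → ζ.Solenoid) :=
  {γ | Continuous γ ∧ ∀ t, ζ.proj j (γ t) = V.ray i t}

/-- The lifts of the prongs to the solenoid that start at a given point. -/
def xraysAt (y : ζ.Solenoid) : Set (Ray → ζ.Solenoid) := {γ | γ Ray.zero = y ∧ ∃ i, γ ∈ V.xlifts i}

/-- The union of the lifts of prongs that start at a given point. -/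
def plaque (y : ζ.Solenoid) : Set ζ.Solenoid := {z | ∃ γ ∈ V.xraysAt y, ∃ t, γ t = z}

end

variable {n : ℕ} {ζ : SplitSequence n} {j : ℕ} (V : GraphTower.StdStar ζ.toGraphTower j)
  {i k : Fin V.N} {γ γ' : Ray → ζ.Solenoid} {x y z : ζ.Solenoid}

theorem proj_xlift {m : ℕ} (h : j ≤ m) (hγ : γ ∈ V.xlifts i) :
    (fun t => ζ.proj m (γ t)) ∈ V.lifts h i :=
  ⟨(ζ.continuous_proj m).comp hγ.1, fun t => by rw [ζ.down_proj, hγ.2]⟩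

theorem down_lift {m l : ℕ} (h : j ≤ m) (hl : m ≤ l) {γ : Ray → ζ.Level l}
    (hγ : γ ∈ V.lifts (h.trans hl) i) : (fun t => ζ.down hl (γ t)) ∈ V.lifts h i :=
  ⟨(ζ.continuous_down hl).comp hγ.1, fun t => by rw [ζ.down_down, hγ.2]⟩

theorem xlift_unique (hγ : γ ∈ V.xlifts i) (hγ' : γ' ∈ V.xlifts i) {t : Ray} (ht : t ≠ Ray.zero)
    (he : γ t = γ' t) : γ = γ' := by
  funext s
  refine ζ.ext_of_le j fun m hm => ?_
  exact congrFun (V.lift_unique (V.proj_xlift hm hγ) (V.proj_xlift hm hγ') ht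
    (congrArg (ζ.proj m) he)) s

theorem xlift_inj (hγ : γ ∈ V.xlifts i) (hγ' : γ' ∈ V.xlifts k) {s t : Ray} (he : γ s = γ' t) :
    s = t ∧ (s = Ray.zero ∨ (i = k ∧ γ = γ')) := by
  have h1 := congrArg (ζ.proj j) he
  rw [hγ.2, hγ'.2] at h1
  obtain ⟨h2, h3⟩ := V.ray_inj _ _ _ _ h1
  subst h2
  refine ⟨rfl, ?_⟩
  by_cases hs : s = Ray.zero
  · exact Or.inl hs
  · have hik := h3.resolve_left hs
    subst hik
    exact Or.inr ⟨rfl, V.xlift_unique hγ hγ' hs he⟩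

theorem xraysAt_inj (hγ : γ ∈ V.xraysAt y) (hγ' : γ' ∈ V.xraysAt y)
    {s t : Ray} (he : γ s = γ' t) : s = t ∧ (s = Ray.zero ∨ γ = γ') := by
  obtain ⟨i, hi⟩ := hγ.2
  obtain ⟨k, hk⟩ := hγ'.2
  obtain ⟨h1, h2⟩ := V.xlift_inj hi hk he
  exact ⟨h1, h2.imp_right And.right⟩

/-- At each level there is a lift through the projection of `z`. By uniqueness these lifts are
compatible with the bonding maps and define a path in the inverse limit. -/
theorem exists_xlift {t : Ray} (ht : t ≠ Ray.zero) (hz : ζ.proj j z = V.ray i t) :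
    ∃ γ ∈ V.xlifts i, γ t = z := by
  have hlev : ∀ m, ∃ γ ∈ V.lifts (Nat.le_add_right j m) i, γ t = ζ.proj (j + m) z := fun m =>
    V.exists_lift ht (by rw [ζ.down_proj, hz])
  choose μ hμ hμt using hlev
  have hle : ∀ m, m ≤ j + m := fun m => Nat.le_add_left m j
  have hcomp : ∀ m s, ζ.down (Nat.le_succ (j + m)) (μ (m + 1) s) = μ m s := by
    intro m s
    have h1 := V.down_lift (Nat.le_add_right j m) (Nat.le_succ (j + m)) (hμ (m + 1))
    refine congrFun (V.lift_unique h1 (hμ m) ht ?_) s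
    rw [hμt, hμt]
    exact ζ.down_proj (Nat.le_succ (j + m)) z
  let γ : Ray → ζ.Solenoid := fun s => ⟨fun m => ζ.down (hle m) (μ m s), fun m => by
    rw [ζ.bond_down]
    change _ = ζ.down (hle m) (μ m s)
    rw [← hcomp m s, ζ.down_down]⟩
  have hγ : γ ∈ V.xlifts i := by
    refine ⟨ζ.continuous_rng fun m => (ζ.continuous_down (hle m)).comp (hμ m).1, fun s => ?_⟩
    exact (hμ j).2 s
  refine ⟨γ, hγ, Subtype.ext (funext fun m => ?_)⟩
  change ζ.down (hle m) (μ m t) = ζ.proj m z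
  rw [hμt, ζ.down_proj]

/-- Any point of the solenoid over the midpoint of `γ` lies on a lift, which uniqueness forces to
project to `γ`. -/
theorem exists_xlift_over {m : ℕ} (h : j ≤ m) {γ : Ray → ζ.Level m} (hγ : γ ∈ V.lifts h i) :
    ∃ δ ∈ V.xlifts i, ∀ t, ζ.proj m (δ t) = γ t := by
  obtain ⟨z, hz⟩ := ζ.proj_surjective m (γ Ray.half)
  obtain ⟨δ, hδ, hδz⟩ := V.exists_xlift (i := i) Ray.half_ne (z := z) (by
    rw [← ζ.down_proj h, hz, hγ.2])
  refine ⟨δ, hδ, congrFun (V.lift_unique (V.proj_xlift h hδ) hγ Ray.half_ne ?_)⟩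
  rw [hδz, hz]

theorem proj_xray {m : ℕ} (h : j ≤ m) (hγ : γ ∈ V.xraysAt y) :
    (fun t => ζ.proj m (γ t)) ∈ V.raysAt h (ζ.proj m y) := by
  obtain ⟨i, hi⟩ := hγ.2
  exact ⟨congrArg (ζ.proj m) hγ.1, i, V.proj_xlift h hi⟩

theorem proj_of_mem_xraysAt (hγ : γ ∈ V.xraysAt y) : ζ.proj j y = V.center := by
  obtain ⟨i, hi⟩ := hγ.2
  rw [← hγ.1, hi.2, V.ray_zero]

/-- Distinct lifts are distinct at low levels. -/
theorem exists_proj_ne_of_ne (hγ : γ ∈ V.xraysAt y) (hγ' : γ' ∈ V.xraysAt y) (hne : γ ≠ γ') :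
    ∃ m₀, ∀ m, m₀ ≤ m → (fun t => ζ.proj m (γ t)) ≠ fun t => ζ.proj m (γ' t) := by
  have : γ Ray.half ≠ γ' Ray.half := fun he =>
    ((V.xraysAt_inj hγ hγ' he).2.resolve_left Ray.half_ne |> hne)
  obtain ⟨m₀, h⟩ := ζ.exists_proj_ne this
  exact ⟨m₀, fun m hm he => h m hm (congrFun he _)⟩

/-- If a prong has a lift at each projection of a point, then it has a lift at the point. -/
theorem exists_xlift_of_forall (h : ∀ m (hm : j ≤ m), ∃ γ ∈ V.lifts hm i, γ Ray.zero = ζ.proj m y) :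
    ∃ δ ∈ V.xlifts i, δ Ray.zero = y := by
  -- Midpoints of those level lifts that start at the projection of `y`. Their preimages in the
  -- solenoid are nested, nonempty and closed; a common point lies on a lift whose start agrees with
  -- `y` at every level.
  let A : ∀ m, j ≤ m → Set (ζ.Level m) := fun m hm =>
    {p | ∃ γ ∈ V.lifts hm i, γ Ray.zero = ζ.proj m y ∧ γ Ray.half = p}
  have hA : ∀ m hm, (A m hm).Finite := fun m hm => by
    refine ((V.finite_lifts hm i).image fun γ => γ Ray.half).subset ?_
    rintro _ ⟨γ, hγ, -, rfl⟩
    exact ⟨γ, hγ, rfl⟩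
  have hle : ∀ l, j ≤ j + l := fun l => Nat.le_add_right j l
  have hK := IsCompact.nonempty_iInter_of_sequence_nonempty_isCompact_isClosed
    (fun l => ζ.proj (j + l) ⁻¹' A (j + l) (hle l)) (by
      rintro l w ⟨γ, hγ, h0, hh⟩
      refine ⟨_, V.down_lift (hle l) (Nat.le_succ (j + l)) hγ, ?_, ?_⟩
      · rw [h0]; exact ζ.down_proj (Nat.le_succ (j + l)) y
      · rw [hh]; exact ζ.down_proj (Nat.le_succ (j + l)) w) (by
      intro l
      obtain ⟨γ, hγ, h0⟩ := h (j + l) (hle l)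
      obtain ⟨w, hw⟩ := ζ.proj_surjective (j + l) (γ Ray.half)
      exact ⟨w, γ, hγ, h0, hw.symm⟩)
    (((hA j le_rfl).isClosed.preimage (ζ.continuous_proj j)).isCompact)
    (fun l => (hA _ _).isClosed.preimage (ζ.continuous_proj _))
  obtain ⟨w, hw⟩ := hK
  rw [mem_iInter] at hw
  obtain ⟨γ₀, hγ₀, -, hh₀⟩ := hw 0
  obtain ⟨δ, hδ, hδw⟩ := V.exists_xlift (i := i) Ray.half_ne (z := w) (by
    have := hγ₀.2 Ray.half
    rwa [hh₀, ζ.down_self] at this)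
  refine ⟨δ, hδ, ζ.ext_of_le j fun m hm => ?_⟩
  obtain ⟨l, rfl⟩ := Nat.exists_eq_add_of_le hm
  obtain ⟨γ, hγ, h0, hh⟩ := hw l
  have := V.lift_unique (V.proj_xlift hm hδ) hγ Ray.half_ne (by rw [hδw, hh])
  rw [← h0, ← this]

/-- Each level has at least two lifts at the projection of `y`, but a lift in the solenoid over one
of them could start at another point of the fiber. Two situations are distinguished, according to
whether eventually only natural vertices lie over a projection of `y`. -/
theorem exists_ne_xraysAt (hstab : ζ.IsStabilized) (hy : ζ.proj j y = V.center) :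
    ∃ a ∈ V.xraysAt y, ∃ b ∈ V.xraysAt y, a ≠ b := by
  have hc : ∀ m (hm : j ≤ m), ζ.down hm (ζ.proj m y) = V.center := fun m hm => by
    rw [ζ.down_proj, hy]
  by_cases hB : ∃ m, ∃ _ : j ≤ m, ∀ l (hl : m ≤ l) (p : ζ.Level l), ζ.down hl p = ζ.proj m y →
      p ∈ (ζ.graph l).naturalVertices
  · obtain ⟨m, hm, hB⟩ := hB
    -- Here every point over the projection of `y` to level `m` is a pre-singularity, so
    -- stabilization leaves only `y` itself. Every lift over a level lift at that projection must
    -- start at `y`.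
    have hpre : ∀ z, ζ.proj m z = ζ.proj m y → z = y := by
      intro z hz
      refine hstab.natural_vertex m (ζ.proj m y) (hB m le_rfl _ (ζ.down_self _ _)) z hz y rfl
        ⟨m, fun l hl => hB l hl _ ?_⟩ ⟨m, fun l hl => hB l hl _ (ζ.down_proj _ _)⟩
      rw [ζ.down_proj, hz]
    obtain ⟨a, b, ha, hb, hab⟩ := (one_lt_ncard_iff (V.finite_raysAt hm (ζ.proj m y))).1
      (V.two_le_ncard_raysAt (hc m hm))
    have key : ∀ γ ∈ V.raysAt hm (ζ.proj m y), ∃ δ ∈ V.xraysAt y, ∀ t, ζ.proj m (δ t) = γ t := by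
      rintro γ ⟨h0, i, hi⟩
      obtain ⟨δ, hδ, hδγ⟩ := V.exists_xlift_over hm hi
      exact ⟨δ, ⟨hpre _ (by rw [hδγ, h0]), i, hδ⟩, hδγ⟩
    obtain ⟨a', ha', haa⟩ := key a ha
    obtain ⟨b', hb', hbb⟩ := key b hb
    refine ⟨a', ha', b', hb', fun he => hab (funext fun t => ?_)⟩
    rw [← haa, ← hbb, he]
  · push Not at hB
    let P : ∀ m, Fin V.N → Prop := fun m i => ∃ hm : j ≤ m, ∃ γ ∈ V.lifts hm i, γ Ray.zero = ζ.proj m y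
    have hPm : ∀ m l i, j ≤ m → m ≤ l → P l i → P m i := by
      rintro m l i hm hl ⟨h, γ, hγ, h0⟩
      exact ⟨hm, _, V.down_lift hm hl hγ, by rw [h0, ζ.down_proj]⟩
    -- Here a point that is not a natural vertex lies over the projection of `y` at some lower
    -- level. Its two lifts are over different prongs, and this difference of prongs survives
    -- projection.
    have hP2 : ∀ m, j ≤ m → ∃ i k, i ≠ k ∧ P m i ∧ P m k := by
      intro m hm
      obtain ⟨l, hl, p, hp, hpn⟩ := hB m hm
      have hpc : ζ.down (hm.trans hl) p = V.center := by rw [← ζ.down_down hm hl, hp, hc]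
      obtain ⟨a, b, ⟨ha0, i, ha⟩, ⟨hb0, k, hb⟩, hab⟩ :=
        (one_lt_ncard_iff (V.finite_raysAt (hm.trans hl) p)).1 (V.two_le_ncard_raysAt hpc)
      refine ⟨i, k, ?_, ⟨hm, _, V.down_lift hm hl ha, by rw [ha0, hp]⟩,
        ⟨hm, _, V.down_lift hm hl hb, by rw [hb0, hp]⟩⟩
      rintro rfl
      exact hab (V.eq_of_type_eq hpn ha hb ha0 hb0)
    -- There are finitely many pairs of prongs and the condition passes to higher levels, so one
    -- pair serves all levels. Compactness then gives lifts of both prongs at `y`.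
    have : ∃ i k, i ≠ k ∧ ∀ m, j ≤ m → P m i ∧ P m k := by
      by_contra! hcon
      choose M hM hPM using hcon
      let B : Fin V.N × Fin V.N → ℕ := fun q => if h : q.1 ≠ q.2 then M q.1 q.2 h else 0
      obtain ⟨K, hK⟩ := (finite_range B).bddAbove
      obtain ⟨i, k, hik, h1, h2⟩ := hP2 (max K j) (le_max_right _ _)
      have hb : M i k hik ≤ max K j := by
        refine le_trans ?_ (le_max_left _ _)
        have := hK ⟨(i, k), rfl⟩
        simpa only [B, dif_pos hik] using this
      exact hPM i k hik (hPm _ _ _ (hM i k hik) hb h1) (hPm _ _ _ (hM i k hik) hb h2)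
    obtain ⟨i, k, hik, h⟩ := this
    obtain ⟨a, ha, ha0⟩ := V.exists_xlift_of_forall (i := i) (y := y) fun m hm => by
      obtain ⟨_, γ, hγ, h0⟩ := (h m hm).1
      exact ⟨γ, hγ, h0⟩
    obtain ⟨b, hb, hb0⟩ := V.exists_xlift_of_forall (i := k) (y := y) fun m hm => by
      obtain ⟨_, γ, hγ, h0⟩ := (h m hm).2
      exact ⟨γ, hγ, h0⟩
    refine ⟨a, ⟨ha0, i, ha⟩, b, ⟨hb0, k, hb⟩, ?_⟩
    rintro rfl
    have := (ha.2 Ray.half).symm.trans (hb.2 Ray.half)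
    exact hik ((V.ray_inj _ _ _ _ this).2.resolve_left Ray.half_ne)

/-- Finitely many lifts at a point form a star set. -/
theorem exists_isStarChart_xrays {l : ℕ} (hl : 2 ≤ l) {a : Fin l → Ray → ζ.Solenoid}
    (ha : ∀ i, a i ∈ V.xraysAt y) (hinj : Function.Injective a) :
    ∃ h, IsStarChart l y {z | ∃ i t, a i t = z} h ∧ ∀ i t, h (starPoint i t) = a i t := by
  have hr : ∀ i k s t, a i s = a k t → s = t ∧ (s = Ray.zero ∨ i = k) := by
    intro i k s t he
    obtain ⟨h1, h2⟩ := V.xraysAt_inj (ha i) (ha k) he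
    exact ⟨h1, h2.imp_right fun h => hinj h⟩
  -- At a level separating the midpoints, distinct rays have distinct projections, so an open piece
  -- of one projected ray isolates the corresponding piece in the union.
  obtain ⟨J, hJ⟩ := ζ.exists_injOn_proj (finite_range fun i => a i Ray.half)
  set M := max J j
  have hjM : j ≤ M := le_max_right _ _
  refine exists_isStarChart_of_rays hl (fun i => ?_) (fun i => (ha i).1) hr rfl ?_ ?_
  · obtain ⟨k, hk⟩ := (ha i).2; exact hk.1
  · intro i t ht N hN
    obtain ⟨k, hk⟩ := (ha i).2
    obtain ⟨O, hON, hO, htO⟩ := mem_nhds_iff.1 (Filter.inter_mem hN (Ray.isOpen_pos.mem_nhds ht))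
    have hopen := V.isOpen_lift_image (V.proj_xlift hjM hk) hO fun h => (hON h).2 rfl
    refine mem_nhdsWithin.2 ⟨_, hopen.preimage (ζ.continuous_proj M), ⟨t, htO, rfl⟩, ?_⟩
    rintro _ ⟨⟨s, hs, he⟩, ⟨i', t', rfl⟩⟩
    obtain ⟨k', hk'⟩ := (ha i').2
    obtain ⟨h1, h2⟩ := V.lift_inj (V.proj_xlift hjM hk) (V.proj_xlift hjM hk') he
    have h3 := (h2.resolve_left (hON hs).2).2
    have h4 := hJ M (le_max_left _ _) ⟨i, rfl⟩ ⟨i', rfl⟩ (congrFun h3 Ray.half)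
    have h5 := (hr _ _ _ _ h4).2.resolve_left Ray.half_ne
    subst h5
    exact ⟨s, (hON hs).1, by rw [h1]⟩
  · intro r hr
    refine mem_nhdsWithin.2 ⟨_, (V.isOpen_core r hr).preimage (ζ.continuous_proj j), ?_, ?_⟩
    · exact ⟨V.someRay, Ray.zero, hr, by
        rw [V.ray_zero, V.proj_of_mem_xraysAt (ha ⟨0, two_pos.trans_le hl⟩)]⟩
    · rintro _ ⟨⟨k, s, hs, he⟩, ⟨i, t, rfl⟩⟩
      obtain ⟨k', hk'⟩ := (ha i).2
      rw [hk'.2] at he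
      have := (V.ray_inj _ _ _ _ he).1
      exact ⟨i, t, this ▸ hs, rfl⟩

/-- If two of three lifts agree at some level, then all three do. -/
theorem proj_eq_of_proj_eq (hstab : ζ.IsStabilized) {a b c : Ray → ζ.Solenoid} (ha : a ∈ V.xraysAt y)
    (hb : b ∈ V.xraysAt y) (hc : c ∈ V.xraysAt y) (hab : a ≠ b) (hac : a ≠ c) (hbc : b ≠ c) {m : ℕ}
    (hm : j ≤ m) (he : (fun t => ζ.proj m (a t)) = fun t => ζ.proj m (b t)) :
    (fun t => ζ.proj m (a t)) = fun t => ζ.proj m (c t) := by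
  by_contra hne
  have hy : ζ.down hm (ζ.proj m y) = V.center := by rw [ζ.down_proj, V.proj_of_mem_xraysAt ha]
  obtain ⟨i, hi⟩ := V.exists_up_ray hy (V.proj_xray hm ha)
  obtain ⟨k, hk⟩ := V.exists_up_ray hy (V.proj_xray hm hc)
  have hik : i ≠ k := by
    rintro rfl; exact hne (hi.symm.trans hk)
  have hinj : Function.Injective ![a, b, c] := by
    intro p q hpq
    fin_cases p <;> fin_cases q <;> simp_all
  obtain ⟨f, hf, -⟩ := V.exists_isStarChart_xrays (y := y) (l := 3) (by norm_num) (a := ![a, b, c])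
    (by intro p; fin_cases p <;> simp [ha, hb, hc]) hinj
  -- With `a` and `b` identified and `c` apart, the three-pronged star of the lifts would project
  -- onto a standard turn.
  refine hstab.no_three_star m _ _ ((V.up hm _ hy).isStandardTurn hik) ⟨y, _, ⟨f, hf⟩, ?_⟩
  rw [hi, hk]
  ext w
  constructor
  · rintro ⟨_, ⟨p, t, rfl⟩, rfl⟩
    fin_cases p
    · exact Or.inl ⟨t, rfl⟩
    · exact Or.inl ⟨t, congrFun he t⟩
    · exact Or.inr ⟨t, rfl⟩
  · rintro (⟨t, rfl⟩ | ⟨t, rfl⟩)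
    · exact ⟨_, ⟨0, t, rfl⟩, rfl⟩
    · exact ⟨_, ⟨2, t, rfl⟩, rfl⟩

/-- Where at least three lifts start, the lifts are distinct at each level. -/
theorem proj_ne_of_three (hstab : ζ.IsStabilized) {a b c : Ray → ζ.Solenoid} (ha : a ∈ V.xraysAt y)
    (hb : b ∈ V.xraysAt y) (hc : c ∈ V.xraysAt y) (hab : a ≠ b) (hac : a ≠ c) (hbc : b ≠ c) {m : ℕ}
    (hm : j ≤ m) : (fun t => ζ.proj m (a t)) ≠ fun t => ζ.proj m (b t) := by
  classical
  intro he
  obtain ⟨m₀, hm₀⟩ := V.exists_proj_ne_of_ne ha hb hab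
  have hex : ∃ l, (fun t => ζ.proj (m + l) (a t)) ≠ fun t => ζ.proj (m + l) (b t) :=
    ⟨m₀, hm₀ _ (Nat.le_add_left _ _)⟩
  have hl := Nat.find_spec hex
  set l := Nat.find hex with hldef
  have hl0 : l ≠ 0 := by
    intro h0; rw [h0] at hl; exact hl he
  obtain ⟨q, hq⟩ := Nat.exists_eq_succ_of_ne_zero hl0
  have hq' : (fun t => ζ.proj (m + q) (a t)) = fun t => ζ.proj (m + q) (b t) := by
    by_contra hne
    exact absurd (Nat.find_min' hex hne) (by omega)
  rw [hq] at hl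
  have hmq : j ≤ m + q := hm.trans (Nat.le_add_right _ _)
  have hmq' : j ≤ m + q + 1 := hmq.trans (Nat.le_succ _)
  -- The index `m + q` directly precedes the first one at which `a` and `b` differ. There all three
  -- lifts agree, while at the next index they are pairwise different, so one fold would identify
  -- three points.
  have h1 := V.proj_eq_of_proj_eq hstab ha hb hc hab hac hbc hmq hq'
  have h2 : (fun t => ζ.proj (m + q + 1) (a t)) ≠ fun t => ζ.proj (m + q + 1) (c t) := fun h =>
    hl (V.proj_eq_of_proj_eq hstab ha hc hb hac hab hbc.symm hmq' h)
  have h3 : (fun t => ζ.proj (m + q + 1) (b t)) ≠ fun t => ζ.proj (m + q + 1) (c t) := fun h =>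
    hl (V.proj_eq_of_proj_eq hstab hb hc ha hbc hab.symm hac.symm hmq' h).symm
  obtain ⟨i, hi⟩ := ha.2
  obtain ⟨k, hk⟩ := hb.2
  obtain ⟨p, hp⟩ := hc.2
  have key : ∀ {i k : Fin V.N} {γ γ' : Ray → ζ.Solenoid}, γ ∈ V.xlifts i → γ' ∈ V.xlifts k →
      ζ.proj (m + q + 1) (γ Ray.half) = ζ.proj (m + q + 1) (γ' Ray.half) →
      (fun t => ζ.proj (m + q + 1) (γ t)) = fun t => ζ.proj (m + q + 1) (γ' t) := by
    intro i k γ γ' h h' he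
    exact ((V.lift_inj (V.proj_xlift hmq' h) (V.proj_xlift hmq' h') he).2.resolve_left Ray.half_ne).2
  have hbond : ∀ w : ζ.Solenoid, ζ.bond (m + q) (ζ.proj (m + q + 1) w) = ζ.proj (m + q) w :=
    fun w => w.2 (m + q)
  rcases (ζ.fold (m + q)).two_to_one (x := ζ.proj (m + q + 1) (a Ray.half))
    (y := ζ.proj (m + q + 1) (b Ray.half)) (z := ζ.proj (m + q + 1) (c Ray.half))
    (by rw [hbond, hbond]; exact congrFun hq' _) (by rw [hbond, hbond]; exact congrFun h1 _)
    with h | h | h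
  · exact hl (key hi hk h)
  · exact h2 (key hi hp h)
  · exact h3 (key hk hp h)

/-- Either alternative provides a third lift for `proj_ne_of_three`. The infinite case is included
because finiteness of `xraysAt` is itself deduced from this injectivity. -/
theorem injOn_proj_of_three (hstab : ζ.IsStabilized)
    (h3 : (V.xraysAt y).Infinite ∨ 3 ≤ (V.xraysAt y).ncard) {m : ℕ} (hm : j ≤ m) :
    InjOn (fun (γ : Ray → ζ.Solenoid) t => ζ.proj m (γ t)) (V.xraysAt y) := by
  intro a ha b hb he
  by_contra hab
  obtain ⟨c, hc, hcab⟩ : ∃ c ∈ V.xraysAt y, c ∉ ({a, b} : Set (Ray → ζ.Solenoid)) := by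
    rcases h3 with h3 | h3
    · exact h3.exists_notMem_finite (toFinite _)
    · exact exists_mem_notMem_of_ncard_lt_ncard ((ncard_pair hab).trans_lt (by omega)) (toFinite _)
  simp only [mem_insert_iff, mem_singleton_iff, not_or] at hcab
  exact V.proj_ne_of_three hstab ha hb hc hab (Ne.symm hcab.1) (Ne.symm hcab.2) hm he

theorem finite_xraysAt (hstab : ζ.IsStabilized) (y : ζ.Solenoid) : (V.xraysAt y).Finite := by
  by_contra h
  have hinj := V.injOn_proj_of_three hstab (Or.inl h) le_rfl
  refine h (Finite.of_finite_image (f := fun (γ : Ray → ζ.Solenoid) t => ζ.proj j (γ t)) ?_ hinj)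
  refine (V.finite_raysAt le_rfl (ζ.proj j y)).subset ?_
  rintro _ ⟨γ, hγ, rfl⟩
  exact V.proj_xray le_rfl hγ

theorem two_le_ncard_xraysAt (hstab : ζ.IsStabilized) (hy : ζ.proj j y = V.center) :
    2 ≤ (V.xraysAt y).ncard := by
  obtain ⟨a, ha, b, hb, hab⟩ := V.exists_ne_xraysAt hstab hy
  exact (one_lt_ncard_iff (V.finite_xraysAt hstab y)).2 ⟨a, b, ha, hb, hab⟩

theorem exists_mem_xraysAt (hstab : ζ.IsStabilized) (hy : ζ.proj j y = V.center) :
    ∃ a, a ∈ V.xraysAt y := by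
  obtain ⟨a, ha, -⟩ := V.exists_ne_xraysAt hstab hy
  exact ⟨a, ha⟩

/-- At a point that is not a natural vertex only two level lifts start, too few for three lifts that
remain distinct. -/
theorem mem_naturalVertices_of_three (hstab : ζ.IsStabilized) (hy : ζ.proj j y = V.center)
    (h3 : 3 ≤ (V.xraysAt y).ncard) {m : ℕ} (hm : j ≤ m) : ζ.proj m y ∈ (ζ.graph m).naturalVertices := by
  by_contra hn
  have h2 := V.ncard_raysAt_of_notMem (h := hm) (x := ζ.proj m y) (by rw [ζ.down_proj, hy]) hn
  have := ncard_le_ncard_of_injOn (s := V.xraysAt y) (t := V.raysAt hm (ζ.proj m y)) _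
    (fun γ hγ => V.proj_xray hm hγ) (V.injOn_proj_of_three hstab (Or.inr h3) hm) (V.finite_raysAt _ _)
  omega

theorem isPreSingularity_of_three (hstab : ζ.IsStabilized) (hy : ζ.proj j y = V.center)
    (h3 : 3 ≤ (V.xraysAt y).ncard) : ζ.IsPreSingularity y :=
  ⟨j, fun _ hm => V.mem_naturalVertices_of_three hstab hy h3 hm⟩

theorem ncard_xraysAt_eq_two (hstab : ζ.IsStabilized) (hy : ζ.proj j y = V.center)
    (hn : ¬ ζ.IsPreSingularity y) : (V.xraysAt y).ncard = 2 := by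
  have h1 := V.two_le_ncard_xraysAt hstab hy
  by_contra h2
  exact hn (V.isPreSingularity_of_three hstab hy (by omega))

/-- At a point that is not a pre-singularity, distinct lifts lie over distinct prongs. -/
theorem type_ne_of_not_isPreSingularity (hn : ¬ ζ.IsPreSingularity y) (hγ : γ ∈ V.xraysAt y)
    (hγ' : γ' ∈ V.xraysAt y) (hne : γ ≠ γ') (hi : γ ∈ V.xlifts i) (hk : γ' ∈ V.xlifts k) : i ≠ k := by
  rintro rfl
  obtain ⟨m₀, hm₀⟩ := V.exists_proj_ne_of_ne hγ hγ' hne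
  unfold IsPreSingularity at hn
  push Not at hn
  obtain ⟨m, hm, hmn⟩ := hn (max m₀ j)
  have hjm := (le_max_right _ _).trans hm
  exact hm₀ m ((le_max_left _ _).trans hm) (V.eq_of_type_eq hmn (V.proj_xlift hjm hi)
    (V.proj_xlift hjm hk) (by rw [hγ.1]) (by rw [hγ'.1]))

/-! ### Plaques -/

theorem mem_levelStar_iff {m : ℕ} {h : j ≤ m} {p w : ζ.Level m} : w ∈ V.levelStar h p 1 ↔
    w = p ∨ ∃ γ ∈ V.raysAt h p, ∃ t, γ t = w := by
  constructor
  · rintro (hw | ⟨γ, hγ, t, -, he⟩)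
    · exact Or.inl hw
    · exact Or.inr ⟨γ, hγ, t, he⟩
  · rintro (hw | ⟨γ, hγ, t, he⟩)
    · exact Or.inl hw
    · exact Or.inr ⟨γ, hγ, t, t.2.2, he⟩

/-- The level stars at the various points over the center are open and disjoint, and they cover the
preimage of the star neighborhood. -/
theorem subset_levelStar {m : ℕ} (h : j ≤ m) {Q : Set (ζ.Level m)} (hQ : IsPreconnected Q)
    (hc : ∀ w ∈ Q, ζ.down h w ∈ V.carrier) {p : ζ.Level m} (hp : ζ.down h p = V.center) {w : ζ.Level m}
    (hw : w ∈ Q) (hwp : w ∈ V.levelStar h p 1) : Q ⊆ V.levelStar h p 1 := by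
  refine hQ.subset_of_disjoint_cover (O := fun p : {p // ζ.down h p = V.center} => V.levelStar h p 1)
    (i := ⟨p, hp⟩) (fun p => V.isOpen_levelStar p.2 one_pos) ?_ ?_ hw hwp
  · intro v hv
    obtain ⟨i, t, ht⟩ := hc v hv
    by_cases ht0 : t = Ray.zero
    · subst ht0
      rw [V.ray_zero] at ht
      exact mem_iUnion.2 ⟨⟨v, ht.symm⟩, Or.inl rfl⟩
    · obtain ⟨γ, hγ, he⟩ := V.exists_lift ht0 ht.symm
      exact mem_iUnion.2 ⟨⟨γ Ray.zero, V.down_center hγ⟩,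
        V.mem_levelStar_iff.2 (Or.inr ⟨γ, ⟨rfl, i, hγ⟩, t, he⟩)⟩
  · rintro ⟨p, hp⟩ ⟨q, hq⟩ hne v - hv hv'
    refine hne (Subtype.ext ?_)
    rw [V.mem_levelStar_iff] at hv hv'
    have hcen : ∀ {p q : ζ.Level m}, ζ.down h p = V.center → ζ.down h q = V.center →
        ∀ γ ∈ V.raysAt h q, ∀ t, γ t = p → p = q := by
      rintro p q hp hq γ ⟨h0, i, hi⟩ t rfl
      rw [hi.2, V.ray_eq_center] at hp
      rw [hp, h0]
    rcases hv with rfl | ⟨γ, hγ, t, rfl⟩ <;> rcases hv' with hv' | ⟨γ', hγ', t', he⟩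
    · exact hv'
    · exact hcen hp hq γ' hγ' t' he
    · exact (hcen hq hp γ hγ t hv').symm
    · obtain ⟨i, hi⟩ := hγ.2
      obtain ⟨k, hk⟩ := hγ'.2
      obtain ⟨h1, h2⟩ := V.lift_inj hk hi he
      subst h1
      rcases h2 with h2 | h2
      · subst h2
        change p = q
        exact hγ.1.symm.trans (he.symm.trans hγ'.1)
      · change p = q
        exact hγ.1.symm.trans ((congrFun h2.2.symm Ray.zero).trans hγ'.1)

theorem mem_plaque_self (hstab : ζ.IsStabilized) (hy : ζ.proj j y = V.center) : y ∈ V.plaque y := by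
  obtain ⟨a, ha⟩ := V.exists_mem_xraysAt hstab hy
  exact ⟨a, ha, Ray.zero, ha.1⟩

/-- A connected set over a standard star neighborhood lies in one plaque. -/
theorem subset_plaque (hstab : ζ.IsStabilized) (hy : ζ.proj j y = V.center) {Q : Set ζ.Solenoid}
    (hQ : IsPreconnected Q) (hc : ∀ w ∈ Q, ζ.proj j w ∈ V.carrier) (hyQ : y ∈ Q) : Q ⊆ V.plaque y := by
  intro z hz
  -- At every level the projection of `Q` stays in the star of the projection of `y`; hence the lift
  -- through `z` starts at `y` at all levels.
  have hstar : ∀ m (hm : j ≤ m), ζ.proj m z ∈ V.levelStar hm (ζ.proj m y) 1 := by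
    intro m hm
    refine V.subset_levelStar hm (hQ.image _ (ζ.continuous_proj m).continuousOn) ?_
      (by rw [ζ.down_proj, hy]) (mem_image_of_mem _ hyQ) (Or.inl rfl) (mem_image_of_mem _ hz)
    rintro _ ⟨w, hw, rfl⟩
    rw [ζ.down_proj]; exact hc w hw
  obtain ⟨i, t, ht⟩ := hc z hz
  by_cases ht0 : t = Ray.zero
  · subst ht0
    rw [V.ray_zero] at ht
    have : z = y := by
      refine ζ.ext_of_le j fun m hm => ?_
      rcases V.mem_levelStar_iff.1 (hstar m hm) with h | ⟨γ, hγ, s, hs⟩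
      · exact h
      · obtain ⟨k, hk⟩ := hγ.2
        have h1 := hk.2 s
        rw [hs, ζ.down_proj, ← ht, eq_comm, V.ray_eq_center] at h1
        rw [← hs, h1, hγ.1]
    rw [this]; exact V.mem_plaque_self hstab hy
  · obtain ⟨γ, hγ, he⟩ := V.exists_xlift ht0 ht.symm
    refine ⟨γ, ⟨ζ.ext_of_le j fun m hm => ?_, i, hγ⟩, t, he⟩
    rcases V.mem_levelStar_iff.1 (hstar m hm) with h | ⟨γ', hγ', s, hs⟩
    · have h1 : ζ.proj j z = ζ.proj j y := ζ.proj_eq_of_le hm h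
      rw [← ht, hy, V.ray_eq_center] at h1
      exact absurd h1 ht0
    · obtain ⟨k, hk⟩ := hγ'.2
      have h1 : ζ.proj m (γ t) = γ' s := by rw [he, hs]
      have h2 := ((V.lift_inj (V.proj_xlift hm hγ) hk h1).2.resolve_left ht0).2
      exact (congrFun h2 Ray.zero).trans hγ'.1

theorem xlift_proj_mem (hγ : γ ∈ V.xlifts i) (t : Ray) : ζ.proj j (γ t) ∈ V.carrier :=
  hγ.2 t ▸ V.ray_mem i t

/-- A lift of a prong lies in one path component. -/
theorem joinedIn_xlift (hγ : γ ∈ V.xlifts i) {O : Set ζ.Solenoid} {T : Set Ray} (hT : T.OrdConnected)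
    (hO : ∀ t ∈ T, γ t ∈ O) {s t : Ray} (hs : s ∈ T) (ht : t ∈ T) : JoinedIn O (γ s) (γ t) := by
  have hval : Convex ℝ (Subtype.val '' T : Set ℝ) := by
    refine Set.OrdConnected.convex ⟨?_⟩
    rintro _ ⟨a, ha, rfl⟩ _ ⟨b, hb, rfl⟩ c hc
    exact ⟨⟨c, a.2.1.trans hc.1, hc.2.trans_lt b.2.2⟩, hT.out ha hb hc, rfl⟩
  have hpc : IsPathConnected T := by
    rw [IsInducing.subtypeVal.isPathConnected_iff]
    exact hval.isPathConnected ⟨s, s, hs, rfl⟩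
  have := (hpc.image hγ.1).joinedIn _ (mem_image_of_mem _ hs) _ (mem_image_of_mem _ ht)
  refine this.mono ?_
  rintro _ ⟨r, hr, rfl⟩
  exact hO r hr

theorem pathComponentIn_eq_plaque (hstab : ζ.IsStabilized) (hy : ζ.proj j y = V.center) :
    pathComponentIn (ζ.proj j ⁻¹' V.carrier) y = V.plaque y := by
  have hyO : y ∈ ζ.proj j ⁻¹' V.carrier := by
    rw [mem_preimage, hy]; exact V.center_mem
  refine Subset.antisymm ?_ ?_
  · refine V.subset_plaque hstab hy (isPathConnected_pathComponentIn hyO).isConnected.isPreconnected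
      (fun w hw => (pathComponentIn_subset hw : w ∈ ζ.proj j ⁻¹' V.carrier)) (mem_pathComponentIn_self hyO)
  · rintro _ ⟨γ, hγ, t, rfl⟩
    obtain ⟨i, hi⟩ := hγ.2
    have := V.joinedIn_xlift hi (O := ζ.proj j ⁻¹' V.carrier) ordConnected_univ
      (fun s _ => V.xlift_proj_mem hi s) (mem_univ Ray.zero) (mem_univ t)
    rwa [hγ.1] at this

/-- Plaques are star sets. -/
theorem exists_isStarChart_plaque (hstab : ζ.IsStabilized) (hy : ζ.proj j y = V.center) :
    ∃ (a : Fin (V.xraysAt y).ncard → Ray → ζ.Solenoid) (h : _),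
      IsStarChart (V.xraysAt y).ncard y (V.plaque y) h ∧ (∀ i t, h (starPoint i t) = a i t) ∧
      (∀ i, a i ∈ V.xraysAt y) ∧ ∀ γ ∈ V.xraysAt y, ∃ i, a i = γ := by
  have := (V.finite_xraysAt hstab y).to_subtype
  let e := (Finite.equivFin (V.xraysAt y)).symm
  obtain ⟨h, hh, hr⟩ := V.exists_isStarChart_xrays (V.two_le_ncard_xraysAt hstab hy)
    (a := fun i => (e i).1) (fun i => (e i).2) (fun i k hik => e.injective (Subtype.ext hik))
  have hsurj : ∀ γ ∈ V.xraysAt y, ∃ i, (e i).1 = γ := fun γ hγ =>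
    ⟨e.symm ⟨γ, hγ⟩, by rw [Equiv.apply_symm_apply]⟩
  refine ⟨_, h, ?_, hr, fun i => (e i).2, hsurj⟩
  convert hh using 1
  ext z
  constructor
  · rintro ⟨γ, hγ, t, rfl⟩
    obtain ⟨i, rfl⟩ := hsurj γ hγ
    exact ⟨i, t, rfl⟩
  · rintro ⟨i, t, rfl⟩
    exact ⟨_, (e i).2, t, rfl⟩

end GraphTower.StdStar

open MetricGraph

namespace GraphTower

/-! ### Construction of standard star neighborhoods -/

section
variable {ζ : GraphTower} {j : ℕ} (x : ζ.Level j) (r : (ζ.graph j).E × Bool → ℝ)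

/-- The star neighborhood whose prongs are initial segments of the arms at a point. -/
def armStar (hr : IsArmRadius x r) (hs : ∀ d ∈ arms x, ∀ s ∈ Ioo 0 (r d),
    ¬ ζ.IsSpecial j ((ζ.graph j).along d (armPos x d + s))) : ζ.StdStar j :=
  have hm : ∀ d ∈ arms x, ∀ t : Ray, t ≠ Ray.zero → (t : ℝ) * r d ∈ Ioo 0 (r d) := fun d hd t ht =>
    ⟨mul_pos (Ray.ne_zero_iff.1 ht) (hr.pos d hd), mul_lt_of_lt_one_left (hr.pos d hd) t.2.2⟩
  have hI : ∀ d ∈ arms x, ∀ s ∈ Ioo 0 (r d), armPos x d + s ∈ Ioo 0 ((ζ.graph j).len d.1) :=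
    fun d hd s h => ⟨by linarith [armPos_nonneg hd, h.1], by linarith [hr.le_len d hd, h.2]⟩
  have hc : ∀ d ∈ arms x, ∀ t : Ray, (ζ.graph j).along d (armPos x d + t * r d) = x → t = Ray.zero := by
    intro d hd t he
    by_contra ht
    have h1 := along_injOn (hI d hd _ (hm d hd t ht)) (he.trans (along_armPos hd).symm)
    linarith [(hm d hd t ht).1]
  haveI := (finite_arms x).to_subtype
  let e : Fin (arms x).ncard → (ζ.graph j).E × Bool := fun i => ((Finite.equivFin (arms x)).symm i).1
  have he : ∀ i, e i ∈ arms x := fun i => ((Finite.equivFin (arms x)).symm i).2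
  have hsurj : ∀ d ∈ arms x, ∃ i, e i = d := fun d hd =>
    ⟨Finite.equivFin (arms x) ⟨d, hd⟩, congrArg Subtype.val (Equiv.symm_apply_apply _ _)⟩
  have h0 : ∀ i, (ζ.graph j).along (e i) (armPos x (e i) + (Ray.zero : ℝ) * r (e i)) = x := fun i => by
    rw [show ((Ray.zero : Ray) : ℝ) = 0 from rfl, zero_mul, add_zero, along_armPos (he i)]
  { N := (arms x).ncard
    two_le := two_le_ncard_arms x
    center := x
    ray := fun i t => (ζ.graph j).along (e i) (armPos x (e i) + t * r (e i))
    continuous_ray := fun i => (continuous_along _).comp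
      (continuous_const.add (continuous_subtype_val.mul continuous_const))
    ray_zero := h0
    ray_inj := by
      intro i k s t hst
      by_cases hs0 : s = Ray.zero
      · subst hs0
        rw [h0] at hst
        exact ⟨(hc _ (he k) t hst.symm).symm, Or.inl rfl⟩
      by_cases ht0 : t = Ray.zero
      · subst ht0
        rw [h0] at hst
        exact absurd (hc _ (he i) s hst) hs0
      obtain ⟨h1, h2⟩ := hr.eq_of_along_eq (he i) (he k) (hm _ (he i) s hs0) (hm _ (he k) t ht0) hst
      have h3 : i = k := (Finite.equivFin (arms x)).symm.injective (Subtype.ext h1)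
      subst h3
      exact ⟨Subtype.ext (mul_right_cancel₀ (hr.pos _ (he i)).ne' h2), Or.inr rfl⟩
    isOpen_piece := by
      intro i O hO hO0
      obtain ⟨O', hO', rfl⟩ := isOpen_induced_iff.1 hO
      have hp := hr.pos _ (he i)
      have hset : (fun t : Ray => (ζ.graph j).along (e i) (armPos x (e i) + t * r (e i))) ''
          (Subtype.val ⁻¹' O') = (ζ.graph j).along (e i) ''
            ((fun u => (u - armPos x (e i)) / r (e i)) ⁻¹' (O' ∩ Ioo 0 1)) := by
        ext y; constructor
        · rintro ⟨t, ht, rfl⟩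
          have ht0 : t ≠ Ray.zero := fun h => hO0 (h ▸ ht)
          refine ⟨_, ?_, rfl⟩
          have : (armPos x (e i) + t * r (e i) - armPos x (e i)) / r (e i) = t := by
            field_simp; ring
          rw [mem_preimage, this]
          exact ⟨ht, Ray.ne_zero_iff.1 ht0, t.2.2⟩
        · rintro ⟨u, hu, rfl⟩
          refine ⟨⟨(u - armPos x (e i)) / r (e i), hu.2.1.le, hu.2.2⟩, hu.1, ?_⟩
          change (ζ.graph j).along _ (armPos x (e i) + (u - armPos x (e i)) / r (e i) * r (e i)) = _
          rw [div_mul_cancel₀ _ hp.ne']; congr 1; ring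
      rw [hset]
      refine isOpen_along_image ((hO'.inter isOpen_Ioo).preimage (by fun_prop)) ?_
      intro u hu
      have h1 : 0 < u - armPos x (e i) := (div_pos_iff_of_pos_right hp).1 hu.2.1
      have h2 : u - armPos x (e i) < r (e i) := (div_lt_one hp).1 hu.2.2
      exact ⟨by linarith [armPos_nonneg (he i)], by linarith [hr.le_len _ (he i)]⟩
    isOpen_core := by
      intro ρ hρ
      have hρ' : 0 < min ρ 1 := lt_min hρ one_pos
      convert isOpen_star (x := x) (r := fun d => min ρ 1 * r d)
        (fun d hd => mul_pos hρ' (hr.pos d hd)) (fun d hd => by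
          have := mul_le_of_le_one_left (hr.pos d hd).le (min_le_right ρ 1)
          linarith [hr.le_len d hd]) using 1
      ext y; constructor
      · rintro ⟨i, t, ht, rfl⟩
        by_cases ht0 : t = Ray.zero
        · subst ht0; exact Or.inl (h0 i)
        · refine Or.inr (mem_biUnion (he i) ⟨_, ⟨?_, ?_⟩, rfl⟩)
          · linarith [(hm _ (he i) t ht0).1]
          · have := mul_lt_mul_of_pos_right (lt_min ht t.2.2) (hr.pos _ (he i))
            linarith
      · rintro (rfl | hy)
        · exact ⟨⟨0, two_pos.trans_le (two_le_ncard_arms _)⟩, Ray.zero, hρ, h0 _⟩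
        · obtain ⟨d, hd, u, hu, rfl⟩ := mem_iUnion₂.1 hy
          obtain ⟨i, rfl⟩ := hsurj d hd
          have hp := hr.pos _ (he i)
          have h1 : (u - armPos x (e i)) / r (e i) < min ρ 1 := by
            rw [div_lt_iff₀ hp]; linarith [hu.2]
          have h2 : 0 ≤ (u - armPos x (e i)) / r (e i) :=
            div_nonneg (by linarith [hu.1]) hp.le
          refine ⟨i, ⟨_, h2, h1.trans_le (min_le_right _ _)⟩, h1.trans_le (min_le_left _ _), ?_⟩
          change (ζ.graph j).along _ (armPos x (e i) + (u - armPos x (e i)) / r (e i) * r (e i)) = _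
          rw [div_mul_cancel₀ _ hp.ne']; congr 1; ring
    not_special := fun i t ht => hs _ (he i) _ (hm _ (he i) t ht) }

variable {x r} {hr : IsArmRadius x r} {hs : ∀ d ∈ arms x, ∀ s ∈ Ioo 0 (r d),
    ¬ ζ.IsSpecial j ((ζ.graph j).along d (armPos x d + s))}

theorem armStar_ray (i : Fin (armStar x r hr hs).N) : ∃ d ∈ arms x, ∀ t : Ray,
    (armStar x r hr hs).ray i t = (ζ.graph j).along d (armPos x d + t * r d) := by
  have := (finite_arms x).to_subtype
  exact ⟨_, ((Finite.equivFin (arms x)).symm i).2, fun t => rfl⟩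

end

namespace StdStar

/-- The open prongs do not lie over optimal points. -/
def Fine {ζ : GraphTower} {j : ℕ} (V : ζ.StdStar j) : Prop :=
  ∀ i t, t ≠ Ray.zero → ζ.down (Nat.zero_le j) (V.ray i t) ∉ ζ.opt

/-- The standard star neighborhood of a point of a prong that is given by the prong. -/
def onProng {ζ : GraphTower} {j : ℕ} (V : ζ.StdStar j) (i : Fin V.N) (t₀ : Ray)
    (ht₀ : t₀ ≠ Ray.zero) : ζ.StdStar j :=
  have hp : 0 < (t₀ : ℝ) := Ray.ne_zero_iff.1 ht₀
  have hq : 0 < 1 - (t₀ : ℝ) := sub_pos.2 t₀.2.2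
  -- The two new prongs run affinely from `t₀` to the two ends of the old open prong.
  let fwd : Ray → Ray := fun s => ⟨t₀ + s * (1 - t₀), by
    constructor
    · linarith [mul_nonneg s.2.1 hq.le]
    · linarith [mul_lt_of_lt_one_left hq s.2.2]⟩
  let bwd : Ray → Ray := fun s => ⟨t₀ - s * t₀, by
    constructor
    · linarith [mul_lt_of_lt_one_left hp s.2.2]
    · linarith [mul_nonneg s.2.1 hp.le, t₀.2.2]⟩
  have hf0 : ∀ s, fwd s ≠ Ray.zero := fun s => Ray.ne_zero_iff.2 (by
    change 0 < (t₀ : ℝ) + s * (1 - t₀); linarith [mul_nonneg s.2.1 hq.le])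
  have hb0 : ∀ s, bwd s ≠ Ray.zero := fun s => Ray.ne_zero_iff.2 (by
    change 0 < (t₀ : ℝ) - s * t₀; linarith [mul_lt_of_lt_one_left hp s.2.2])
  have hfz : fwd Ray.zero = t₀ := Subtype.ext (by
    change (t₀ : ℝ) + 0 * (1 - t₀) = t₀; ring)
  have hbz : bwd Ray.zero = t₀ := Subtype.ext (by change (t₀ : ℝ) - 0 * t₀ = t₀; ring)
  have hfi : ∀ s t, fwd s = fwd t → s = t := fun s t h => by
    have : (t₀ : ℝ) + s * (1 - t₀) = t₀ + t * (1 - t₀) := congrArg Subtype.val h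
    exact Subtype.ext (mul_right_cancel₀ hq.ne' (add_left_cancel this))
  have hbi : ∀ s t, bwd s = bwd t → s = t := fun s t h => by
    have : (t₀ : ℝ) - s * t₀ = t₀ - t * t₀ := congrArg Subtype.val h
    exact Subtype.ext (mul_right_cancel₀ hp.ne' (by linarith))
  have hfb : ∀ s t, fwd s = bwd t → s = t ∧ s = Ray.zero := fun s t h => by
    have : (t₀ : ℝ) + s * (1 - t₀) = t₀ - t * t₀ := congrArg Subtype.val h
    have h1 := mul_nonneg s.2.1 hq.le
    have h2 := mul_nonneg t.2.1 hp.le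
    have h3 : (s : ℝ) = 0 := by
      rcases mul_eq_zero.1 (show (s : ℝ) * (1 - t₀) = 0 by linarith) with h | h
      · exact h
      · exact absurd h hq.ne'
    have h4 : (t : ℝ) = 0 := by
      rcases mul_eq_zero.1 (show (t : ℝ) * t₀ = 0 by linarith) with h | h
      · exact h
      · exact absurd h hp.ne'
    exact ⟨Subtype.ext (h3.trans h4.symm), Subtype.ext h3⟩
  have hfw : ∀ u : Ray, (t₀ : ℝ) < u → ∃ s : Ray, s ≠ Ray.zero ∧ fwd s = u ∧
      (s : ℝ) = (u - t₀) / (1 - t₀) := fun u hu =>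
    ⟨⟨(u - t₀) / (1 - t₀), div_nonneg (by linarith) hq.le, by
      rw [div_lt_one hq]; linarith [u.2.2]⟩, Ray.ne_zero_iff.2 (div_pos (by linarith) hq),
      Subtype.ext (by
        change (t₀ : ℝ) + (u - t₀) / (1 - t₀) * (1 - t₀) = u
        rw [div_mul_cancel₀ _ hq.ne']; ring), rfl⟩
  have hbw : ∀ u : Ray, u ≠ Ray.zero → (u : ℝ) < t₀ → ∃ s : Ray, s ≠ Ray.zero ∧ bwd s = u ∧
      (s : ℝ) = (t₀ - u) / t₀ := fun u hu0 hu =>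
    ⟨⟨(t₀ - u) / t₀, div_nonneg (by linarith) hp.le, by
      rw [div_lt_one hp]; linarith [Ray.ne_zero_iff.1 hu0]⟩,
      Ray.ne_zero_iff.2 (div_pos (by linarith) hp), Subtype.ext (by
        change (t₀ : ℝ) - (t₀ - u) / t₀ * t₀ = u
        rw [div_mul_cancel₀ _ hp.ne']; ring), rfl⟩
  have hcf : Continuous fwd := by
    refine Continuous.subtype_mk ?_ _
    exact continuous_const.add (continuous_subtype_val.mul continuous_const)
  have hcb : Continuous bwd := by
    refine Continuous.subtype_mk ?_ _
    exact continuous_const.sub (continuous_subtype_val.mul continuous_const)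
  { N := 2
    two_le := le_rfl
    center := V.ray i t₀
    ray := fun k s => V.ray i (if k = 0 then fwd s else bwd s)
    continuous_ray := fun k => by
      by_cases hk : k = 0
      · simp only [hk, if_true]; exact (V.continuous_ray i).comp hcf
      · simp only [hk, if_false]; exact (V.continuous_ray i).comp hcb
    ray_zero := fun k => by by_cases hk : k = 0 <;> simp only [hk, if_true, if_false, hfz, hbz]
    ray_inj := by
      intro k l s t h
      have h1 := (V.ray_inj _ _ _ _ h).1
      by_cases hk : k = 0 <;> by_cases hl : l = 0
      · rw [if_pos hk, if_pos hl] at h1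
        exact ⟨hfi _ _ h1, Or.inr (hk.trans hl.symm)⟩
      · rw [if_pos hk, if_neg hl] at h1
        exact ⟨(hfb _ _ h1).1, Or.inl (hfb _ _ h1).2⟩
      · rw [if_neg hk, if_pos hl] at h1
        obtain ⟨a, b⟩ := hfb _ _ h1.symm
        exact ⟨a.symm, Or.inl (a ▸ b)⟩
      · rw [if_neg hk, if_neg hl] at h1
        exact ⟨hbi _ _ h1, Or.inr (by omega)⟩
    isOpen_piece := by
      intro k O hO h0
      have hop : IsOpenMap (fun s : {s : Ray // s ≠ Ray.zero} => fwd s) ∧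
          IsOpenMap (fun s : {s : Ray // s ≠ Ray.zero} => bwd s) := by
        -- A map with open image and a continuous left inverse is open; both affine
        -- reparameterizations are of this kind at positive parameters.
        have gen : ∀ (φ : Ray → Ray) (g : Ray → ℝ) (A : Set Ray), Continuous g → IsOpen A →
            (∀ u, u ∈ A ↔ ∃ s, s ≠ Ray.zero ∧ φ s = u) →
            (∀ s, s ≠ Ray.zero → g (φ s) = s) → 
            IsOpenMap (fun s : {s : Ray // s ≠ Ray.zero} => φ s) := by
          intro φ g A hg hA hAφ hgφ W hW
          obtain ⟨W', hW', rfl⟩ := isOpen_induced_iff.1 hW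
          obtain ⟨W'', hW'', rfl⟩ := isOpen_induced_iff.1 hW'
          convert hA.inter (hW''.preimage hg) using 1
          ext u; constructor
          · rintro ⟨s, hs, rfl⟩
            refine ⟨(hAφ _).2 ⟨s, s.2, rfl⟩, ?_⟩
            rw [mem_preimage, hgφ _ s.2]; exact hs
          · rintro ⟨hu, hu'⟩
            obtain ⟨s, hs, rfl⟩ := (hAφ _).1 hu
            rw [mem_preimage, hgφ _ hs] at hu'
            exact ⟨⟨s, hs⟩, hu', rfl⟩
        constructor
        · refine gen fwd (fun u => ((u : ℝ) - t₀) / (1 - t₀)) {u | (t₀ : ℝ) < u} (by fun_prop)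
            (isOpen_lt continuous_const continuous_subtype_val) ?_ ?_
          · intro u; constructor
            · intro hu
              obtain ⟨s, h1, h2, -⟩ := hfw u hu
              exact ⟨s, h1, h2⟩
            · rintro ⟨s, h1, rfl⟩
              change (t₀ : ℝ) < t₀ + s * (1 - t₀)
              linarith [mul_pos (Ray.ne_zero_iff.1 h1) hq]
          · intro s _
            change ((t₀ : ℝ) + s * (1 - t₀) - t₀) / (1 - t₀) = s
            field_simp; ring
        · refine gen bwd (fun u => ((t₀ : ℝ) - u) / t₀) {u | u ≠ Ray.zero ∧ (u : ℝ) < t₀} (by fun_prop)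
            (Ray.isOpen_pos.inter (isOpen_lt continuous_subtype_val continuous_const)) ?_ ?_
          · intro u; constructor
            · rintro ⟨hu0, hu⟩
              obtain ⟨s, h1, h2, -⟩ := hbw u hu0 hu
              exact ⟨s, h1, h2⟩
            · rintro ⟨s, h1, rfl⟩
              refine ⟨hb0 s, ?_⟩
              change (t₀ : ℝ) - s * t₀ < t₀
              linarith [mul_pos (Ray.ne_zero_iff.1 h1) hp]
          · intro s _
            change ((t₀ : ℝ) - (t₀ - s * t₀)) / t₀ = s
            field_simp; ring
      have himg : ∀ φ : Ray → Ray, IsOpenMap (fun s : {s : Ray // s ≠ Ray.zero} => φ s) →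
          IsOpen (φ '' O) := by
        intro φ hφ
        convert hφ _ (hO.preimage continuous_subtype_val) using 1
        ext u; constructor
        · rintro ⟨s, hs, rfl⟩
          exact ⟨⟨s, fun h => h0 (h ▸ hs)⟩, hs, rfl⟩
        · rintro ⟨s, hs, rfl⟩; exact ⟨s, hs, rfl⟩
      by_cases hk : k = 0
      · simp only [hk, if_true]
        rw [← image_image (V.ray i) fwd]
        refine V.isOpen_piece i _ (himg _ hop.1) ?_
        rintro ⟨s, -, h⟩; exact hf0 s h
      · simp only [hk, if_false]
        rw [← image_image (V.ray i) bwd]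
        refine V.isOpen_piece i _ (himg _ hop.2) ?_
        rintro ⟨s, -, h⟩; exact hb0 s h
    isOpen_core := by
      intro ρ hρ
      have hset : {x | ∃ k : Fin 2, ∃ s : Ray, (s : ℝ) < ρ ∧
          V.ray i (if k = 0 then fwd s else bwd s) = x} = V.ray i ''
          {u | u ≠ Ray.zero ∧ (t₀ : ℝ) - ρ * t₀ < u ∧ (u : ℝ) < t₀ + ρ * (1 - t₀)} := by
        ext x; constructor
        · rintro ⟨k, s, hs, rfl⟩
          refine ⟨_, ?_, rfl⟩
          by_cases hk : k = 0
          · rw [if_pos hk]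
            refine ⟨hf0 s, ?_, ?_⟩
            · change (t₀ : ℝ) - ρ * t₀ < t₀ + s * (1 - t₀)
              linarith [mul_pos hρ hp, mul_nonneg s.2.1 hq.le]
            · change (t₀ : ℝ) + s * (1 - t₀) < t₀ + ρ * (1 - t₀)
              linarith [mul_lt_mul_of_pos_right hs hq]
          · rw [if_neg hk]
            refine ⟨hb0 s, ?_, ?_⟩
            · change (t₀ : ℝ) - ρ * t₀ < t₀ - s * t₀
              linarith [mul_lt_mul_of_pos_right hs hp]
            · change (t₀ : ℝ) - s * t₀ < t₀ + ρ * (1 - t₀)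
              linarith [mul_pos hρ hq, mul_nonneg s.2.1 hp.le]
        · rintro ⟨u, ⟨hu0, hu1, hu2⟩, rfl⟩
          rcases lt_trichotomy (u : ℝ) t₀ with h | h | h
          · obtain ⟨s, -, h1, h2⟩ := hbw u hu0 h
            refine ⟨1, s, ?_, ?_⟩
            · rw [h2, div_lt_iff₀ hp]; linarith
            · rw [if_neg (by decide), h1]
          · refine ⟨0, Ray.zero, hρ, ?_⟩
            rw [if_pos rfl, hfz, Subtype.ext h]
          · obtain ⟨s, -, h1, h2⟩ := hfw u h
            refine ⟨0, s, ?_, ?_⟩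
            · rw [h2, div_lt_iff₀ hq]; linarith
            · rw [if_pos rfl, h1]
      rw [hset]
      refine V.isOpen_piece i _ ?_ fun h => h.1 rfl
      exact Ray.isOpen_pos.inter ((isOpen_lt continuous_const continuous_subtype_val).inter
        (isOpen_lt continuous_subtype_val continuous_const))
    not_special := fun k s _ => by
      refine V.not_special i _ ?_
      by_cases hk : k = 0
      · rw [if_pos hk]; exact hf0 s
      · rw [if_neg hk]; exact hb0 s }

end StdStar
end GraphTower

open MetricGraph

namespace GraphTower.StdStar

section
variable {ζ : GraphTower} {j : ℕ} (V : ζ.StdStar j)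

/-- Later arguments only use that the prongs of `onProng` are reparameterized pieces that together
exhaust the open prong. -/
theorem onProng_spec (i : Fin V.N) {t₀ : Ray} (ht₀ : t₀ ≠ Ray.zero) :
    ∃ φ : Fin (V.onProng i t₀ ht₀).N → Ray → Ray, (∀ k, Continuous (φ k)) ∧
      (∀ k s, φ k s ≠ Ray.zero) ∧ (∀ k, φ k Ray.zero = t₀) ∧
      (∀ k s, (V.onProng i t₀ ht₀).ray k s = V.ray i (φ k s)) ∧
      (∀ u, u ≠ Ray.zero → ∃ k s, φ k s = u) ∧ ∃ k l : Fin (V.onProng i t₀ ht₀).N, k ≠ l := by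
  have hp : 0 < (t₀ : ℝ) := Ray.ne_zero_iff.1 ht₀
  have hq : 0 < 1 - (t₀ : ℝ) := sub_pos.2 t₀.2.2
  have hex : ∀ (k : Fin 2) (s : Ray), ∃ u : Ray, (V.onProng i t₀ ht₀).ray k s = V.ray i u ∧
      (u : ℝ) = if k = 0 then (t₀ : ℝ) + s * (1 - t₀) else t₀ - s * t₀ := by
    intro k s
    by_cases hk : k = 0
    · subst hk; exact ⟨_, rfl, rfl⟩
    · obtain rfl : k = 1 := by omega
      exact ⟨_, rfl, rfl⟩
  choose φ hφ hφv using hex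
  refine ⟨φ, fun (k : Fin 2) => ?_, fun (k : Fin 2) s => ?_, fun (k : Fin 2) => Subtype.ext ?_, hφ,
    fun u hu => ?_, (0 : Fin 2), (1 : Fin 2), show (0 : Fin 2) ≠ 1 by decide⟩
  · refine continuous_induced_rng.2 ?_
    change Continuous fun s => ((φ k s : Ray) : ℝ)
    simp only [hφv]
    by_cases hk : k = 0
    · simp only [if_pos hk]; fun_prop
    · simp only [if_neg hk]; fun_prop
  · rw [Ray.ne_zero_iff, hφv]
    split_ifs
    · linarith [mul_nonneg s.2.1 hq.le]
    · linarith [mul_lt_of_lt_one_left hp s.2.2]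
  · rw [hφv]
    change (if k = 0 then (t₀ : ℝ) + 0 * (1 - t₀) else t₀ - 0 * t₀) = t₀
    split_ifs <;> ring
  · have hu' := Ray.ne_zero_iff.1 hu
    have hu1 : (u : ℝ) < 1 := u.2.2
    rcases le_total (t₀ : ℝ) u with h | h
    · refine ⟨(0 : Fin 2), ⟨(u - t₀) / (1 - t₀), div_nonneg (by linarith) hq.le, by
        rw [div_lt_one hq]; linarith⟩, Subtype.ext ?_⟩
      rw [hφv, if_pos rfl]
      change (t₀ : ℝ) + (u - t₀) / (1 - t₀) * (1 - t₀) = u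
      rw [div_mul_cancel₀ _ hq.ne']; ring
    · refine ⟨(1 : Fin 2), ⟨(t₀ - u) / t₀, div_nonneg (by linarith) hp.le, by
        rw [div_lt_one hp]; linarith⟩, Subtype.ext ?_⟩
      rw [hφv, if_neg (by decide)]
      change (t₀ : ℝ) - (t₀ - u) / t₀ * t₀ = u
      rw [div_mul_cancel₀ _ hp.ne']; ring

variable {V} in
theorem Fine.onProng (hV : V.Fine) (i : Fin V.N) {t₀ : Ray} (ht₀ : t₀ ≠ Ray.zero) :
    (V.onProng i t₀ ht₀).Fine := by
  obtain ⟨φ, -, h1, -, h2, -⟩ := V.onProng_spec i ht₀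
  intro k s _
  rw [h2]; exact hV _ _ (h1 k s)

end

variable {n : ℕ} {ζ : SplitSequence n} {j : ℕ}

/-- By properness only finitely many points lie over optimal points, so a short star avoids them
except possibly at its center. Such a star is standard, since special points lie over optimal
points. -/
theorem exists_fine (hproper : ζ.IsProper) (x : ζ.Level j) {U : Set (ζ.Level j)} (hU : U ∈ 𝓝 x) :
    ∃ V : GraphTower.StdStar ζ.toGraphTower j, V.center = x ∧ V.Fine ∧ V.carrier ⊆ U := by
  have hfin : ({y : ζ.Level j | ζ.down (Nat.zero_le j) y ∈ ζ.opt} \ {x}).Finite :=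
    (ζ.finite_preimage (Nat.zero_le j) hproper.finite_opt).subset sdiff_subset
  have hU' : U ∩ ({y : ζ.Level j | ζ.down (Nat.zero_le j) y ∈ ζ.opt} \ {x})ᶜ ∈ 𝓝 x :=
    Filter.inter_mem hU (hfin.isClosed.isOpen_compl.mem_nhds fun h => h.2 rfl)
  obtain ⟨δ, hδ, hrad, hδU⟩ := exists_isArmRadius hU'
  have hopt : ∀ d ∈ arms x, ∀ s ∈ Ioo 0 δ,
      ζ.down (Nat.zero_le j) ((ζ.graph j).along d (armPos x d + s)) ∉ ζ.opt := by
    intro d hd s hs h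
    have h1 : (ζ.graph j).along d (armPos x d + s) = x := by
      by_contra hne
      exact (hδU d hd s hs.1 hs.2).2 ⟨h, hne⟩
    have h2 : armPos x d + s ∈ Ioo 0 ((ζ.graph j).len d.1) :=
      ⟨by linarith [armPos_nonneg hd, hs.1], by linarith [hrad.le_len d hd, hs.2]⟩
    linarith [along_injOn h2 (h1.trans (along_armPos hd).symm), hs.1]
  have hmul : ∀ t : Ray, t ≠ Ray.zero → (t : ℝ) * δ ∈ Ioo 0 δ := fun t ht =>
    ⟨mul_pos (Ray.ne_zero_iff.1 ht) hδ, mul_lt_of_lt_one_left hδ t.2.2⟩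
  refine ⟨armStar x (fun _ => δ) hrad fun d hd s hs h => hopt d hd s hs h.mem_opt, rfl, ?_, ?_⟩
  · intro i t ht
    obtain ⟨d, hd, he⟩ := armStar_ray i
    rw [he]
    exact hopt d hd _ (hmul t ht)
  · rintro _ ⟨i, t, rfl⟩
    obtain ⟨d, hd, he⟩ := armStar_ray i
    by_cases ht : t = Ray.zero
    · subst ht
      rw [ray_zero]; exact mem_of_mem_nhds hU
    · rw [he]
      exact (hδU d hd _ (hmul t ht).1 (hmul t ht).2).1

variable (V : GraphTower.StdStar ζ.toGraphTower j) {i k : Fin V.N} {γ γ' : Ray → ζ.Solenoid}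
  {x y z : ζ.Solenoid}

theorem xraysAt_eq_pair (hstab : ζ.IsStabilized) (hn : ¬ ζ.IsPreSingularity y)
    (hγ : γ ∈ V.xraysAt y) (hγ' : γ' ∈ V.xraysAt y) (hne : γ ≠ γ') : V.xraysAt y = {γ, γ'} := by
  refine (eq_of_subset_of_ncard_le ?_ ?_ (V.finite_xraysAt hstab y)).symm
  · rintro _ (rfl | rfl)
    · exact hγ
    · exact hγ'
  · rw [ncard_pair hne, V.ncard_xraysAt_eq_two hstab (V.proj_of_mem_xraysAt hγ) hn]

theorem not_isPreSingularity_xlift (hstab : ζ.IsStabilized) (hγ : γ ∈ V.xlifts i) {t : Ray}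
    (ht : t ≠ Ray.zero) : ¬ ζ.IsPreSingularity (γ t) :=
  hstab.not_natural_vertex j _ (fun h => V.not_special i t ht (ζ.isSpecial_of_mem h)) _ (hγ.2 t)

/-- The point `γ t₀` is not a pre-singularity, so exactly two lifts start there; the two halves of
`γ` are such. Hence an open lift is itself a standard plaque, even if the lift starts at a
singularity. -/
theorem plaque_onProng (hstab : ζ.IsStabilized) (hγ : γ ∈ V.xlifts i) {t₀ : Ray}
    (ht₀ : t₀ ≠ Ray.zero) :
    (V.onProng i t₀ ht₀).plaque (γ t₀) = γ '' {t | t ≠ Ray.zero} := by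
  obtain ⟨φ, hc, h1, h0, h2, h3, p, q, hpq⟩ := V.onProng_spec i ht₀
  generalize V.onProng i t₀ ht₀ = W at φ hc h1 h0 h2 h3 p q hpq ⊢
  have hmem : ∀ k, γ ∘ φ k ∈ W.xraysAt (γ t₀) := fun k =>
    ⟨congrArg γ (h0 k), k, hγ.1.comp (hc k), fun s => (hγ.2 _).trans (h2 k s).symm⟩
  have hne : γ ∘ φ p ≠ γ ∘ φ q := by
    intro he
    have h4 := congrArg (ζ.proj j) (congrFun he Ray.half)
    change ζ.proj j (γ _) = ζ.proj j (γ _) at h4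
    rw [hγ.2, hγ.2, ← h2, ← h2] at h4
    exact hpq ((W.ray_inj _ _ _ _ h4).2.resolve_left Ray.half_ne)
  have hpair := W.xraysAt_eq_pair hstab (V.not_isPreSingularity_xlift hstab hγ ht₀)
    (hmem p) (hmem q) hne
  ext z; constructor
  · rintro ⟨δ, hδ, t, rfl⟩
    rw [hpair] at hδ
    rcases hδ with rfl | rfl
    · exact ⟨_, h1 _ t, rfl⟩
    · exact ⟨_, h1 _ t, rfl⟩
  · rintro ⟨u, hu, rfl⟩
    obtain ⟨k, s, rfl⟩ := h3 u hu
    exact ⟨_, hmem k, s, rfl⟩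

/-! ### Singularities -/

/-- Initial pieces of three lifts at `y` remain in the path component of `y`, and three disjoint
paths from one point do not fit in a two-pronged star. -/
theorem not_isStarSet_two_of_three (h3 : 3 ≤ (V.xraysAt y).ncard) {O : Set ζ.Solenoid}
    (hO : IsOpen O) (hy : y ∈ O) (p : ζ.Solenoid) : ¬ IsStarSet 2 p (pathComponentIn O y) := by
  intro H
  obtain ⟨T, hT, hcard⟩ := exists_subset_card_eq h3
  have hfin : T.Finite := finite_of_ncard_ne_zero (by omega)
  have := hfin.to_subtype
  have e : Fin 3 ≃ T := by
    rw [← hcard]; exact (Finite.equivFin T).symm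
  have hmem : ∀ i, (e i).1 ∈ V.xraysAt y := fun i => hT (e i).2
  have hcont : ∀ i, Continuous (e i).1 := fun i => by
    obtain ⟨k, hk⟩ := (hmem i).2; exact hk.1
  have hnhds : ∀ᶠ t in 𝓝 Ray.zero, ∀ i, (e i).1 t ∈ O := by
    rw [Filter.eventually_all]
    intro i
    exact (hcont i).continuousAt.eventually_mem (hO.mem_nhds (by rw [(hmem i).1]; exact hy))
  obtain ⟨ε, hε, hb⟩ := Metric.eventually_nhds_iff.1 hnhds
  let r : Ray := ⟨min (ε / 2) (1 / 2), le_min (by positivity) (by norm_num),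
    (min_le_right _ _).trans_lt (by norm_num)⟩
  have hr : r ≠ Ray.zero := Ray.ne_zero_iff.2 (lt_min (by positivity) (by norm_num))
  refine H.not_three_rays (β := fun i => (e i).1) hr hcont (fun i => (hmem i).1) ?_ ?_
  · intro i k s t he
    obtain ⟨h1, h2⟩ := V.xraysAt_inj (hmem i) (hmem k) he
    exact ⟨h1, h2.imp_right fun h => e.injective (Subtype.ext h)⟩
  · intro i t ht
    obtain ⟨k, hk⟩ := (hmem i).2
    have := V.joinedIn_xlift hk (O := O) (T := Iic r) ordConnected_Iic (fun s hs => by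
      refine hb (y := s) ?_ i
      rw [Subtype.dist_eq, Real.dist_eq]
      have h1 : (s : ℝ) ≤ r := hs
      have h2 : (r : ℝ) ≤ ε / 2 := min_le_left _ _
      change |(s : ℝ) - 0| < ε
      rw [sub_zero, abs_of_nonneg s.2.1]
      linarith) (s := Ray.zero) (t := t) r.2.1 ht
    rwa [(hmem i).1] at this

/-- If only two lifts start at `y`, the plaque over `V` is a two-pronged star, which cannot also
have three prongs. Conversely, with three lifts `y` is a pre-singularity, so it lies over the center
of every standard neighborhood containing it; its plaque there is a star that cannot be two-pronged.
-/
theorem mem_sing_iff (hstab : ζ.IsStabilized) (hy : ζ.proj j y = V.center) :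
    y ∈ ζ.sing ↔ 3 ≤ (V.xraysAt y).ncard := by
  constructor
  · intro h
    have hyO : y ∈ ζ.proj j ⁻¹' V.carrier := by rw [mem_preimage, hy]; exact V.center_mem
    obtain ⟨m, hm, p, f, hf⟩ := h _ ⟨j, _, _, V.isStandardStarNhd, rfl⟩ hyO
    by_contra h3
    have h2 : (V.xraysAt y).ncard = 2 := by
      have := V.two_le_ncard_xraysAt hstab hy
      omega
    obtain ⟨a, g, hg, -⟩ := V.exists_isStarChart_plaque hstab hy
    have hg' : ∃ n, n = 2 ∧ IsStarSet n y (V.plaque y) := ⟨_, h2, g, hg⟩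
    obtain ⟨_, rfl, g, hg⟩ := hg'
    rw [V.pathComponentIn_eq_plaque hstab hy] at hf
    let e : Fin 3 → Fin m := Fin.castLE hm
    refine IsStarSet.not_three_rays ⟨g, hg⟩ (β := fun i t => f (starPoint (e i) t)) (y := p)
      Ray.half_ne (fun i => hf.2.1.continuous.comp (continuous_starPoint _))
      (fun i => hf.apply_zero _) ?_ fun i t _ => hf.mem_iff.2 ⟨_, _, rfl⟩
    intro i k s t he
    obtain ⟨h1, h2⟩ := hf.inj he
    exact ⟨h1, h2.imp_right fun h => Fin.castLE_injective hm h⟩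
  · rintro h3 O ⟨l, p, U, hU, rfl⟩ hyO
    have hpre := V.isPreSingularity_of_three hstab hy h3
    obtain ⟨W, rfl, rfl⟩ := hU.exists_stdStar
    have hyW : ζ.proj l y = W.center := by
      obtain ⟨i, t, ht⟩ := hyO
      by_cases ht0 : t = Ray.zero
      · rw [← ht, ht0, W.ray_zero]
      · by_contra
        refine hstab.not_natural_vertex l (ζ.proj l y) (fun hv => ?_) y rfl hpre
        rw [← ht] at hv
        exact W.not_special i t ht0 (ζ.isSpecial_of_mem hv)
    have hno := V.not_isStarSet_two_of_three h3 (W.isOpen_carrier.preimage (ζ.continuous_proj l)) hyO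
    obtain ⟨a, g, hg, -⟩ := W.exists_isStarChart_plaque hstab hyW
    rw [← W.pathComponentIn_eq_plaque hstab hyW] at hg
    refine ⟨_, lt_of_le_of_ne hg.1 fun h2 => hno y ?_, y, g, hg⟩
    rw [h2]; exact ⟨g, hg⟩

theorem _root_.SplitSequence.isPreSingularity_of_mem_sing (hproper : ζ.IsProper)
    (hstab : ζ.IsStabilized) (hy : y ∈ ζ.sing) : ζ.IsPreSingularity y := by
  obtain ⟨V, hV, -, -⟩ := exists_fine hproper (ζ.proj 0 y) Filter.univ_mem
  exact V.isPreSingularity_of_three hstab hV.symm ((V.mem_sing_iff hstab hV.symm).1 hy)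

theorem xlift_notMem_sing (hproper : ζ.IsProper) (hstab : ζ.IsStabilized) (hγ : γ ∈ V.xlifts i)
    {t : Ray} (ht : t ≠ Ray.zero) : γ t ∉ ζ.sing := fun h =>
  V.not_isPreSingularity_xlift hstab hγ ht (ζ.isPreSingularity_of_mem_sing hproper hstab h)

theorem ncard_eq_two_iff (hstab : ζ.IsStabilized) (hy : ζ.proj j y = V.center) :
    (V.xraysAt y).ncard = 2 ↔ y ∉ ζ.sing := by
  rw [V.mem_sing_iff hstab hy]
  have := V.two_le_ncard_xraysAt hstab hy
  omega

theorem isStandardPlaque_plaque (hstab : ζ.IsStabilized) (hy : ζ.proj j y = V.center) :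
    ζ.IsStandardPlaque (V.plaque y) :=
  ⟨_, ⟨j, _, _, V.isStandardStarNhd, rfl⟩, y, by rw [mem_preimage, hy]; exact V.center_mem,
    (V.pathComponentIn_eq_plaque hstab hy).symm⟩

theorem isSingularPlaque_plaque (hstab : ζ.IsStabilized) (hy : ζ.proj j y = V.center)
    (hs : y ∈ ζ.sing) : ζ.IsSingularPlaque y (V.plaque y) := by
  obtain ⟨a, g, hg, -⟩ := V.exists_isStarChart_plaque hstab hy
  exact ⟨V.isStandardPlaque_plaque hstab hy, hs, _, g, hg⟩

theorem notMem_sing_of_mem_plaque (hproper : ζ.IsProper) (hstab : ζ.IsStabilized)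
    (hs : y ∉ ζ.sing) (hz : z ∈ V.plaque y) : z ∉ ζ.sing := by
  obtain ⟨γ, hγ, t, rfl⟩ := hz
  by_cases ht : t = Ray.zero
  · rwa [ht, hγ.1]
  · obtain ⟨i, hi⟩ := hγ.2
    exact V.xlift_notMem_sing hproper hstab hi ht

theorem isSingularPlaque_iff (hproper : ζ.IsProper) (hstab : ζ.IsStabilized)
    (hy : ζ.proj j y = V.center) : (∃ s, ζ.IsSingularPlaque s (V.plaque y)) ↔ y ∈ ζ.sing := by
  constructor
  · rintro ⟨s, -, hs, m, f, hf⟩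
    by_contra hy'
    exact V.notMem_sing_of_mem_plaque hproper hstab hy' hf.center_mem hs
  · exact fun h => ⟨y, V.isSingularPlaque_plaque hstab hy h⟩

theorem isLeafSegment_plaque (hproper : ζ.IsProper) (hstab : ζ.IsStabilized)
    (hy : ζ.proj j y = V.center) (hs : y ∉ ζ.sing) : ζ.IsLeafSegment (V.plaque y) :=
  ⟨V.isStandardPlaque_plaque hstab hy, fun h => hs ((V.isSingularPlaque_iff hproper hstab hy).1 h)⟩

theorem exists_mem_plaque (hstab : ζ.IsStabilized) (hx : ζ.proj j x ∈ V.carrier) :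
    ∃ y, ζ.proj j y = V.center ∧ x ∈ V.plaque y := by
  obtain ⟨i, t, ht⟩ := hx
  by_cases ht0 : t = Ray.zero
  · have hc : ζ.proj j x = V.center := by rw [← ht, ht0, V.ray_zero]
    exact ⟨x, hc, V.mem_plaque_self hstab hc⟩
  · obtain ⟨γ, hγ, he⟩ := V.exists_xlift ht0 ht.symm
    exact ⟨γ Ray.zero, by rw [hγ.2, V.ray_zero], γ, ⟨rfl, i, hγ⟩, t, he⟩

theorem pathComponentIn_eq_plaque_of_mem (hstab : ζ.IsStabilized) (hy : ζ.proj j y = V.center)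
    (hx : x ∈ V.plaque y) : pathComponentIn (ζ.proj j ⁻¹' V.carrier) x = V.plaque y := by
  rw [← V.pathComponentIn_eq_plaque hstab hy] at hx ⊢
  exact pathComponentIn_congr hx

/-- The plaques of a standard neighborhood are the unions of lifts of prongs. -/
theorem _root_.IsPlaqueOf.exists_plaque (hstab : ζ.IsStabilized) {P : Set ζ.Solenoid}
    (hP : IsPlaqueOf (ζ.proj j ⁻¹' V.carrier) P) : ∃ y, ζ.proj j y = V.center ∧ P = V.plaque y := by
  obtain ⟨x, hx, rfl⟩ := hP
  obtain ⟨y, hy, hxy⟩ := V.exists_mem_plaque hstab hx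
  exact ⟨y, hy, V.pathComponentIn_eq_plaque_of_mem hstab hy hxy⟩

end GraphTower.StdStar

open MetricGraph

namespace MetricGraph

variable {G : MetricGraph}

theorem exists_mem_openEdge {x : G.Point} (hx : x ∉ G.naturalVertices) : ∃ e, x ∈ G.openEdge e := by
  rcases x with v | ⟨e, t, h0, h1⟩
  · exact absurd ⟨v, rfl⟩ hx
  · exact ⟨e, t, ⟨h0, h1⟩, path_of_mem ⟨h0, h1⟩⟩

theorem notMem_naturalVertices_of_mem_openEdge {e : G.E} {x : G.Point} (hx : x ∈ G.openEdge e) :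
    x ∉ G.naturalVertices := by
  obtain ⟨t, ht, rfl⟩ := hx
  rw [path_of_mem ht]
  rintro ⟨v, hv⟩
  cases hv

theorem isPreconnected_openEdge (e : G.E) : IsPreconnected (G.openEdge e) :=
  isPreconnected_Ioo.image _ (continuous_path e).continuousOn

theorem isCompact_closedEdge (e : G.E) : IsCompact (G.closedEdge e) :=
  isCompact_Icc.image (continuous_path e)

theorem closedEdge_subset_closure (e : G.E) : G.closedEdge e ⊆ closure (G.openEdge e) := by
  unfold closedEdge openEdge
  rw [← closure_Ioo (G.len_pos e).ne]
  exact image_closure_subset_closure_image (continuous_path e)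

end MetricGraph

/-! ### Leafwise sets obstruct expansion -/

namespace SplitSequence

variable {n : ℕ} {ζ : SplitSequence n}

theorem notMem_naturalVertices_of_notMem_opt {x : ζ.Solenoid} (hx : ζ.proj 0 x ∉ ζ.opt) (k : ℕ) :
    ζ.proj k x ∉ (ζ.graph k).naturalVertices := fun h => hx (by
  rw [← ζ.down_proj (Nat.zero_le k)]
  exact (ζ.isSpecial_of_mem h).mem_opt)

/-- Sets of regular points that are unions of leaf segments and are finite on generic fibers. -/
structure IsLeafwise (ζ : SplitSequence n) (M : Set ζ.Solenoid) : Prop where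
  notMem_sing : ∀ z ∈ M, z ∉ ζ.sing
  plaque_subset : ∀ j (V : GraphTower.StdStar ζ.toGraphTower j), V.Fine → ∀ y, ζ.proj j y = V.center →
    y ∉ ζ.sing → (V.plaque y ∩ M).Nonempty → V.plaque y ⊆ M
  finite_fiber : ∀ x, x ∉ ζ.opt → (M ∩ ζ.fiber 0 x).Finite

namespace IsLeafwise

variable {M : Set ζ.Solenoid} {j : ℕ} {V : GraphTower.StdStar ζ.toGraphTower j}

/-- The start of the lift may be a singularity, where saturation gives nothing; but the open lift is
the plaque of a star neighborhood centered on the prong. -/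
theorem xlift_subset (hM : IsLeafwise ζ M) (hproper : ζ.IsProper) (hstab : ζ.IsStabilized)
    (hV : V.Fine) {i : Fin V.N} {γ : Ray → ζ.Solenoid} (hγ : γ ∈ V.xlifts i) {t : Ray}
    (ht : t ≠ Ray.zero) (h : γ t ∈ M) : γ '' {t | t ≠ Ray.zero} ⊆ M := by
  rw [← V.plaque_onProng hstab hγ ht]
  refine hM.plaque_subset j _ (hV.onProng i ht) _ (hγ.2 t)
    (V.xlift_notMem_sing hproper hstab hγ ht) ⟨γ t, ?_, h⟩
  rw [V.plaque_onProng hstab hγ ht]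
  exact ⟨t, ht, rfl⟩

/-- The lifts of prongs in a set of points. -/
def liftsIn (V : GraphTower.StdStar ζ.toGraphTower j) (M : Set ζ.Solenoid) : Set (Ray → ζ.Solenoid) :=
  {γ | (∃ i, γ ∈ V.xlifts i) ∧ γ '' {t | t ≠ Ray.zero} ⊆ M}

/-- The midpoint of a fine prong lies over a non-optimal point, where a leafwise set has finite
fibers, and midpoints determine lifts. -/
theorem finite_liftsIn (hM : IsLeafwise ζ M) (hV : V.Fine) : (liftsIn V M).Finite := by
  have : (⋃ i : Fin V.N, {γ | γ ∈ V.xlifts i ∧ γ '' {t | t ≠ Ray.zero} ⊆ M}).Finite := by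
    refine finite_iUnion fun i => ?_
    refine Finite.of_finite_image (f := fun γ => γ Ray.half) ?_ fun γ hγ γ' hγ' he =>
      V.xlift_unique hγ.1 hγ'.1 Ray.half_ne he
    refine (hM.finite_fiber _ (hV i Ray.half Ray.half_ne)).subset ?_
    rintro _ ⟨γ, hγ, rfl⟩
    refine ⟨hγ.2 ⟨_, Ray.half_ne, rfl⟩, ?_⟩
    change ζ.proj 0 (γ Ray.half) = _
    rw [← hγ.1.2, ζ.down_proj]
  refine this.subset ?_
  rintro γ ⟨⟨i, hi⟩, h⟩
  exact mem_iUnion.2 ⟨i, hi, h⟩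

theorem isOpen_off_xlift {i : Fin V.N} {γ : Ray → ζ.Solenoid} (hγ : γ ∈ V.xlifts i) :
    IsOpen {z | ζ.proj j z ∈ V.carrier ∧ γ (V.rad (ζ.proj j z)) ≠ z} := by
  have hc : ContinuousOn (fun z => (γ (V.rad (ζ.proj j z)), z)) (ζ.proj j ⁻¹' V.carrier) :=
    ContinuousOn.prodMk (hγ.1.comp_continuousOn (V.continuousOn_rad.comp
      (ζ.continuous_proj j).continuousOn fun _ hz => hz)) continuousOn_id
  exact hc.isOpen_inter_preimage (V.isOpen_carrier.preimage (ζ.continuous_proj j))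
    (isClosed_diagonal.isOpen_compl)

/-- Over a fine star neighborhood, the closure of a leafwise set consists of finitely many lifts. -/
theorem exists_mem_range (hM : IsLeafwise ζ M) (hproper : ζ.IsProper) (hstab : ζ.IsStabilized)
    (hV : V.Fine) {z : ζ.Solenoid} (hz : z ∈ closure M) (hzV : ζ.proj j z ∈ V.carrier) :
    ∃ γ ∈ liftsIn V M, z ∈ range γ := by
  by_contra! hcon
  have hopen : IsOpen (ζ.proj j ⁻¹' V.carrier ∩
      ⋂ γ ∈ liftsIn V M, {z | ζ.proj j z ∈ V.carrier ∧ γ (V.rad (ζ.proj j z)) ≠ z}) := by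
    refine (V.isOpen_carrier.preimage (ζ.continuous_proj j)).inter
      ((hM.finite_liftsIn hV).isOpen_biInter fun γ hγ => ?_)
    obtain ⟨i, hi⟩ := hγ.1
    exact isOpen_off_xlift hi
  -- If no lift in `M` contained `z`, deleting these finitely many lifts would leave a neighborhood
  -- of `z`. It contains a point of `M`, which nevertheless lies on a lift running inside `M`.
  obtain ⟨w, ⟨hwV, hw⟩, hwM⟩ := mem_closure_iff.1 hz _ hopen
    ⟨hzV, mem_iInter₂.2 fun γ hγ => ⟨hzV, fun he => hcon γ hγ ⟨_, he⟩⟩⟩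
  have hoff : ∀ γ ∈ liftsIn V M, ∀ t, γ t ≠ w := by
    rintro γ hγ t rfl
    obtain ⟨i, hi⟩ := hγ.1
    refine (mem_iInter₂.1 hw γ hγ).2 ?_
    rw [hi.2, V.rad_ray]
  obtain ⟨y, hy, γ, hγ, t, rfl⟩ := V.exists_mem_plaque hstab hwV
  obtain ⟨i, hi⟩ := hγ.2
  by_cases ht : t = Ray.zero
  · subst ht
    rw [hγ.1] at hwM
    refine hoff γ ⟨⟨i, hi⟩, ?_⟩ Ray.zero rfl
    have := hM.plaque_subset j V hV y hy (hM.notMem_sing y hwM) ⟨y, V.mem_plaque_self hstab hy, hwM⟩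
    rintro _ ⟨s, -, rfl⟩
    exact this ⟨γ, hγ, s, rfl⟩
  · exact hoff γ ⟨⟨i, hi⟩, hM.xlift_subset hproper hstab hV hi ht hwM⟩ t rfl

/-- At points over interior points of edges, the closure of a leafwise set projects onto a
neighborhood. -/
theorem image_closure_mem_nhds (hM : IsLeafwise ζ M) (hproper : ζ.IsProper) (hstab : ζ.IsStabilized)
    {z : ζ.Solenoid} (hz : z ∈ closure M) (hn : ζ.proj j z ∉ (ζ.graph j).naturalVertices) :
    ζ.proj j '' closure M ∈ 𝓝 (ζ.proj j z) := by
  obtain ⟨V, hVz, hV, -⟩ := GraphTower.StdStar.exists_fine hproper (ζ.proj j z) Filter.univ_mem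
  have hpre : ¬ ζ.IsPreSingularity z := hstab.not_natural_vertex j _ hn z rfl
  have hzs : z ∉ ζ.sing := fun h => hpre (ζ.isPreSingularity_of_mem_sing hproper hstab h)
  obtain ⟨γ, hγ, t, ht⟩ := hM.exists_mem_range hproper hstab hV hz (hVz ▸ V.center_mem)
  obtain ⟨i, hi⟩ := hγ.1
  have ht0 : t = Ray.zero := by
    rw [← V.ray_eq_center (i := i), ← hi.2, ht, hVz]
  subst ht0
  -- The point `z` is only known to be in the closure, but it is the start of a lift inside `M`, so
  -- its plaque meets `M`.
  have hsub := hM.plaque_subset j V hV z hVz.symm hzs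
    ⟨γ Ray.half, ⟨γ, ⟨ht, i, hi⟩, _, rfl⟩, hγ.2 ⟨_, Ray.half_ne, rfl⟩⟩
  obtain ⟨a, ha, b, hb, hab⟩ := V.exists_ne_xraysAt hstab hVz.symm
  obtain ⟨p, hp⟩ := ha.2
  obtain ⟨q, hq⟩ := hb.2
  have hpq := V.type_ne_of_not_isPreSingularity hpre ha hb hab hp hq
  have hc : ζ.down le_rfl (ζ.proj j z) = V.center := by rw [ζ.down_self, hVz]
  have hne : (fun t => ζ.proj j (a t)) ≠ fun t => ζ.proj j (b t) := by
    intro he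
    have h1 := congrFun he Ray.half
    change ζ.proj j (a _) = ζ.proj j (b _) at h1
    rw [hp.2, hq.2] at h1
    exact hpq ((V.ray_inj _ _ _ _ h1).2.resolve_left Ray.half_ne)
  -- Only two prongs leave a point that is not a natural vertex, so the plaque of `z` projects onto
  -- the whole star.
  have hpair : {(fun t => ζ.proj j (a t)), fun t => ζ.proj j (b t)} =
      V.raysAt le_rfl (ζ.proj j z) := by
    refine eq_of_subset_of_ncard_le ?_ ?_ (V.finite_raysAt le_rfl _)
    · rintro _ (rfl | rfl)
      · exact V.proj_xray le_rfl ha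
      · exact V.proj_xray le_rfl hb
    · rw [ncard_pair hne, V.ncard_raysAt_of_notMem hc hn]
  have hzV : V.carrier ∈ 𝓝 (ζ.proj j z) := V.isOpen_carrier.mem_nhds (hVz ▸ V.center_mem)
  refine Filter.mem_of_superset hzV ?_
  rintro _ ⟨k, s, rfl⟩
  have hk : V.ray k ∈ V.raysAt le_rfl (ζ.proj j z) :=
    ⟨(V.ray_zero k).trans hVz, k, V.continuous_ray k, fun t => ζ.down_self _ _⟩
  rw [← hpair] at hk
  rcases hk with hk | hk
  · exact ⟨a s, subset_closure (hsub ⟨a, ha, s, rfl⟩), (congrFun hk s).symm⟩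
  · exact ⟨b s, subset_closure (hsub ⟨b, hb, s, rfl⟩), (congrFun hk s).symm⟩

/-- Some projection is injective on the closure of a leafwise set. -/
theorem exists_injOn_closure (hM : IsLeafwise ζ M) (hproper : ζ.IsProper) (hstab : ζ.IsStabilized) :
    ∃ J, InjOn (ζ.proj J) (closure M) := by
  have hex : ∀ x : ζ.Level 0, ∃ V : GraphTower.StdStar ζ.toGraphTower 0, V.center = x ∧ V.Fine :=
    fun x => by
      obtain ⟨V, h1, h2, -⟩ := GraphTower.StdStar.exists_fine hproper x Filter.univ_mem
      exact ⟨V, h1, h2⟩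
  choose V hVx hV using hex
  obtain ⟨F, hF⟩ := isCompact_univ.elim_finite_subcover (fun x => (V x).carrier)
    (fun x => (V x).isOpen_carrier) fun x _ => mem_iUnion.2 ⟨x, by
      have := (V x).center_mem
      rwa [hVx] at this⟩
  -- The level `J` separates the starts and the midpoints of the finitely many lifts in `M` over a
  -- finite cover by fine stars. Midpoints distinguish lifts, and starts distinguish their initial
  -- points.
  have hfin : (⋃ x ∈ F, ((fun γ => γ Ray.half) '' liftsIn (V x) M ∪
      (fun γ => γ Ray.zero) '' liftsIn (V x) M)).Finite :=
    F.finite_toSet.biUnion fun x _ => ((hM.finite_liftsIn (hV x)).image _).union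
      ((hM.finite_liftsIn (hV x)).image _)
  obtain ⟨J, hJ⟩ := ζ.exists_injOn_proj hfin
  have hJ := hJ J le_rfl
  refine ⟨J, fun z hz w hw hzw => ?_⟩
  have h0 : ζ.proj 0 z = ζ.proj 0 w := ζ.proj_eq_of_le (Nat.zero_le J) hzw
  obtain ⟨x, hxF, hzx⟩ := mem_iUnion₂.1 (hF (mem_univ (ζ.proj 0 z)))
  obtain ⟨γ, hγ, t, rfl⟩ := hM.exists_mem_range hproper hstab (hV x) hz hzx
  obtain ⟨δ, hδ, s, rfl⟩ := hM.exists_mem_range hproper hstab (hV x) hw (h0 ▸ hzx)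
  obtain ⟨i, hi⟩ := hγ.1
  obtain ⟨k, hk⟩ := hδ.1
  have hA : ∀ α ∈ liftsIn (V x) M, α Ray.half ∈ (⋃ x ∈ F, ((fun γ => γ Ray.half) '' liftsIn (V x) M ∪
      (fun γ => γ Ray.zero) '' liftsIn (V x) M)) ∧ α Ray.zero ∈
      (⋃ x ∈ F, ((fun γ => γ Ray.half) '' liftsIn (V x) M ∪
      (fun γ => γ Ray.zero) '' liftsIn (V x) M)) := fun α hα =>
    ⟨mem_biUnion hxF (Or.inl ⟨α, hα, rfl⟩), mem_biUnion hxF (Or.inr ⟨α, hα, rfl⟩)⟩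
  obtain ⟨hst, hik⟩ := (V x).lift_inj ((V x).proj_xlift (Nat.zero_le J) hi)
    ((V x).proj_xlift (Nat.zero_le J) hk) hzw
  subst hst
  by_cases ht : t = Ray.zero
  · subst ht
    exact hJ (hA γ hγ).2 (hA δ hδ).2 hzw
  · obtain ⟨rfl, he⟩ := hik.resolve_left ht
    have h1 := hJ (hA γ hγ).1 (hA δ hδ).1 (congrFun he Ray.half)
    rw [(V x).xlift_unique hi hk Ray.half_ne h1]

/-- Within the open edge the image of the closure of `M` is open and closed, hence everything;
compactness adds the end points. -/
theorem closedEdge_subset (hM : IsLeafwise ζ M) (hproper : ζ.IsProper) (hstab : ζ.IsStabilized)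
    {e : (ζ.graph j).E} {z : ζ.Solenoid} (hz : z ∈ closure M) (he : ζ.proj j z ∈ (ζ.graph j).openEdge e) :
    (ζ.graph j).closedEdge e ⊆ ζ.proj j '' closure M := by
  have hcl : IsClosed (ζ.proj j '' closure M) :=
    (isClosed_closure.isCompact.image (ζ.continuous_proj j)).isClosed
  refine (closedEdge_subset_closure e).trans (closure_minimal ?_ hcl)
  refine Subset.trans ?_ interior_subset
  have hint : ∀ x ∈ (ζ.graph j).openEdge e, x ∈ ζ.proj j '' closure M →
      x ∈ interior (ζ.proj j '' closure M) := by
    rintro _ hx ⟨w, hw, rfl⟩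
    exact mem_interior_iff_mem_nhds.2 (hM.image_closure_mem_nhds hproper hstab hw
      (notMem_naturalVertices_of_mem_openEdge hx))
  refine (isPreconnected_openEdge e).subset_left_of_subset_union isOpen_interior hcl.isOpen_compl
    ?_ ?_ ⟨_, he, hint _ he ⟨z, hz, rfl⟩⟩
  · exact disjoint_left.2 fun x hx hx' => hx' (interior_subset hx)
  · intro x hx
    by_cases h : x ∈ ζ.proj j '' closure M
    · exact Or.inl (hint x hx h)
    · exact Or.inr h

/-- Expanding split sequences do not have leafwise sets. -/
theorem not_isExpanding (hM : IsLeafwise ζ M) (hproper : ζ.IsProper) (hstab : ζ.IsStabilized)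
    (hne : M.Nonempty) : ¬ ζ.IsExpanding := by
  intro hexp
  -- Off the optimal fibers the projections of `z` to all levels are inside edges.
  obtain ⟨z, hzM, hz⟩ : ∃ z ∈ M, ζ.proj 0 z ∉ ζ.opt := by
    obtain ⟨z, hz⟩ := hne
    obtain ⟨V, hVz, hV, -⟩ := GraphTower.StdStar.exists_fine hproper (ζ.proj 0 z) Filter.univ_mem
    obtain ⟨γ, hγ⟩ := V.exists_mem_xraysAt hstab hVz.symm
    obtain ⟨i, hi⟩ := hγ.2
    refine ⟨γ Ray.half, hM.plaque_subset 0 V hV z hVz.symm (hM.notMem_sing z hz)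
      ⟨z, V.mem_plaque_self hstab hVz.symm, hz⟩ ⟨γ, hγ, _, rfl⟩, ?_⟩
    have := hV i Ray.half Ray.half_ne
    rwa [← hi.2, ζ.down_proj] at this
  obtain ⟨J, hJ⟩ := hM.exists_injOn_closure hproper hstab
  obtain ⟨e, he⟩ := exists_mem_openEdge (notMem_naturalVertices_of_notMem_opt hz J)
  obtain ⟨k, hk, h⟩ := hexp J e
  obtain ⟨e', he'⟩ := exists_mem_openEdge (notMem_naturalVertices_of_notMem_opt hz k)
  refine h e' ⟨ζ.proj J z, ⟨_, he', ζ.down_proj hk.le z⟩, he⟩ ?_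
  -- The edge `e'` lies in the projection of the closure of `M`, so points of `e'` with the same
  -- image at level `J` come from points of the closure with the same projection there, which
  -- coincide.
  have hsub := hM.closedEdge_subset hproper hstab (subset_closure hzM) he'
  have := isCompact_iff_compactSpace.1 (isCompact_closedEdge e')
  refine (Continuous.isClosedEmbedding (f := ((ζ.graph k).closedEdge e').domRestrict (ζ.down hk.le))
    ((ζ.continuous_down hk.le).comp continuous_subtype_val) ?_).isEmbedding
  rintro ⟨x, hx⟩ ⟨y, hy⟩ hxy
  obtain ⟨a, ha, rfl⟩ := hsub hx
  obtain ⟨b, hb, rfl⟩ := hsub hy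
  have h1 : ζ.down hk.le (ζ.proj k a) = ζ.down hk.le (ζ.proj k b) := hxy
  rw [ζ.down_proj, ζ.down_proj] at h1
  exact Subtype.ext (congrArg (ζ.proj k) (hJ ha hb h1))

end IsLeafwise
end SplitSequence

open MetricGraph

/-! ### Optimal star neighborhoods -/

namespace GraphTower

variable {ζ : GraphTower}

/-- Each arm extends to the next optimal point; one exists since the far end is a natural vertex.
Midpoints of loops are optimal, which yields the bound by half the length of a loop. -/
theorem exists_optRadius (hproper : ζ.IsProper) (q : ζ.Level 0) :
    ∃ r : (ζ.graph 0).E × Bool → ℝ, IsArmRadius q r ∧ ∀ d ∈ arms q,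
      (∀ s ∈ Ioo 0 (r d), (ζ.graph 0).along d (armPos q d + s) ∉ ζ.opt) ∧
      (ζ.graph 0).along d (armPos q d + r d) ∈ ζ.opt := by
  have hvert : ∀ x ∈ (ζ.graph 0).naturalVertices, x ∈ ζ.opt := fun x hx =>
    Or.inl (ζ.isSpecial_of_mem hx)
  have hex : ∀ d ∈ arms q, ∃ u ∈ Ioc (armPos q d) ((ζ.graph 0).len d.1),
      (ζ.graph 0).along d u ∈ ζ.opt ∧ ∀ v ∈ Ioc (armPos q d) ((ζ.graph 0).len d.1),
        (ζ.graph 0).along d v ∈ ζ.opt → u ≤ v := by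
    intro d hd
    have hfin : {u ∈ Ioc (armPos q d) ((ζ.graph 0).len d.1) | (ζ.graph 0).along d u ∈ ζ.opt}.Finite := by
      have h1 : {u ∈ Ioo 0 ((ζ.graph 0).len d.1) | (ζ.graph 0).along d u ∈ ζ.opt}.Finite := by
        refine Finite.of_finite_image (f := (ζ.graph 0).along d) (hproper.finite_opt.subset ?_)
          fun u hu v _ h => along_injOn hu.1 h
        rintro _ ⟨u, hu, rfl⟩
        exact hu.2
      refine (h1.insert ((ζ.graph 0).len d.1)).subset ?_
      rintro u ⟨hu, hu'⟩
      rcases hu.2.eq_or_lt with h | h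
      · exact Or.inl h
      · exact Or.inr ⟨⟨(armPos_nonneg hd).trans_lt hu.1, h⟩, hu'⟩
    obtain ⟨u, hu, hmin⟩ := exists_min_image _ id hfin
      ⟨(ζ.graph 0).len d.1, ⟨armPos_lt hd, le_rfl⟩,
        hvert _ (along_mem_naturalVertices.2 fun h => lt_irrefl _ h.2)⟩
    exact ⟨u, hu.1, hu.2, fun v hv hv' => hmin v ⟨hv, hv'⟩⟩
  choose! u hu hopt hmin using hex
  refine ⟨fun d => u d - armPos q d, ⟨fun d hd => sub_pos.2 (hu d hd).1, fun d hd => ?_,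
    fun d hd hq hl => ?_⟩, fun d hd => ⟨fun s hs h => ?_, ?_⟩⟩
  · rw [add_sub_cancel]; exact (hu d hd).2
  · have hlen := (ζ.graph 0).len_pos d.1
    have h0 : armPos q d = 0 := by
      rcases q with v | _
      · rfl
      · obtain ⟨v, hv⟩ := hq; cases hv
    rw [h0, sub_zero]
    refine hmin d hd _ ⟨by rw [h0]; linarith, by linarith⟩ (Or.inr ⟨d.1, hl, ?_⟩)
    rcases d with ⟨e, _ | _⟩
    · change (ζ.graph 0).path e ((ζ.graph 0).len e - (ζ.graph 0).len e / 2) = _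
      rw [sub_half]
    · simp [along]
  · have := hmin d hd _ ⟨by linarith [hs.1], by linarith [hs.2, (hu d hd).2]⟩ h
    linarith [hs.2]
  · rw [add_sub_cancel]; exact hopt d hd

namespace StdStar

/-- Star neighborhoods in the top graph whose open prongs are components of the complement of the
set of optimal points. -/
structure IsSaturated (V : ζ.StdStar 0) : Prop where
  center_mem_opt : V.center ∈ ζ.opt
  notMem_opt : ∀ i t, t ≠ Ray.zero → V.ray i t ∉ ζ.opt
  subset_prong : ∀ Q, IsPreconnected Q → Disjoint Q ζ.opt → ∀ i, (Q ∩ V.prong i).Nonempty →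
    Q ⊆ V.prong i

/-- The boundary of each prong consists of optimal points, so a connected set avoiding these cannot
leave the prong. -/
theorem exists_isSaturated (hproper : ζ.IsProper) {q : ζ.Level 0} (hq : q ∈ ζ.opt) :
    ∃ V : ζ.StdStar 0, V.center = q ∧ V.IsSaturated := by
  obtain ⟨r, hr, hropt⟩ := exists_optRadius hproper q
  have hmul : ∀ d ∈ arms q, ∀ t : Ray, t ≠ Ray.zero → (t : ℝ) * r d ∈ Ioo 0 (r d) := fun d hd t ht =>
    ⟨mul_pos (Ray.ne_zero_iff.1 ht) (hr.pos d hd), mul_lt_of_lt_one_left (hr.pos d hd) t.2.2⟩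
  obtain ⟨V, hVq, hray⟩ : ∃ V : ζ.StdStar 0, V.center = q ∧ ∀ i, ∃ d ∈ arms q, ∀ t : Ray,
      V.ray i t = (ζ.graph 0).along d (armPos q d + t * r d) :=
    ⟨armStar q r hr fun d hd s hs h => (hropt d hd).1 s hs (Or.inl h), rfl, armStar_ray⟩
  refine ⟨V, hVq, hVq ▸ hq, ?_, ?_⟩
  · intro i t ht
    obtain ⟨d, hd, he⟩ := hray i
    rw [he]
    exact (hropt d hd).1 _ (hmul d hd t ht)
  · intro Q hQ hdis i hne
    obtain ⟨d, hd, he⟩ := hray i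
    have hsub : closure (V.prong i) ⊆ V.prong i ∪ ζ.opt ∪ {q} := by
      have hcl : IsClosed ((ζ.graph 0).along d '' Icc (armPos q d) (armPos q d + r d)) :=
        (isCompact_Icc.image (continuous_along d)).isClosed
      have h1 : V.prong i ⊆ (ζ.graph 0).along d '' Icc (armPos q d) (armPos q d + r d) := by
        rintro _ ⟨t, ht, rfl⟩
        rw [he]
        exact ⟨_, ⟨by linarith [(hmul d hd t ht).1], by linarith [(hmul d hd t ht).2]⟩, rfl⟩
      refine (closure_minimal h1 hcl).trans ?_
      rintro _ ⟨u, hu, rfl⟩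
      rcases hu.1.eq_or_lt with h | h
      · right; rw [← h]; exact along_armPos hd
      rcases hu.2.eq_or_lt with h' | h'
      · left; right; rw [h']; exact (hropt d hd).2
      · left; left
        have hp := hr.pos d hd
        refine ⟨⟨(u - armPos q d) / r d, div_nonneg (by linarith) hp.le, by
          rw [div_lt_one hp]; linarith⟩, Ray.ne_zero_iff.2 (div_pos (by linarith) hp), ?_⟩
        rw [he]
        change (ζ.graph 0).along _ (armPos q d + (u - armPos q d) / r d * r d) = _
        rw [div_mul_cancel₀ _ hp.ne']; congr 1; ring
    refine hQ.subset_left_of_subset_union (V.isOpen_prong i) isClosed_closure.isOpen_compl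
      (disjoint_left.2 fun x hx hx' => hx' (subset_closure hx)) ?_ hne
    intro x hx
    by_cases h : x ∈ closure (V.prong i)
    · rcases hsub h with (h | h) | h
      · exact Or.inl h
      · exact absurd h (disjoint_left.1 hdis hx)
      · exact absurd (show x ∈ ζ.opt by rw [show x = q from h]; exact hq) (disjoint_left.1 hdis hx)
    · exact Or.inr h

namespace IsSaturated

variable {V W : ζ.StdStar 0}

/-- Just after its start the path is in the open star, hence on a prong, which it can only leave
through an optimal point. -/
theorem mem_carrier_of_path (hV : V.IsSaturated) {g : Ray → ζ.Level 0} (hg : Continuous g)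
    (h0 : g Ray.zero = V.center) (hopt : ∀ t, t ≠ Ray.zero → g t ∉ ζ.opt) (t : Ray) :
    g t ∈ V.carrier := by
  by_cases ht : t = Ray.zero
  · rw [ht, h0]; exact V.center_mem
  obtain ⟨s, hs, hs0⟩ : ∃ s, g s ∈ V.carrier ∧ s ≠ Ray.zero := by
    have h1 : ∀ᶠ s in 𝓝 Ray.zero, g s ∈ V.carrier := hg.continuousAt.eventually_mem
      (V.isOpen_carrier.mem_nhds (h0 ▸ V.center_mem))
    obtain ⟨ε, hε, hb⟩ := Metric.eventually_nhds_iff.1 h1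
    have hm : 0 < min (ε / 2) (1 / 2) := lt_min (by positivity) (by norm_num)
    refine ⟨⟨min (ε / 2) (1 / 2), hm.le, (min_le_right _ _).trans_lt (by norm_num)⟩, hb ?_,
      Ray.ne_zero_iff.2 hm⟩
    rw [Subtype.dist_eq, Real.dist_eq]
    change |min (ε / 2) (1 / 2) - 0| < ε
    rw [sub_zero, abs_of_pos hm]
    exact (min_le_left _ _).trans_lt (by linarith)
  obtain ⟨i, u, hu⟩ := hs
  have hu0 : u ≠ Ray.zero := by
    rintro rfl
    rw [V.ray_zero] at hu
    exact hopt s hs0 (hu ▸ hV.center_mem_opt)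
  refine V.prong_subset i (hV.subset_prong _ (Ray.isPreconnected_pos.image g hg.continuousOn) ?_ i
    ⟨_, ⟨s, hs0, rfl⟩, u, hu0, hu⟩ ⟨t, ht, rfl⟩)
  rw [disjoint_left]
  rintro _ ⟨v, hv, rfl⟩
  exact hopt v hv

theorem carrier_subset (hV : V.IsSaturated) (hc : W.center = V.center)
    (hW : ∀ x ∈ W.carrier, x ≠ W.center → x ∉ ζ.opt) : W.carrier ⊆ V.carrier := by
  rintro _ ⟨i, t, rfl⟩
  exact hV.mem_carrier_of_path (W.continuous_ray i) ((W.ray_zero i).trans hc)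
    (fun s hs => hW _ (W.ray_mem i s) fun h => hs (W.ray_eq_center.1 h)) t

theorem isPreOptimalStarNhd (hV : V.IsSaturated) : ζ.IsPreOptimalStarNhd 0 V.center V.carrier := by
  refine ⟨V.isStandardStarNhd, hV.center_mem_opt, ?_⟩
  rintro _ ⟨i, t, rfl⟩ hne
  exact hV.notMem_opt i t fun h => hne (V.ray_eq_center.2 h)

theorem subset_of_isPreOptimalStarNhd (hV : V.IsSaturated) {U : Set (ζ.Level 0)}
    (hU : ζ.IsPreOptimalStarNhd 0 V.center U) : U ⊆ V.carrier := by
  obtain ⟨W, hWc, rfl⟩ := hU.1.exists_stdStar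
  exact hV.carrier_subset hWc fun x hx hne => hU.2.2 x hx (hWc ▸ hne)

theorem isOptimalStarNhd (hV : V.IsSaturated) : ζ.IsOptimalStarNhd 0 V.center V.carrier :=
  ⟨hV.isPreOptimalStarNhd, fun _ hU hsub =>
    (hV.subset_of_isPreOptimalStarNhd hU).antisymm hsub⟩

/-- A saturated star contains every pre-optimal one with the same center, so maximality leaves no
other choice. Optimal leaf segments can thus be studied through saturated stars. -/
theorem eq_of_isOptimalStarNhd (hV : V.IsSaturated) {U : Set (ζ.Level 0)}
    (hU : ζ.IsOptimalStarNhd 0 V.center U) : U = V.carrier :=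
  (hU.2 _ hV.isPreOptimalStarNhd (hV.subset_of_isPreOptimalStarNhd hU.1)).symm

end IsSaturated

end StdStar
end GraphTower

/-! ### Concatenations -/

namespace SplitSequence

variable {n : ℕ} {ζ : SplitSequence n} {V : GraphTower.StdStar ζ.toGraphTower 0} {y z : ζ.Solenoid}

theorem isOptimalLeafSegment_plaque (hproper : ζ.IsProper) (hstab : ζ.IsStabilized)
    (hV : V.IsSaturated) (hy : ζ.proj 0 y = V.center) (hs : y ∉ ζ.sing) :
    ζ.IsOptimalLeafSegment (V.plaque y) :=
  ⟨⟨_, _, hV.isOptimalStarNhd, y, by rw [mem_preimage, hy]; exact V.center_mem,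
    (V.pathComponentIn_eq_plaque hstab hy).symm⟩,
    fun h => hs ((V.isSingularPlaque_iff hproper hstab hy).1 h)⟩

theorem _root_.GraphTower.IsOptimalLeafSegment.exists_plaque (hproper : ζ.IsProper)
    (hstab : ζ.IsStabilized) {W : Set ζ.Solenoid} (hW : ζ.IsOptimalLeafSegment W) :
    ∃ (V : GraphTower.StdStar ζ.toGraphTower 0) (y : ζ.Solenoid), V.IsSaturated ∧
      ζ.proj 0 y = V.center ∧ y ∉ ζ.sing ∧ W = V.plaque y := by
  obtain ⟨⟨p, U, hU, hP⟩, hns⟩ := hW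
  obtain ⟨V, rfl, hV⟩ := GraphTower.StdStar.exists_isSaturated hproper hU.1.2.1
  rw [hV.eq_of_isOptimalStarNhd hU] at hP
  obtain ⟨y, hy, rfl⟩ := hP.exists_plaque V hstab
  exact ⟨V, y, hV, hy, fun h => hns ((V.isSingularPlaque_iff hproper hstab hy).2 h), rfl⟩

theorem isPreconnected_plaque (hstab : ζ.IsStabilized) {j : ℕ}
    {V : GraphTower.StdStar ζ.toGraphTower j} (hy : ζ.proj j y = V.center) :
    IsPreconnected (V.plaque y) := by
  rw [← V.pathComponentIn_eq_plaque hstab hy]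
  exact (isPathConnected_pathComponentIn (by
    rw [mem_preimage, hy]; exact V.center_mem)).isConnected.isPreconnected

/-- Connected sets off the fibers of optimal points lie in one optimal plaque. -/
theorem subset_plaque_of_notMem_opt (hstab : ζ.IsStabilized) (hV : V.IsSaturated)
    (hy : ζ.proj 0 y = V.center) {Q : Set ζ.Solenoid} (hQ : IsPreconnected Q)
    (hopt : ∀ w ∈ Q, ζ.proj 0 w ∉ ζ.opt) (hz : z ∈ Q) (hzV : z ∈ V.plaque y) : Q ⊆ V.plaque y := by
  obtain ⟨γ, hγ, t, rfl⟩ := hzV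
  obtain ⟨i, hi⟩ := hγ.2
  have ht : t ≠ Ray.zero := by
    rintro rfl
    refine hopt _ hz ?_
    rw [hi.2, V.ray_zero]; exact hV.center_mem_opt
  have hsub : ζ.proj 0 '' Q ⊆ V.prong i := hV.subset_prong _
    (hQ.image _ (ζ.continuous_proj 0).continuousOn) (by
      rw [disjoint_left]; rintro _ ⟨w, hw, rfl⟩; exact hopt w hw) i
    ⟨_, ⟨_, hz, rfl⟩, t, ht, (hi.2 t).symm⟩
  refine subset_union_left.trans (V.subset_plaque hstab hy
    (hQ.union (γ t) hz (show γ t ∈ V.plaque y from ⟨γ, hγ, t, rfl⟩) (isPreconnected_plaque hstab hy)) ?_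
    (Or.inr (V.mem_plaque_self hstab hy)))
  rintro w (hw | ⟨δ, hδ, s, rfl⟩)
  · exact V.prong_subset i (hsub ⟨w, hw, rfl⟩)
  · obtain ⟨k, hk⟩ := hδ.2
    exact V.xlift_proj_mem hk s

/-- Two optimal leaf segments overlap in a leaf segment. -/
def Overlap (ζ : SplitSequence n) (A B : Set ζ.Solenoid) : Prop :=
  ζ.IsOptimalLeafSegment A ∧ ζ.IsOptimalLeafSegment B ∧ ∃ N, ζ.IsLeafSegment N ∧ N ⊆ A ∩ B

theorem exists_isConcatenation {A B : Set ζ.Solenoid} (hA : ζ.IsOptimalLeafSegment A)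
    (h : Relation.ReflTransGen (Overlap ζ) A B) : ∃ S, ζ.IsConcatenation S ∧ A ⊆ S ∧ B ⊆ S := by
  have key : ∃ (m : ℕ) (U : ℕ → Set ζ.Solenoid), U 0 = A ∧ U m = B ∧
      (∀ i, i ≤ m → ζ.IsOptimalLeafSegment (U i)) ∧
      ∀ i, i < m → ∃ N, ζ.IsLeafSegment N ∧ N ⊆ U i ∩ U (i + 1) := by
    induction h with
    | refl => exact ⟨0, fun _ => A, rfl, rfl, fun _ _ => hA, fun i hi => absurd hi (Nat.not_lt_zero i)⟩
    | @tail B C _ hBC ih =>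
      obtain ⟨m, U, h0, hm, h1, h2⟩ := ih
      have hU : ∀ i, i ≤ m → Function.update U (m + 1) C i = U i := fun i hi =>
        Function.update_of_ne (by omega) _ _
      refine ⟨m + 1, Function.update U (m + 1) C, ?_, Function.update_self _ _ _, ?_, ?_⟩
      · rw [hU 0 (Nat.zero_le _), h0]
      · intro i hi
        rcases Nat.lt_or_ge m i with h | h
        · obtain rfl : i = m + 1 := by omega
          rw [Function.update_self]; exact hBC.2.1
        · rw [hU i h]; exact h1 i h
      · intro i hi
        rcases Nat.lt_or_ge i m with h | h
        · rw [hU i h.le, hU (i + 1) h]; exact h2 i h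
        · obtain rfl : i = m := by omega
          rw [hU i le_rfl, Function.update_self, hm]; exact hBC.2.2
  obtain ⟨m, U, rfl, rfl, h1, h2⟩ := key
  refine ⟨_, ⟨m, fun i => U i, fun i => h1 i (Nat.lt_succ_iff.1 i.2), fun i => h2 i i.2, rfl⟩, ?_, ?_⟩
  · exact subset_iUnion (fun i : Fin (m + 1) => U i) 0
  · exact subset_iUnion_of_subset (Fin.last m) subset_rfl

theorem reflTransGen_overlap {m : ℕ} {W : Fin (m + 1) → Set ζ.Solenoid}
    (hW : ∀ i, ζ.IsOptimalLeafSegment (W i))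
    (h : ∀ i : Fin m, ∃ N, ζ.IsLeafSegment N ∧ N ⊆ W i.castSucc ∩ W i.succ) (a b : Fin (m + 1)) :
    Relation.ReflTransGen (Overlap ζ) (W a) (W b) := by
  have h0 : ∀ i, Relation.ReflTransGen (Overlap ζ) (W 0) (W i) ∧
      Relation.ReflTransGen (Overlap ζ) (W i) (W 0) := by
    intro i
    induction i using Fin.induction with
    | zero => exact ⟨.refl, .refl⟩
    | succ i ih =>
      obtain ⟨N, hN, hsub⟩ := h i
      exact ⟨ih.1.tail ⟨hW _, hW _, N, hN, hsub⟩,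
        ih.2.head ⟨hW _, hW _, N, hN, by rwa [inter_comm]⟩⟩
  exact (h0 a).2.trans (h0 b).1

/-- Plaques of fine neighborhoods extend concatenations that they meet. -/
theorem leafEquivalent_of_mem_plaque (hproper : ζ.IsProper) (hstab : ζ.IsStabilized) {j : ℕ}
    {V : GraphTower.StdStar ζ.toGraphTower j} (hV : V.Fine) (hy : ζ.proj j y = V.center)
    (hs : y ∉ ζ.sing) {x w : ζ.Solenoid} (hxz : ζ.LeafEquivalent x z) (hz : z ∈ V.plaque y)
    (hw : w ∈ V.plaque y) : ζ.LeafEquivalent x w := by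
  obtain ⟨_, ⟨m, W, hW, hov, rfl⟩, hx, hzW⟩ := hxz
  obtain ⟨a, hxa⟩ := mem_iUnion.1 hx
  obtain ⟨b, hzb⟩ := mem_iUnion.1 hzW
  -- It suffices to chain the segment through `z` to one optimal leaf segment that contains the
  -- whole plaque.
  suffices h : ∃ B, Relation.ReflTransGen (Overlap ζ) (W b) B ∧ V.plaque y ⊆ B by
    obtain ⟨B, hB, hsub⟩ := h
    obtain ⟨S, hS, h1, h2⟩ := exists_isConcatenation (hW a) ((reflTransGen_overlap hW hov a b).trans hB)
    exact ⟨S, hS, h1 hxa, h2 (hsub hw)⟩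
  obtain ⟨U, u, hU, hu, hus, hWb⟩ := (hW b).exists_plaque hproper hstab
  have hdown : ∀ γ ∈ V.xraysAt y, ∀ t, t ≠ Ray.zero → ζ.proj 0 (γ t) ∉ ζ.opt := by
    intro γ hγ t ht
    obtain ⟨i, hi⟩ := hγ.2
    rw [← ζ.down_proj (Nat.zero_le j), hi.2]
    exact hV i t ht
  by_cases hq : ζ.proj 0 y ∈ ζ.opt
  · obtain ⟨U', hU'c, hU'⟩ := GraphTower.StdStar.exists_isSaturated hproper hq
    -- When `y` is over an optimal point, the optimal plaque centered at `y` contains the given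
    -- plaque and serves as `B`.
    have hsub : V.plaque y ⊆ U'.plaque y := by
      refine U'.subset_plaque hstab hU'c.symm (isPreconnected_plaque hstab hy) ?_
        (V.mem_plaque_self hstab hy)
      rintro _ ⟨γ, hγ, t, rfl⟩
      obtain ⟨i, hi⟩ := hγ.2
      exact hU'.mem_carrier_of_path ((ζ.continuous_proj 0).comp hi.1)
        ((congrArg (ζ.proj 0) hγ.1).trans hU'c.symm) (hdown γ hγ) t
    have hopt' := isOptimalLeafSegment_plaque hproper hstab hU' hU'c.symm hs
    refine ⟨_, .single ⟨hW b, hopt', ?_⟩, hsub⟩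
    obtain ⟨γ, hγ, t, rfl⟩ := hsub hz
    obtain ⟨i, hi⟩ := hγ.2
    by_cases ht : t = Ray.zero
    -- If `z` is the center `y`, the segment through `z` must also be centered at `y`, and it
    -- contains the optimal plaque there, which can serve as the overlap.
    · subst ht
      rw [hγ.1, hWb] at hzb
      refine ⟨U'.plaque y, U'.isLeafSegment_plaque hproper hstab hU'c.symm hs,
        subset_inter ?_ subset_rfl⟩
      rw [hWb]
      obtain ⟨δ, hδ, s, hsy⟩ := hzb
      obtain ⟨k, hk⟩ := hδ.2
      have hs0 : s = Ray.zero := by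
        by_contra hs0
        refine hU.notMem_opt k s hs0 ?_
        rw [← hk.2, hsy]; exact hq
      subst hs0
      have huy : u = y := hδ.1.symm.trans hsy
      subst huy
      refine U.subset_plaque hstab hu (isPreconnected_plaque hstab hU'c.symm) ?_
        (U'.mem_plaque_self hstab hU'c.symm)
      rintro _ ⟨γ', hγ', t, rfl⟩
      obtain ⟨i', hi'⟩ := hγ'.2
      refine hU.mem_carrier_of_path ((ζ.continuous_proj 0).comp hi'.1)
        ((congrArg (ζ.proj 0) hγ'.1).trans hu) (fun s hs => ?_) t
      change ζ.proj 0 (γ' s) ∉ _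
      rw [hi'.2]; exact hU'.notMem_opt i' s hs
    -- Otherwise the open lift through `z` is a leaf segment avoiding the optimal fibers, and so
    -- lies in both optimal plaques.
    · have hN := U'.plaque_onProng hstab hi ht
      refine ⟨_, (U'.onProng i t ht).isLeafSegment_plaque hproper hstab (hi.2 t)
        (U'.xlift_notMem_sing hproper hstab hi ht), ?_⟩
      rw [hN, hWb]
      refine subset_inter ?_ ?_
      · refine subset_plaque_of_notMem_opt hstab hU hu
          (Ray.isPreconnected_pos.image _ hi.1.continuousOn) ?_ ⟨t, ht, rfl⟩ (hWb ▸ hzb)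
        rintro _ ⟨s, hs, rfl⟩
        rw [hi.2]; exact hU'.notMem_opt i s hs
      · rintro _ ⟨s, -, rfl⟩
        exact ⟨γ, hγ, s, rfl⟩
  -- When `y` is not over an optimal point, the plaque avoids all optimal fibers and already lies in
  -- the segment through `z`.
  · refine ⟨_, .refl, ?_⟩
    rw [hWb]
    refine subset_plaque_of_notMem_opt hstab hU hu (isPreconnected_plaque hstab hy) ?_ hz (hWb ▸ hzb)
    rintro _ ⟨γ, hγ, t, rfl⟩
    by_cases ht : t = Ray.zero
    · rwa [ht, hγ.1]
    · exact hdown γ hγ t ht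

theorem finite_plaque_inter_fiber (hstab : ζ.IsStabilized) (x : ζ.Level 0) :
    (V.plaque y ∩ ζ.fiber 0 x).Finite := by
  refine ((V.finite_xraysAt hstab y).image fun γ => γ (V.rad x)).subset ?_
  rintro _ ⟨⟨γ, hγ, t, rfl⟩, hx⟩
  obtain ⟨i, hi⟩ := hγ.2
  refine ⟨γ, hγ, ?_⟩
  have hx : ζ.proj 0 (γ t) = x := hx
  change γ (V.rad x) = γ t
  rw [← hx, hi.2, V.rad_ray]

/-- Leaf equivalence absorbs plaques, and each of the finitely many optimal plaques meets a fiber at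
most once along each of its finitely many lifts. -/
theorem isLeafwise_of_isFinitePartialLeaf (hproper : ζ.IsProper) (hstab : ζ.IsStabilized)
    {L : Set ζ.Solenoid} (hL : ζ.IsFinitePartialLeaf L) : IsLeafwise ζ L := by
  obtain ⟨⟨x, -, hLx⟩, hconc⟩ := hL
  refine ⟨fun z hz => ?_, fun j V hV y hy hs hne w hw => ?_, fun q _ => ?_⟩
  · rw [hLx] at hz; exact hz.1
  · obtain ⟨z, hz, hzL⟩ := hne
    rw [hLx] at hzL ⊢
    exact ⟨V.notMem_sing_of_mem_plaque hproper hstab hs hw,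
      leafEquivalent_of_mem_plaque hproper hstab hV hy hs hzL.2 hz hw⟩
  · obtain ⟨m, W, hW, -, rfl⟩ := hconc
    rw [iUnion_inter]
    refine finite_iUnion fun i => ?_
    obtain ⟨V, y, -, -, -, h⟩ := (hW i).exists_plaque hproper hstab
    rw [h]
    exact finite_plaque_inter_fiber hstab q

theorem _root_.GraphTower.IsConcatenation.nonempty {L : Set ζ.Solenoid} (hL : ζ.IsConcatenation L) :
    L.Nonempty := by
  obtain ⟨m, W, hW, -, rfl⟩ := hL
  obtain ⟨⟨p, U, -, x, hx, hWx⟩, -⟩ := hW 0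
  exact ⟨x, mem_iUnion.2 ⟨0, hWx ▸ mem_pathComponentIn_self hx⟩⟩

theorem not_isFinitePartialLeaf (hproper : ζ.IsProper) (hstab : ζ.IsStabilized)
    (hexp : ζ.IsExpanding) (L : Set ζ.Solenoid) : ¬ ζ.IsFinitePartialLeaf L := fun hL =>
  (isLeafwise_of_isFinitePartialLeaf hproper hstab hL).not_isExpanding hproper hstab
    hL.2.nonempty hexp

end SplitSequence

open MetricGraph

/-! ### Turns, cross-sections and flow maps -/

namespace GraphTower.StdStar

variable {n : ℕ} {ζ : SplitSequence n} {j : ℕ} (V : GraphTower.StdStar ζ.toGraphTower j)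
  {i k : Fin V.N} {α β γ : Ray → ζ.Solenoid} {y z : ζ.Solenoid}

/-- The turn of a standard star neighborhood given by two prongs. -/
def turn (i k : Fin V.N) : Set (ζ.Level j) := range (V.ray i) ∪ range (V.ray k)

theorem isStandardTurn_turn (hik : i ≠ k) : ζ.IsStandardTurn j V.center (V.turn i k) :=
  V.isStandardTurn hik

variable {V}

theorem xraysAt_eq_of_notMem_sing (hstab : ζ.IsStabilized) (hs : y ∉ ζ.sing)
    (hα : α ∈ V.xraysAt y) (hβ : β ∈ V.xraysAt y) (hne : α ≠ β) : V.xraysAt y = {α, β} := by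
  refine (eq_of_subset_of_ncard_le ?_ ?_ (V.finite_xraysAt hstab y)).symm
  · rintro _ (rfl | rfl)
    · exact hα
    · exact hβ
  · rw [ncard_pair hne, (V.ncard_eq_two_iff hstab (V.proj_of_mem_xraysAt hα)).2 hs]

theorem ne_of_types_ne (hik : i ≠ k) (hα : α ∈ V.xlifts i) (hβ : β ∈ V.xlifts k) : α ≠ β := by
  rintro rfl
  exact hik ((V.ray_inj _ _ _ _ ((hα.2 Ray.half).symm.trans (hβ.2 Ray.half))).2.resolve_left
    Ray.half_ne)

/-- The plaque of a regular point takes the turn spanned by its prongs. -/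
theorem takes_plaque (hproper : ζ.IsProper) (hstab : ζ.IsStabilized) (hik : i ≠ k)
    (hs : y ∉ ζ.sing) (hα : α ∈ V.xlifts i) (hβ : β ∈ V.xlifts k) (hα0 : α Ray.zero = y)
    (hβ0 : β Ray.zero = y) : ζ.Takes j (V.turn i k) (V.plaque y) := by
  classical
  have hαy : α ∈ V.xraysAt y := ⟨hα0, i, hα⟩
  have hβy : β ∈ V.xraysAt y := ⟨hβ0, k, hβ⟩
  have hpair := xraysAt_eq_of_notMem_sing hstab hs hαy hβy (ne_of_types_ne hik hα hβ)
  refine ⟨V.isLeafSegment_plaque hproper hstab (V.proj_of_mem_xraysAt hαy) hs, ?_⟩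
  have hcar : ∀ x : V.turn i k, (x : ζ.Level j) ∈ V.carrier := by
    rintro ⟨_, ⟨t, rfl⟩ | ⟨t, rfl⟩⟩
    · exact V.ray_mem i t
    · exact V.ray_mem k t
  have hrad : Continuous fun x : V.turn i k => V.rad x :=
    V.continuousOn_rad.comp_continuous continuous_subtype_val hcar
  -- The inverse of the projection follows `α` on one prong and `β` on the other. The two agree at
  -- the center, and both prongs are closed in the turn.
  let g : V.turn i k → ζ.Solenoid := fun x => if (x : ζ.Level j) ∈ range (V.ray i) then
    α (V.rad x) else β (V.rad x)
  have hgi : ∀ x : V.turn i k, (x : ζ.Level j) ∈ range (V.ray i) → g x = α (V.rad x) := fun x hx =>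
    if_pos hx
  have hgk : ∀ x : V.turn i k, (x : ζ.Level j) ∈ range (V.ray k) → g x = β (V.rad x) := by
    intro x hx
    by_cases h : (x : ζ.Level j) ∈ range (V.ray i)
    · obtain ⟨s, hs⟩ := hx
      obtain ⟨t, ht⟩ := h
      obtain ⟨h1, h2⟩ := V.ray_inj _ _ _ _ (ht.trans hs.symm)
      have ht0 := h2.resolve_right hik
      rw [hgi x ⟨t, ht⟩, ← ht, V.rad_ray, ht0, hα0, hβ0]
    · exact if_neg h
  have hclosed : ∀ l, IsClosed {x : V.turn i k | (x : ζ.Level j) ∈ range (V.ray l)} := by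
    intro l
    have : ({x | (x : ζ.Level j) ∈ range (V.ray l)} : Set (V.turn i k)) =
        ({x | V.ray l (V.rad (x : ζ.Level j)) = x} : Set (V.turn i k)) := by
      ext x; constructor
      · rintro ⟨t, ht⟩
        change V.ray l (V.rad x) = x
        rw [← ht, V.rad_ray]
      · intro h; exact ⟨_, h⟩
    rw [this]
    exact isClosed_eq ((V.continuous_ray l).comp hrad) continuous_subtype_val
  have hg : Continuous g := by
    rw [← continuousOn_univ]
    have hU : (univ : Set (V.turn i k)) = ({x | (x : ζ.Level j) ∈ range (V.ray i)} ∪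
        {x | (x : ζ.Level j) ∈ range (V.ray k)} : Set (V.turn i k)) :=
      (eq_univ_of_forall fun x => x.2).symm
    rw [hU]
    exact ContinuousOn.union_of_isClosed ((hα.1.comp hrad).continuousOn.congr hgi)
      ((hβ.1.comp hrad).continuousOn.congr hgk) (hclosed i) (hclosed k)
  have hproj : ∀ x : V.turn i k, ζ.proj j (g x) = x := by
    rintro ⟨x, ⟨t, rfl⟩ | ⟨t, rfl⟩⟩
    · rw [hgi _ ⟨t, rfl⟩, hα.2, V.rad_ray]
    · rw [hgk _ ⟨t, rfl⟩, hβ.2, V.rad_ray]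
  have hmem : ∀ x, g x ∈ V.plaque y := by
    rintro ⟨x, ⟨t, rfl⟩ | ⟨t, rfl⟩⟩
    · rw [hgi _ ⟨t, rfl⟩]; exact ⟨α, hαy, _, rfl⟩
    · rw [hgk _ ⟨t, rfl⟩]; exact ⟨β, hβy, _, rfl⟩
  have hback : ∀ z ∈ V.plaque y, ∃ h : ζ.proj j z ∈ V.turn i k, g ⟨_, h⟩ = z := by
    rintro _ ⟨δ, hδ, t, rfl⟩
    rw [hpair] at hδ
    rcases hδ with rfl | rfl
    · refine ⟨Or.inl ⟨t, (hα.2 t).symm⟩, ?_⟩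
      rw [hgi _ ⟨t, (hα.2 t).symm⟩]
      change δ (V.rad (ζ.proj j (δ t))) = δ t
      rw [hα.2, V.rad_ray]
    · refine ⟨Or.inr ⟨t, (hβ.2 t).symm⟩, ?_⟩
      rw [hgk _ ⟨t, (hβ.2 t).symm⟩]
      change δ (V.rad (ζ.proj j (δ t))) = δ t
      rw [hβ.2, V.rad_ray]
  exact ⟨⟨⟨fun x => ⟨g x, hmem x⟩, fun z => ⟨ζ.proj j z, (hback z z.2).1⟩,
    fun x => Subtype.ext (hproj x), fun z => Subtype.ext (hback z z.2).2⟩,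
    hg.subtype_mk _, ((ζ.continuous_proj j).comp continuous_subtype_val).subtype_mk _⟩, hproj⟩

theorem _root_.GraphTower.IsLeafSegment.notMem_sing (hproper : ζ.IsProper) (hstab : ζ.IsStabilized)
    {L : Set ζ.Solenoid} (hL : ζ.IsLeafSegment L) (hz : z ∈ L) : z ∉ ζ.sing := by
  obtain ⟨⟨O, ⟨l, p, U, hU, rfl⟩, hP⟩, hns⟩ := hL
  obtain ⟨W, rfl, rfl⟩ := hU.exists_stdStar
  obtain ⟨w, hw, rfl⟩ := hP.exists_plaque W hstab
  exact W.notMem_sing_of_mem_plaque hproper hstab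
    (fun h => hns ((W.isSingularPlaque_iff hproper hstab hw).2 h)) hz

/-- A leaf segment taking the turn restricts to lifts over the two prongs; conversely two such lifts
at a regular point form its entire plaque. -/
theorem mem_crossSection_iff (hproper : ζ.IsProper) (hstab : ζ.IsStabilized) (hik : i ≠ k) :
    y ∈ ζ.crossSection j V.center (V.turn i k) ↔ y ∉ ζ.sing ∧
      (∃ α ∈ V.xlifts i, α Ray.zero = y) ∧ ∃ β ∈ V.xlifts k, β Ray.zero = y := by
  constructor
  · rintro ⟨hy, L, ⟨hL, l, hl⟩, hyL⟩
    have hy : ζ.proj j y = V.center := hy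
    refine ⟨hL.notMem_sing hproper hstab hyL, ?_⟩
    have key : ∀ q, (∀ t, V.ray q t ∈ V.turn i k) → ∃ α ∈ V.xlifts q, α Ray.zero = y := by
      intro q hq
      refine ⟨fun t => l ⟨V.ray q t, hq t⟩, ⟨?_, fun t => hl _⟩, ?_⟩
      · exact continuous_subtype_val.comp (l.continuous.comp ((V.continuous_ray q).subtype_mk _))
      · have h1 := hl (l.symm ⟨y, hyL⟩)
        rw [l.apply_symm_apply] at h1
        have h2 : (⟨V.ray q Ray.zero, hq _⟩ : V.turn i k) = l.symm ⟨y, hyL⟩ := by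
          refine Subtype.ext ?_
          rw [← h1]
          exact (V.ray_zero q).trans hy.symm
        change (l ⟨V.ray q Ray.zero, hq _⟩ : ζ.Solenoid) = y
        rw [h2, l.apply_symm_apply]
    exact ⟨key i fun t => Or.inl ⟨t, rfl⟩, key k fun t => Or.inr ⟨t, rfl⟩⟩
  · rintro ⟨hs, ⟨α, hα, hα0⟩, β, hβ, hβ0⟩
    have hy : ζ.proj j y = V.center := by rw [← hα0, hα.2, V.ray_zero]
    exact ⟨hy, _, takes_plaque hproper hstab hik hs hα hβ hα0 hβ0, V.mem_plaque_self hstab hy⟩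

/-- Sliding points of the fiber over a point of a prong to the fiber over the center is
continuous. -/
theorem exists_slide (i : Fin V.N) {t : Ray} (ht : t ≠ Ray.zero) :
    ∃ o : ζ.fiber j (V.ray i t) → ζ.Solenoid, Continuous o ∧
      ∀ z : ζ.fiber j (V.ray i t), ∃ γ ∈ V.xlifts i, γ t = z ∧ γ Ray.zero = o z := by
  have hex : ∀ z : ζ.fiber j (V.ray i t), ∃ γ ∈ V.xlifts i, γ t = z := fun z =>
    V.exists_xlift ht z.2
  choose γ hγ hγt using hex
  refine ⟨fun z : ζ.fiber j (V.ray i t) => γ z Ray.zero, ?_, fun z => ⟨γ z, hγ z, hγt z, rfl⟩⟩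
  have key : ∀ m, j ≤ m → Continuous fun z : ζ.fiber j (V.ray i t) => ζ.proj m (γ z Ray.zero) := by
    intro m hm
    -- Nearby points of the fiber have the same projection at level `m`, because the fibers between
    -- levels are finite; then their lifts agree at that level.
    have hloc : IsLocallyConstant fun z : ζ.fiber j (V.ray i t) => ζ.proj m (γ z Ray.zero) := by
      rw [IsLocallyConstant.iff_eventually_eq]
      intro z
      have hfin := (ζ.finite_fiber hm (V.ray i t)).subset
        (sdiff_subset (t := {ζ.proj m (z : ζ.Solenoid)}))
      have hopen : IsOpen {w : ζ.fiber j (V.ray i t) |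
          ζ.proj m (w : ζ.Solenoid) ∉ {x | ζ.down hm x = V.ray i t} \ {ζ.proj m (z : ζ.Solenoid)}} :=
        hfin.isClosed.isOpen_compl.preimage ((ζ.continuous_proj m).comp continuous_subtype_val)
      filter_upwards [hopen.mem_nhds (x := z) fun h => h.2 rfl] with w hw
      have hwz : ζ.proj m (w : ζ.Solenoid) = ζ.proj m (z : ζ.Solenoid) := by
        by_contra hne
        exact hw ⟨(ζ.down_proj hm _).trans w.2, hne⟩
      refine congrFun (V.lift_unique (V.proj_xlift hm (hγ w)) (V.proj_xlift hm (hγ z)) ht ?_) Ray.zero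
      rw [hγt, hγt, hwz]
    exact hloc.continuous
  refine ζ.continuous_rng fun m => ?_
  refine ((ζ.continuous_down (le_max_left m j)).comp (key _ (le_max_right m j))).congr fun z => ?_
  exact ζ.down_proj _ _

/-- At a point of the cross-section exactly two lifts start, over different prongs, so sliding along
prong `i` to a fixed parameter is well defined. Its inverse, sliding back to the center, is the map
whose continuity is immediate. -/
theorem exists_isFlowMap (hproper : ζ.IsProper) (hstab : ζ.IsStabilized) (hik : i ≠ k) (t : Ray) :
    ∃ Φ : ζ.crossSection j V.center (V.turn i k) → ζ.Solenoid,
      ζ.IsFlowMap j V.center (V.turn i k) Φ ∧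
        ∀ y : ζ.crossSection j V.center (V.turn i k), ∀ α ∈ V.xlifts i, α Ray.zero = y → Φ y = α t := by
  have hex : ∀ y : ζ.crossSection j V.center (V.turn i k), ∃ α ∈ V.xlifts i, α Ray.zero = y :=
    fun y => ((mem_crossSection_iff hproper hstab hik).1 y.2).2.1
  choose α hα hα0 using hex
  have huniq : ∀ y : ζ.crossSection j V.center (V.turn i k), ∀ δ ∈ V.xlifts i, δ Ray.zero = y →
      δ = α y := by
    intro y δ hδ hδ0
    obtain ⟨hs, -, β, hβ, hβ0⟩ := (mem_crossSection_iff hproper hstab hik).1 y.2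
    have hpair := xraysAt_eq_of_notMem_sing (V := V) hstab hs ⟨hα0 y, i, hα y⟩ ⟨hβ0, k, hβ⟩
      (ne_of_types_ne hik (hα y) hβ)
    have hmem : δ ∈ V.xraysAt y := ⟨hδ0, i, hδ⟩
    rw [hpair] at hmem
    exact hmem.resolve_right (ne_of_types_ne hik hδ hβ)
  refine ⟨fun y => α y t, ⟨?_, fun _ => ⟨V.ray i t, Or.inl ⟨t, rfl⟩⟩, continuous_const, fun y => ?_⟩,
    fun y δ hδ hδ0 => by rw [huniq y δ hδ hδ0]⟩
  · by_cases ht : t = Ray.zero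
    · subst ht
      have : (fun y => α y Ray.zero) = Subtype.val := funext hα0
      rw [this]
      exact IsEmbedding.subtypeVal
    obtain ⟨o, ho, hoγ⟩ := exists_slide (ζ := ζ) i ht
    have hoα : ∀ (y : ζ.crossSection j V.center (V.turn i k)) (z : ζ.fiber j (V.ray i t)),
        o z = y ↔ (z : ζ.Solenoid) = α y t := by
      intro y z
      obtain ⟨γ, hγ, hγt, hγ0⟩ := hoγ z
      constructor
      · intro h
        rw [← hγt, huniq y γ hγ (hγ0.trans h)]
      · intro h
        rw [← hγ0, V.xlift_unique hγ (hα y) ht (hγt.trans h), hα0]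
    let f : ζ.crossSection j V.center (V.turn i k) → ζ.fiber j (V.ray i t) :=
      fun y => ⟨α y t, (hα y).2 t⟩
    have hof : ∀ y, o (f y) = y := fun y => (hoα y _).2 rfl
    -- The fiber is compact, so sliding back is a closed map. Preimages under the forward slide are
    -- images under it, which yields continuity of the forward slide.
    have hcl : IsClosedMap o := by
      have : CompactSpace (ζ.fiber j (V.ray i t)) := isCompact_iff_compactSpace.1
        ((isClosed_singleton.preimage (ζ.continuous_proj j)).isCompact)
      exact ho.isClosedMap
    have hf : Continuous f := by
      rw [continuous_iff_isClosed]
      intro F hF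
      have : f ⁻¹' F = Subtype.val ⁻¹' (o '' F) := by
        ext y; constructor
        · intro h; exact ⟨f y, h, hof y⟩
        · rintro ⟨z, hz, hzy⟩
          have : z = f y := Subtype.ext ((hoα y z).1 hzy)
          rwa [this] at hz
      rw [this]
      exact (hcl F hF).preimage continuous_subtype_val
    have hemb : IsEmbedding f := IsEmbedding.of_comp hf ho (by
      have : o ∘ f = Subtype.val := funext hof
      rw [this]; exact IsEmbedding.subtypeVal)
    exact IsEmbedding.subtypeVal.comp hemb
  · obtain ⟨hs, -, β, hβ, hβ0⟩ := (mem_crossSection_iff hproper hstab hik).1 y.2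
    have hy : ζ.proj j y = V.center := y.2.1
    exact ⟨V.plaque y, takes_plaque hproper hstab hik hs (hα y) hβ (hα0 y) hβ0,
      V.mem_plaque_self hstab hy, ⟨α y, ⟨hα0 y, i, hα y⟩, t, rfl⟩, (hα y).2 t⟩

end GraphTower.StdStar

/-! ### Point masses of transverse measures -/

namespace SplitSequence

variable {n : ℕ} {ζ : SplitSequence n} {j : ℕ} {V : GraphTower.StdStar ζ.toGraphTower j}
  {i k : Fin V.N} {α β : Ray → ζ.Solenoid} {y z : ζ.Solenoid} {μ : Set ζ.Solenoid → ℝ≥0}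

open GraphTower.StdStar

theorem _root_.measurableSet_borel_singleton {Y : Type*} [TopologicalSpace Y] [T1Space Y] (y : Y) :
    @MeasurableSet Y (borel Y) {y} := by
  let _ : MeasurableSpace Y := borel Y
  have : BorelSpace Y := ⟨rfl⟩
  exact measurableSet_singleton y

/-- Both singletons are transversals of the turn, and the flow map to the parameter `t` carries one
to the other in a single flow step. -/
theorem measure_singleton_of_types_ne (hproper : ζ.IsProper) (hstab : ζ.IsStabilized)
    (hμ : ζ.IsTransverseSemiMeasure μ) (hik : i ≠ k) (hs : y ∉ ζ.sing) (hα : α ∈ V.xlifts i)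
    (hβ : β ∈ V.xlifts k) (hα0 : α Ray.zero = y) (hβ0 : β Ray.zero = y) (t : Ray) :
    μ {α t} = μ {y} := by
  have hyC : y ∈ ζ.crossSection j V.center (V.turn i k) :=
    (mem_crossSection_iff hproper hstab hik).2 ⟨hs, ⟨α, hα, hα0⟩, β, hβ, hβ0⟩
  have htr : ∀ s, ζ.IsTransversal {α s} := by
    intro s
    obtain ⟨Φ, hΦ, hΦα⟩ := exists_isFlowMap (V := V) hproper hstab hik s
    refine ⟨j, _, _, V.isStandardTurn_turn hik, Φ, hΦ, {⟨y, hyC⟩}, ?_, ?_⟩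
    · exact measurableSet_borel_singleton (Y := ζ.crossSection j V.center (V.turn i k)) _
    · rw [image_singleton, hΦα _ α hα hα0]
  obtain ⟨Φ, hΦ, hΦα⟩ := exists_isFlowMap (V := V) hproper hstab hik t
  let φ : ({y} : Set ζ.Solenoid) ≃ₜ ({α t} : Set ζ.Solenoid) := Homeomorph.homeomorphOfUnique _ _
  have hval : ∀ x, (φ x : ζ.Solenoid) = α t := fun x => (φ x).2
  have hcomp : ζ.IsFlowComposition φ := by
    refine .single φ ?_ (htr t) ⟨j, _, _, V.isStandardTurn_turn hik, Φ, hΦ, Or.inl ?_⟩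
    · have := htr Ray.zero
      rwa [hα0] at this
    · rintro ⟨x, rfl⟩
      exact ⟨hyC, (hval _).trans (hΦα _ α hα hα0).symm⟩
  have h := hμ.flow_invariant _ _ φ hcomp univ (@MeasurableSet.univ _ (borel _))
  rwa [image_univ, φ.range_coe, image_univ, image_univ, Subtype.range_coe, Subtype.range_coe] at h

/-- The mass of points is constant along leaf segments. -/
theorem measure_singleton_of_mem_plaque (hproper : ζ.IsProper) (hstab : ζ.IsStabilized)
    (hμ : ζ.IsTransverseSemiMeasure μ) (hs : y ∉ ζ.sing) (hz : z ∈ V.plaque y) : μ {z} = μ {y} := by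
  obtain ⟨α, hα, t, rfl⟩ := hz
  have hy := V.proj_of_mem_xraysAt hα
  obtain ⟨β, hβ, hne⟩ : ∃ β ∈ V.xraysAt y, α ≠ β := by
    obtain ⟨a, ha, b, hb, hab⟩ := V.exists_ne_xraysAt hstab hy
    by_cases h : α = a
    · exact ⟨b, hb, h ▸ hab⟩
    · exact ⟨a, ha, h⟩
  -- At level `j` both lifts may lie over the same prong. At a low enough level their projections
  -- are different prongs of the lifted star neighborhood, and the turn there can be used.
  obtain ⟨m₀, hm₀⟩ := V.exists_proj_ne_of_ne hα hβ hne
  have hm := hm₀ (max m₀ j) (le_max_left _ _)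
  have hjm : j ≤ max m₀ j := le_max_right _ _
  generalize max m₀ j = m at hm hjm
  have hc : ζ.down hjm (ζ.proj m y) = V.center := by rw [ζ.down_proj, hy]
  obtain ⟨p, hp⟩ := V.exists_up_ray hc (V.proj_xray hjm hα)
  obtain ⟨q, hq⟩ := V.exists_up_ray hc (V.proj_xray hjm hβ)
  have hpq : p ≠ q := by
    rintro rfl; exact hm (hp.symm.trans hq)
  obtain ⟨i, hi⟩ := hα.2
  obtain ⟨k, hk⟩ := hβ.2
  exact measure_singleton_of_types_ne (V := V.up hjm _ hc) hproper hstab hμ hpq hs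
    ⟨hi.1, fun t => (congrFun hp t).symm⟩ ⟨hk.1, fun t => (congrFun hq t).symm⟩ hα.1 hβ.1 t

/-- A transversal contains finitely many points of a given positive mass. -/
theorem finite_of_isTransversal (hμ : ζ.IsTransverseSemiMeasure μ) {F : Set ζ.Solenoid}
    (hF : ζ.IsTransversal F) {c : ℝ≥0} (hc : c ≠ 0) : {z ∈ F | μ {z} = c}.Finite := by
  obtain ⟨m, hm⟩ := hμ.measure F hF
  let _ : MeasurableSpace F := borel F
  have : BorelSpace F := ⟨rfl⟩
  have hsing : ∀ x : F, m {x} = (μ {(x : ζ.Solenoid)} : ℝ≥0∞) := by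
    intro x
    rw [hm _ (measurableSet_singleton x), image_singleton]
  have huniv := hm univ MeasurableSet.univ
  by_contra hinf
  have hinf' : {x : F | μ {(x : ζ.Solenoid)} = c}.Infinite := by
    intro hfin
    refine hinf ((hfin.image Subtype.val).subset ?_)
    rintro z ⟨hz, hzc⟩
    exact ⟨⟨z, hz⟩, hzc, rfl⟩
  obtain ⟨N, hN⟩ := exists_nat_gt (μ (Subtype.val '' (univ : Set F)) / c)
  obtain ⟨T, hT, hcard⟩ := hinf'.exists_subset_card_eq N
  -- With `N` chosen so that `N * c` exceeds the total mass, `N` points of mass `c` are too many.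
  have h1 : m (T : Set F) = N * c := by
    rw [← MeasureTheory.sum_measure_singleton, Finset.sum_congr rfl fun x hx => (hsing x).trans
      (congrArg _ (hT hx)), Finset.sum_const, hcard, nsmul_eq_mul]
  have h2 : (N * c : ℝ≥0∞) ≤ μ (Subtype.val '' (univ : Set F)) := by
    rw [← huniv, ← h1]; exact MeasureTheory.measure_mono (subset_univ _)
  have h3 : N * c ≤ μ (Subtype.val '' (univ : Set F)) := by exact_mod_cast h2
  rw [div_lt_iff₀ (pos_of_ne_zero hc)] at hN
  exact absurd hN (not_lt.2 h3)

/-- Masses are constant along plaques of regular points. A fiber over a non-optimal point contains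
no pre-singularity, so each of its points has lifts over two different prongs and belongs to the
cross-section of one of finitely many turns; each cross-section is a transversal. -/
theorem isLeafwise_mass (hproper : ζ.IsProper) (hstab : ζ.IsStabilized)
    (hμ : ζ.IsTransverseSemiMeasure μ) {c : ℝ≥0} (hc : c ≠ 0) :
    IsLeafwise ζ {z | z ∉ ζ.sing ∧ μ {z} = c} := by
  refine ⟨fun z hz => hz.1, fun j V hV y hy hs hne w hw => ?_, fun x hx => ?_⟩
  · obtain ⟨z, hz, -, hzc⟩ := hne
    refine ⟨V.notMem_sing_of_mem_plaque hproper hstab hs hw, ?_⟩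
    rw [← hzc, measure_singleton_of_mem_plaque hproper hstab hμ hs hw,
      measure_singleton_of_mem_plaque hproper hstab hμ hs hz]
  · obtain ⟨V, rfl, hV, -⟩ := GraphTower.StdStar.exists_fine hproper x Filter.univ_mem
    have hfin : (⋃ p : {p : Fin V.N × Fin V.N // p.1 ≠ p.2},
        {z ∈ ζ.crossSection 0 V.center (V.turn p.1.1 p.1.2) | μ {z} = c}).Finite := by
      refine finite_iUnion fun p => finite_of_isTransversal hμ ?_ hc
      obtain ⟨Φ, hΦ, hΦα⟩ := exists_isFlowMap (V := V) hproper hstab p.2 Ray.zero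
      refine ⟨0, _, _, V.isStandardTurn_turn p.2, Φ, hΦ, univ, @MeasurableSet.univ _ (borel _), ?_⟩
      have : Φ = Subtype.val := by
        funext y
        obtain ⟨-, ⟨α, hα, hα0⟩, -⟩ := (mem_crossSection_iff hproper hstab p.2).1 y.2
        rw [hΦα y α hα hα0, hα0]
      rw [this, image_univ, Subtype.range_coe]
    refine hfin.subset ?_
    rintro z ⟨⟨hzs, hzc⟩, hzx⟩
    have hzx : ζ.proj 0 z = V.center := hzx
    have hpre : ¬ ζ.IsPreSingularity z := hstab.not_natural_vertex 0 (ζ.proj 0 z)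
      (notMem_naturalVertices_of_notMem_opt (by rwa [hzx]) 0) z rfl
    obtain ⟨a, ha, b, hb, hab⟩ := V.exists_ne_xraysAt hstab hzx
    obtain ⟨i, hi⟩ := ha.2
    obtain ⟨k, hk⟩ := hb.2
    have hik := V.type_ne_of_not_isPreSingularity hpre ha hb hab hi hk
    exact mem_iUnion.2 ⟨⟨(i, k), hik⟩, (mem_crossSection_iff hproper hstab hik).2
      ⟨hzs, ⟨a, hi, ha.1⟩, b, hk, hb.1⟩, hzc⟩

/-- Positive masses at regular points would give a nonempty leafwise set. The mass of a singularity
is then computed from regular points, namely the midpoints of its lifts. -/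
theorem isNonAtomic (hproper : ζ.IsProper) (hstab : ζ.IsStabilized) (hexp : ζ.IsExpanding)
    (hμ : ζ.IsTransverseSemiMeasure μ) : ζ.IsNonAtomic μ := by
  have hreg : ∀ z, z ∉ ζ.sing → μ {z} = 0 := by
    intro z hz
    by_contra hc
    exact (isLeafwise_mass hproper hstab hμ hc).not_isExpanding hproper hstab ⟨z, hz, rfl⟩ hexp
  intro s
  by_cases hs : s ∈ ζ.sing
  swap
  · exact hreg s hs
  obtain ⟨V, hV, -, -⟩ := GraphTower.StdStar.exists_fine hproper (ζ.proj 0 s) Filter.univ_mem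
  obtain ⟨a, h, hh, hha, hmem, hsurj⟩ := V.exists_isStarChart_plaque hstab hV.symm
  have hhalf : ∀ γ ∈ V.xraysAt s, γ Ray.half ≠ s := fun γ hγ he =>
    Ray.half_ne (V.xraysAt_inj hγ hγ (he.trans hγ.1.symm)).1
  rw [hμ.singular_mass s _ (V.isSingularPlaque_plaque hstab hV.symm hs)
    ((fun γ => γ Ray.half) '' V.xraysAt s) ?_ ?_]
  · rw [finsum_mem_eq_zero_of_forall_eq_zero, zero_div]
    rintro _ ⟨γ, hγ, rfl⟩
    obtain ⟨i, hi⟩ := hγ.2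
    exact hreg _ (V.xlift_notMem_sing hproper hstab hi Ray.half_ne)
  · rintro _ ⟨γ, hγ, rfl⟩
    exact ⟨⟨γ, hγ, _, rfl⟩, hhalf γ hγ⟩
  · intro Q hQ
    obtain ⟨i, rfl⟩ := hh.eq_prong hQ
    rw [image_modelProng]
    simp only [hha]
    refine ⟨a i Ray.half, ⟨⟨a i, hmem i, rfl⟩, _, Ray.half_ne, rfl⟩, ?_⟩
    rintro _ ⟨⟨γ, hγ, rfl⟩, t, ht, he⟩
    obtain ⟨h1, h2⟩ := V.xraysAt_inj (hmem i) hγ he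
    change γ Ray.half = _
    rw [h2.resolve_left ht]

end SplitSequence

/-! ### Edges covered by locally injective paths -/

namespace MetricGraph

variable {G : MetricGraph}

open Classical in
/-- The parameter of a point on an edge. -/
def edgeCoord (e : G.E) : G.Point → ℝ
  | .vertex _ => 0
  | .inner e' t _ _ => if e' = e then t else 0

theorem edgeCoord_path {e : G.E} {t : ℝ} (ht : t ∈ Ioo 0 (G.len e)) : edgeCoord e (G.path e t) = t := by
  rw [path_of_mem ht]; simp [edgeCoord]

theorem continuousOn_edgeCoord (e : G.E) : ContinuousOn (edgeCoord e) (G.openEdge e) := by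
  rintro _ ⟨s, hs, rfl⟩
  refine ContinuousAt.continuousWithinAt fun N hN => ?_
  rw [edgeCoord_path hs] at hN
  obtain ⟨O, hON, hO, hsO⟩ := mem_nhds_iff.1 (Filter.inter_mem hN (isOpen_Ioo.mem_nhds hs))
  rw [Filter.mem_map]
  refine Filter.mem_of_superset ((isOpen_path_image hO fun t ht => (hON ht).2).mem_nhds ⟨s, hsO, rfl⟩) ?_
  rintro _ ⟨t, ht, rfl⟩
  rw [mem_preimage, edgeCoord_path (hON ht).2]
  exact (hON ht).1

theorem path_edgeCoord {e : G.E} {x : G.Point} (hx : x ∈ G.openEdge e) :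
    G.path e (edgeCoord e x) = x := by
  obtain ⟨t, ht, rfl⟩ := hx
  rw [edgeCoord_path ht]

theorem edgeCoord_mem {e : G.E} {x : G.Point} (hx : x ∈ G.openEdge e) :
    edgeCoord e x ∈ Ioo 0 (G.len e) := by
  obtain ⟨t, ht, rfl⟩ := hx
  rwa [edgeCoord_path ht]

theorem eq_of_mem_openEdge {e e' : G.E} {x : G.Point} (h : x ∈ G.openEdge e) (h' : x ∈ G.openEdge e') :
    e = e' := by
  obtain ⟨t, ht, rfl⟩ := h
  obtain ⟨s, hs, he⟩ := h'
  rw [path_of_mem ht] at he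
  exact (mem_Ioo_of_path_eq_inner he).1.symm

/-- A locally injective path in an edge is open. -/
theorem image_mem_nhds_of_injOn {f : ℝ → G.Point} (hf : Continuous f) {e : G.E} {u : ℝ}
    (hu : f u ∈ G.openEdge e) {U : Set ℝ} (hU : U ∈ 𝓝 u) (hinj : InjOn f U) : f '' U ∈ 𝓝 (f u) := by
  have hW : U ∩ f ⁻¹' G.openEdge e ∈ 𝓝 u :=
    Filter.inter_mem hU (((isOpen_openEdge e).preimage hf).mem_nhds hu)
  obtain ⟨ε, hε, hb⟩ := Metric.nhds_basis_closedBall.mem_iff.1 hW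
  rw [Real.closedBall_eq_Icc] at hb
  have hlu : u - ε ≤ u + ε := by linarith
  have hφc : ContinuousOn (fun t => edgeCoord e (f t)) (Icc (u - ε) (u + ε)) :=
    (continuousOn_edgeCoord e).comp hf.continuousOn fun t ht => (hb ht).2
  have hφi : InjOn (fun t => edgeCoord e (f t)) (Icc (u - ε) (u + ε)) := by
    intro s hs t ht hst
    refine hinj (hb hs).1 (hb ht).1 ?_
    rw [← path_edgeCoord (hb hs).2, ← path_edgeCoord (hb ht).2]
    exact congrArg _ hst
  have hl : u - ε ∈ Icc (u - ε) (u + ε) := ⟨le_rfl, hlu⟩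
  have hr : u + ε ∈ Icc (u - ε) (u + ε) := ⟨hlu, le_rfl⟩
  have hm : u ∈ Icc (u - ε) (u + ε) := ⟨by linarith, by linarith⟩
  have key : ∀ c d, c ∈ Icc (u - ε) (u + ε) → d ∈ Icc (u - ε) (u + ε) →
      edgeCoord e (f c) < edgeCoord e (f u) → edgeCoord e (f u) < edgeCoord e (f d) →
      (∀ s ∈ Ioo (edgeCoord e (f c)) (edgeCoord e (f d)), ∃ t ∈ Icc (u - ε) (u + ε),
        edgeCoord e (f t) = s) → f '' U ∈ 𝓝 (f u) := by
    intro c d hc hd h1 h2 hsurj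
    refine Filter.mem_of_superset ((isOpen_path_image (e := e) isOpen_Ioo (Ioo_subset_Ioo
      (edgeCoord_mem (hb hc).2).1.le (edgeCoord_mem (hb hd).2).2.le)).mem_nhds
      ⟨_, ⟨h1, h2⟩, path_edgeCoord hu⟩) ?_
    rintro _ ⟨s, hs, rfl⟩
    obtain ⟨t, ht, rfl⟩ := hsurj s hs
    exact ⟨t, (hb ht).1, (path_edgeCoord (hb ht).2).symm⟩
  rcases hφc.strictMonoOn_of_injOn_Icc' hlu hφi with h | h
  · refine key _ _ hl hr (h hl hm (by linarith)) (h hm hr (by linarith)) fun s hs => ?_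
    exact intermediate_value_Icc hlu hφc ⟨hs.1.le, hs.2.le⟩
  · refine key _ _ hr hl (h hm hr (by linarith)) (h hl hm (by linarith)) fun s hs => ?_
    exact intermediate_value_Icc' hlu hφc ⟨hs.1.le, hs.2.le⟩

/-- A locally injective path with end points off an edge that meets the edge covers it. -/
theorem openEdge_subset_of_locally_injOn {f : ℝ → G.Point} (hf : Continuous f) {e : G.E} {a b t : ℝ}
    (hl : ∀ u ∈ Ioo a b, ∃ U ∈ 𝓝 u, InjOn f U) (ha : f a ∉ G.openEdge e) (hb : f b ∉ G.openEdge e)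
    (ht : t ∈ Ioo a b) (hte : f t ∈ G.openEdge e) : G.openEdge e ⊆ f '' Ioo a b := by
  have hint : ∀ u ∈ Ioo a b, f u ∈ G.openEdge e → f u ∈ interior (f '' Ioo a b) := by
    intro u hu hue
    obtain ⟨U, hU, hinj⟩ := hl u hu
    refine mem_interior_iff_mem_nhds.2 (Filter.mem_of_superset (image_mem_nhds_of_injOn hf hue
      (Filter.inter_mem hU (isOpen_Ioo.mem_nhds hu)) (hinj.mono inter_subset_left)) ?_)
    exact image_mono inter_subset_right
  -- Relative to the open edge, the image of the open interval is open by local injectivity and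
  -- closed because both end points map off the edge.
  refine ((isPreconnected_openEdge e).subset_left_of_subset_union isOpen_interior
    ((isCompact_Icc (a := a) (b := b)).image hf).isClosed.isOpen_compl ?_ ?_ ⟨_, hte, hint t ht hte⟩).trans interior_subset
  · exact disjoint_left.2 fun x hx hx' => hx' (image_mono Ioo_subset_Icc_self (interior_subset hx))
  · intro x hx
    by_cases h : x ∈ f '' Icc a b
    · obtain ⟨u, hu, rfl⟩ := h
      refine Or.inl (hint u ⟨lt_of_le_of_ne hu.1 ?_, lt_of_le_of_ne hu.2 ?_⟩ hx)
      · rintro rfl; exact ha hx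
      · rintro rfl; exact hb hx
    · exact Or.inr h

/-- A simple closed path that meets an edge covers it. -/
theorem openEdge_subset_of_simple_closed {f : ℝ → G.Point} (hf : Continuous f) {e : G.E} {L t : ℝ}
    (hL : 0 < L) (h0 : f 0 = f L) (hinj : InjOn f (Ico 0 L)) (ht : t ∈ Icc 0 L)
    (hte : f t ∈ G.openEdge e) : G.openEdge e ⊆ f '' Icc 0 L := by
  have hbase : f 0 ∈ G.openEdge e → f 0 ∈ interior (f '' Icc 0 L) := by
    intro he
    -- The base point is treated like any other after the loop is rebased: for negative time it is
    -- continued by its final part.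
    let g : ℝ → G.Point := fun t => if 0 ≤ t then f t else f (L + t)
    have hg : Continuous g := Continuous.if_le hf (hf.comp (continuous_const.add continuous_id))
      continuous_const continuous_id (by rintro x rfl; simp [h0])
    have hg0 : g 0 = f 0 := if_pos le_rfl
    have hU : Ioo (-(L / 2)) (L / 2) ∈ 𝓝 (0 : ℝ) := Ioo_mem_nhds (by linarith) (by linarith)
    have hgi : InjOn g (Ioo (-(L / 2)) (L / 2)) := by
      intro s hs t ht hst
      have hs1 := hs.1; have hs2 := hs.2; have ht1 := ht.1; have ht2 := ht.2
      by_cases h1 : 0 ≤ s <;> by_cases h2 : 0 ≤ t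
      · simp only [g, if_pos h1, if_pos h2] at hst
        exact hinj ⟨h1, by linarith⟩ ⟨h2, by linarith⟩ hst
      · simp only [g, if_pos h1, if_neg h2] at hst
        have := hinj ⟨h1, by linarith⟩ ⟨by linarith, by linarith⟩ hst
        linarith
      · simp only [g, if_neg h1, if_pos h2] at hst
        have := hinj ⟨by linarith, by linarith⟩ ⟨h2, by linarith⟩ hst
        linarith
      · simp only [g, if_neg h1, if_neg h2] at hst
        have := hinj ⟨by linarith, by linarith⟩ ⟨by linarith, by linarith⟩ hst
        linarith
    have := image_mem_nhds_of_injOn hg (by rwa [hg0]) hU hgi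
    rw [hg0] at this
    refine mem_interior_iff_mem_nhds.2 (Filter.mem_of_superset this ?_)
    rintro _ ⟨s, hs, rfl⟩
    have hs1 := hs.1; have hs2 := hs.2
    by_cases h1 : 0 ≤ s
    · exact ⟨s, ⟨h1, by linarith⟩, (if_pos h1).symm⟩
    · exact ⟨L + s, ⟨by linarith, by linarith⟩, (if_neg h1).symm⟩
  have hint : ∀ u ∈ Icc 0 L, f u ∈ G.openEdge e → f u ∈ interior (f '' Icc 0 L) := by
    intro u hu hue
    rcases hu.1.eq_or_lt with h | h
    · rw [← h] at hue ⊢; exact hbase hue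
    rcases hu.2.eq_or_lt with h' | h'
    · rw [h', ← h0] at hue ⊢; exact hbase hue
    refine mem_interior_iff_mem_nhds.2 (Filter.mem_of_superset (image_mem_nhds_of_injOn hf hue
      (Ioo_mem_nhds h h') (hinj.mono Ioo_subset_Ico_self)) (image_mono Ioo_subset_Icc_self))
  refine ((isPreconnected_openEdge e).subset_left_of_subset_union isOpen_interior
    ((isCompact_Icc (a := 0) (b := L)).image hf).isClosed.isOpen_compl ?_ ?_ ⟨_, hte, hint t ht hte⟩).trans interior_subset
  · exact disjoint_left.2 fun x hx hx' => hx' (interior_subset hx)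
  · intro x hx
    by_cases h : x ∈ f '' Icc 0 L
    · obtain ⟨u, hu, rfl⟩ := h
      exact Or.inl (hint u hu hx)
    · exact Or.inr h

/-- Connected sets that meet two edges contain a natural vertex. -/
theorem exists_mem_naturalVertices {Q : Set G.Point} (hQ : IsPreconnected Q) {e e' : G.E} (hne : e ≠ e')
    {x x' : G.Point} (hx : x ∈ Q) (hxe : x ∈ G.openEdge e) (hx' : x' ∈ Q) (hxe' : x' ∈ G.openEdge e') :
    ∃ v ∈ Q, v ∈ G.naturalVertices := by
  by_contra! hcon
  have := hQ.subset_of_disjoint_cover (fun e => isOpen_openEdge e) (fun y hy => by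
    obtain ⟨e, he⟩ := exists_mem_openEdge (hcon y hy)
    exact mem_iUnion.2 ⟨e, he⟩) (fun i k hik y _ hi hk => hik (eq_of_mem_openEdge hi hk)) hx hxe
  exact hne (eq_of_mem_openEdge (this hx') hxe')

/-- A simple closed path in a graph with one natural vertex stays in one edge. -/
theorem eq_of_simple_closed [Subsingleton G.V] {f : ℝ → G.Point} (hf : Continuous f) {L : ℝ}
    (h0 : f 0 = f L) (hinj : InjOn f (Ico 0 L)) {e e' : G.E} {s t : ℝ} (hs : s ∈ Icc 0 L)
    (ht : t ∈ Icc 0 L) (hse : f s ∈ G.openEdge e) (hte : f t ∈ G.openEdge e') : e = e' := by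
  have key : ∀ (e e' : G.E) (s t : ℝ), s ∈ Icc 0 L → t ∈ Icc 0 L → s < t → f s ∈ G.openEdge e →
      f t ∈ G.openEdge e' → e = e' := by
    intro e e' s t hs ht hst hse hte
    by_contra hne
    -- Each of the two arcs of the loop between the points in different edges passes a natural
    -- vertex. As there is only one, the loop visits it twice.
    obtain ⟨_, ⟨c, hc, rfl⟩, v, hv⟩ := exists_mem_naturalVertices
      (isPreconnected_Icc.image f hf.continuousOn) hne
      (mem_image_of_mem f (left_mem_Icc.2 hst.le)) hse (mem_image_of_mem f (right_mem_Icc.2 hst.le)) hte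
    have hQ : IsPreconnected (f '' Icc t L ∪ f '' Icc 0 s) :=
      (isPreconnected_Icc.image f hf.continuousOn).union (f 0)
        (h0 ▸ mem_image_of_mem f (right_mem_Icc.2 ht.2)) (mem_image_of_mem f (left_mem_Icc.2 hs.1))
        (isPreconnected_Icc.image f hf.continuousOn)
    obtain ⟨x, hx, w, hw⟩ := exists_mem_naturalVertices hQ hne
      (Or.inr (mem_image_of_mem f (right_mem_Icc.2 hs.1))) hse
      (Or.inl (mem_image_of_mem f (left_mem_Icc.2 ht.2))) hte
    have hxc : x = f c := by rw [← hw, ← hv, Subsingleton.elim w v]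
    have hcs : s < c := lt_of_le_of_ne hc.1 (by
      rintro rfl; exact notMem_naturalVertices_of_mem_openEdge hse ⟨v, hv⟩)
    have hct : c < t := lt_of_le_of_ne hc.2 (by
      rintro rfl; exact notMem_naturalVertices_of_mem_openEdge hte ⟨v, hv⟩)
    have hs0 := hs.1
    have htL := ht.2
    have hcm : c ∈ Ico 0 L := ⟨by linarith, by linarith⟩
    rcases hx with ⟨d, hd, rfl⟩ | ⟨d, hd, rfl⟩
    · rcases hd.2.eq_or_lt with h | h
      · rw [h, ← h0] at hxc
        have := hinj ⟨le_rfl, by linarith⟩ hcm hxc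
        linarith
      · have := hinj ⟨by linarith [hd.1], h⟩ hcm hxc
        linarith [hd.1]
    · have := hinj ⟨hd.1, by linarith [hd.2]⟩ hcm hxc
      linarith [hd.2]
  rcases lt_trichotomy s t with h | h | h
  · exact key e e' s t hs ht h hse hte
  · subst h; exact eq_of_mem_openEdge hse hte
  · exact (key e' e t s ht hs h hte hse).symm

theorem injOn_path_Ico [Subsingleton G.V] (e : G.E) : InjOn (G.path e) (Ico 0 (G.len e)) := by
  have key : ∀ s t, s ∈ Ioo 0 (G.len e) → G.path e s = G.path e t → s = t := by
    intro s t hs h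
    rw [path_of_mem hs] at h
    exact (mem_Ioo_of_path_eq_inner h.symm).2.symm
  intro s hs t ht h
  rcases hs.1.eq_or_lt with h1 | h1
  · rcases ht.1.eq_or_lt with h2 | h2
    · rw [← h1, ← h2]
    · exact (key t s ⟨h2, ht.2⟩ h.symm).symm
  · exact key s t ⟨h1, hs.2⟩ h

/-- A single edge provides at most two directed edges, fewer than the valence. -/
theorem exists_ne_edges (v : G.V) : ∃ e e' : G.E, e ≠ e' := by
  by_contra! h
  have hle : Nat.card {d : G.E × Bool // (if d.2 then G.src d.1 else G.tgt d.1) = v} ≤ Nat.card Bool :=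
    Nat.card_le_card_of_injective (fun d => d.1.2) fun a b hab =>
      Subtype.ext (Prod.ext (h _ _) hab)
  rw [Nat.card_eq_fintype_card (α := Bool), Fintype.card_bool] at hle
  have := G.three_le_valence v
  omega

/-- Two vertices are the starts of at least six directed edges, and each edge accounts for two. -/
theorem exists_three_edges {v w : G.V} (h : v ≠ w) : ∃ e₁ e₂ e₃ : G.E, e₁ ≠ e₂ ∧ e₁ ≠ e₃ ∧ e₂ ≠ e₃ := by
  have := G.finite_E
  have hle : Nat.card ({d : G.E × Bool // (if d.2 then G.src d.1 else G.tgt d.1) = v} ⊕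
      {d : G.E × Bool // (if d.2 then G.src d.1 else G.tgt d.1) = w}) ≤ Nat.card (G.E × Bool) := by
    refine Nat.card_le_card_of_injective (Sum.elim Subtype.val Subtype.val) ?_
    refine Function.Injective.sumElim Subtype.val_injective Subtype.val_injective ?_
    rintro ⟨a, ha⟩ ⟨b, hb⟩ (rfl : a = b)
    exact h (ha.symm.trans hb)
  rw [Nat.card_sum, Nat.card_prod, Nat.card_eq_fintype_card (α := Bool), Fintype.card_bool] at hle
  have h1 := G.three_le_valence v
  have h2 := G.three_le_valence w
  have h3 : 2 < (univ : Set G.E).ncard := by rw [ncard_univ]; omega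
  obtain ⟨a, b, c, -, -, -, hab, hac, hbc⟩ := (two_lt_ncard_iff (toFinite _)).1 h3
  exact ⟨a, b, c, hab, hac, hbc⟩

end MetricGraph

/-! ### Full mingling implies expansion -/

namespace SplitSequence

open MetricGraph

variable {n : ℕ} {ζ : SplitSequence n} {j k : ℕ}

/-- The image of an edge under the composition of bonding maps, as a path. -/
def edgePath (ζ : SplitSequence n) (h : j ≤ k) (e : (ζ.graph k).E) (t : ℝ) : ζ.Level j :=
  ζ.down h ((ζ.graph k).path e t)

theorem continuous_edgePath (h : j ≤ k) (e : (ζ.graph k).E) : Continuous (ζ.edgePath h e) :=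
  (ζ.continuous_down h).comp (continuous_path e)

theorem edgePath_locally_injOn (h : j ≤ k) (e : (ζ.graph k).E) :
    ∀ u ∈ Ioo 0 ((ζ.graph k).len e), ∃ U ∈ 𝓝 u, InjOn (ζ.edgePath h e) U := by
  intro u hu
  obtain ⟨U, hU, hinj⟩ := ζ.exists_injOn_down h
    (notMem_naturalVertices_of_mem_openEdge ⟨u, hu, rfl⟩)
  refine ⟨(ζ.graph k).path e ⁻¹' U ∩ Ioo 0 ((ζ.graph k).len e), Filter.inter_mem
    ((continuous_path e).continuousAt.preimage_mem_nhds hU) (isOpen_Ioo.mem_nhds hu), ?_⟩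
  intro s hs t ht hst
  have := hinj hs.1 ht.1 hst
  rw [path_of_mem hs.2] at this
  exact (mem_Ioo_of_path_eq_inner this.symm).2.symm

/-- The number of optimal points of the top graph passed by the interior of an edge. -/
def optCount (ζ : SplitSequence n) (e : (ζ.graph k).E) : ℕ :=
  ((ζ.graph k).openEdge e ∩ {x | ζ.down (Nat.zero_le k) x ∈ ζ.opt}).ncard

/-- Each optimal point over `e'` is also passed by `e`, and the natural vertex `v`, which lies
outside the interior of `e'`, contributes one more. -/
theorem optCount_lt (hproper : ζ.IsProper) (h : j ≤ k) {e : (ζ.graph k).E} {e' : (ζ.graph j).E}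
    (hsub : (ζ.graph j).openEdge e' ⊆ ζ.edgePath h e '' Ioo 0 ((ζ.graph k).len e)) {v : ζ.Level j}
    (hv : v ∈ (ζ.graph j).naturalVertices)
    (hve : v ∈ ζ.edgePath h e '' Ioo 0 ((ζ.graph k).len e)) : ζ.optCount e' < ζ.optCount e := by
  have hfin : ∀ l, {x : ζ.Level l | ζ.down (Nat.zero_le l) x ∈ ζ.opt}.Finite := fun l =>
    ζ.finite_preimage (Nat.zero_le l) hproper.finite_opt
  have hvE : v ∉ (ζ.graph j).openEdge e' ∩ {x | ζ.down (Nat.zero_le j) x ∈ ζ.opt} := fun h =>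
    notMem_naturalVertices_of_mem_openEdge h.1 hv
  have h1 : insert v ((ζ.graph j).openEdge e' ∩ {x | ζ.down (Nat.zero_le j) x ∈ ζ.opt}) ⊆
      ζ.down h '' ((ζ.graph k).openEdge e ∩ {x | ζ.down (Nat.zero_le k) x ∈ ζ.opt}) := by
    have key : ∀ x, x ∈ ζ.edgePath h e '' Ioo 0 ((ζ.graph k).len e) →
        ζ.down (Nat.zero_le j) x ∈ ζ.opt →
        x ∈ ζ.down h '' ((ζ.graph k).openEdge e ∩ {x | ζ.down (Nat.zero_le k) x ∈ ζ.opt}) := by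
      rintro _ ⟨t, ht, rfl⟩ hx
      refine ⟨_, ⟨⟨t, ht, rfl⟩, ?_⟩, rfl⟩
      unfold edgePath at hx
      rwa [ζ.down_down] at hx
    rintro x (rfl | hx)
    · exact key _ hve (ζ.isSpecial_of_mem hv).mem_opt
    · exact key _ (hsub hx.1) hx.2
  have h2 := ncard_le_ncard h1 (((hfin k).subset inter_subset_right).image _)
  rw [ncard_insert_of_notMem hvE ((hfin j).subset inter_subset_right)] at h2
  exact h2.trans (ncard_image_le ((hfin k).subset inter_subset_right))

/-- Of three edges met at three times, the one met in the middle is crossed completely, and a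
natural vertex is passed between the first two meetings. -/
theorem exists_optCount_lt (hproper : ζ.IsProper) (h : j ≤ k) {e₁ e₂ e₃ : (ζ.graph j).E}
    (h12 : e₁ ≠ e₂) (h13 : e₁ ≠ e₃) (h23 : e₂ ≠ e₃) {e : (ζ.graph k).E}
    (hm : ∀ e', ζ.Mingles h e e') : ∃ e' : (ζ.graph j).E, ζ.optCount e' < ζ.optCount e := by
  have key : ∀ (a b c : (ζ.graph j).E) (r s t : ℝ), a ≠ b → b ≠ c → 0 < r → t < (ζ.graph k).len e →
      r < s → s < t → ζ.edgePath h e r ∈ (ζ.graph j).openEdge a →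
      ζ.edgePath h e s ∈ (ζ.graph j).openEdge b → ζ.edgePath h e t ∈ (ζ.graph j).openEdge c →
      ∃ e' : (ζ.graph j).E, ζ.optCount e' < ζ.optCount e := by
    intro a b c r s t hab hbc hr ht hrs hst ha hb hc
    have hsub : Ioo r t ⊆ Ioo 0 ((ζ.graph k).len e) := Ioo_subset_Ioo hr.le ht.le
    have h1 := openEdge_subset_of_locally_injOn (ζ.continuous_edgePath h e)
      (fun u hu => ζ.edgePath_locally_injOn h e u (hsub hu))
      (fun h' => hab (eq_of_mem_openEdge ha h')) (fun h' => hbc (eq_of_mem_openEdge h' hc))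
      ⟨hrs, hst⟩ hb
    obtain ⟨v, ⟨u, hu, hv⟩, hvn⟩ := exists_mem_naturalVertices
      (isPreconnected_Icc.image _ (ζ.continuous_edgePath h e).continuousOn) hab
      (mem_image_of_mem _ (left_mem_Icc.2 hrs.le)) ha (mem_image_of_mem _ (right_mem_Icc.2 hrs.le)) hb
    exact ⟨b, ζ.optCount_lt hproper h (h1.trans (image_mono hsub)) hvn
      ⟨u, ⟨hr.trans_le hu.1, hu.2.trans_lt (hst.trans ht)⟩, hv⟩⟩
  have htime : ∀ e', ∃ t ∈ Ioo 0 ((ζ.graph k).len e), ζ.edgePath h e t ∈ (ζ.graph j).openEdge e' := by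
    intro e'
    obtain ⟨_, ⟨_, ⟨t, ht, rfl⟩, rfl⟩, he⟩ := hm e'
    exact ⟨t, ht, he⟩
  choose t ht hte using htime
  have hne : ∀ a b, a ≠ b → t a ≠ t b := fun a b hab he =>
    hab (eq_of_mem_openEdge (hte a) (he ▸ hte b))
  have key' : ∀ a b c, a ≠ b → b ≠ c → t a < t b → t b < t c → ∃ e' : (ζ.graph j).E, ζ.optCount e' < ζ.optCount e :=
    fun a b c hab hbc h1 h2 => key a b c _ _ _ hab hbc (ht a).1 (ht c).2 h1 h2 (hte a) (hte b) (hte c)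
  rcases lt_or_gt_of_ne (hne _ _ h12) with a | a <;> rcases lt_or_gt_of_ne (hne _ _ h13) with b | b <;>
    rcases lt_or_gt_of_ne (hne _ _ h23) with c | c
  · exact key' e₁ e₂ e₃ h12 h23 a c
  · exact key' e₁ e₃ e₂ h13 h23.symm b c
  · exact key' e₁ e₂ e₃ h12 h23 a c
  · exact key' e₃ e₁ e₂ h13.symm h12 b a
  · exact key' e₂ e₁ e₃ h12.symm h13 a b
  · exact key' e₃ e₂ e₁ h23.symm h12.symm c a
  · exact key' e₂ e₃ e₁ h23 h13.symm c b
  · exact key' e₃ e₂ e₁ h23.symm h12.symm c a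

theorem nonempty_vertices (j : ℕ) : Nonempty (ζ.graph j).V := by
  obtain ⟨hc, -⟩ := ζ.core j
  obtain ⟨x⟩ := hc.nonempty
  rcases x with v | ⟨e, _, _, _⟩
  · exact ⟨v⟩
  · exact ⟨(ζ.graph j).src e⟩

theorem injOn_down_of_le {i : ℕ} (hij : i ≤ j) (hjk : j ≤ k) {A : Set (ζ.Level k)}
    (h : InjOn (ζ.down (hij.trans hjk)) A) : InjOn (ζ.down hjk) A := by
  intro x hx y hy hxy
  refine h hx hy ?_
  rw [← ζ.down_down hij hjk, hxy, ζ.down_down]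

/-- Counting needs three edges, which two natural vertices guarantee. Arbitrarily low levels with a
single natural vertex are treated separately, using that all their edges are loops. -/
theorem isExpanding_of_isFullyMingling (hproper : ζ.IsProper) (hm : ζ.IsFullyMingling) :
    ζ.IsExpanding := by
  intro j e₀
  choose K hK hKm using hm
  by_cases hone : ∀ N, ∃ l, N ≤ l ∧ Subsingleton (ζ.graph l).V
  · obtain ⟨i, hji, hi⟩ := hone j
    obtain ⟨l, hl, hlone⟩ := hone (K i)
    have hil : i < l := (hK i).trans_le hl
    refine ⟨l, hji.trans_lt hil, fun e _ hemb => ?_⟩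
    have hinjl : InjOn (ζ.down (hji.trans hil.le)) ((ζ.graph l).closedEdge e) :=
      injOn_iff_injective.2 hemb.injective
    have hlen := (ζ.graph l).len_pos e
    have hclosed : (ζ.graph l).path e 0 = (ζ.graph l).path e ((ζ.graph l).len e) := by
      rw [path_of_nonpos le_rfl, path_of_len_le le_rfl, Subsingleton.elim ((ζ.graph l).src e)]
    have hinj : ∀ {m : ℕ} (hml : m ≤ l), j ≤ m → InjOn (ζ.edgePath hml e) (Ico 0 ((ζ.graph l).len e)) := by
      intro m hml hjm s hs t ht hst
      exact injOn_path_Ico e hs ht (ζ.injOn_down_of_le hjm hml hinjl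
        ⟨s, Ico_subset_Icc_self hs, rfl⟩ ⟨t, Ico_subset_Icc_self ht, rfl⟩ hst)
    have hcl : ∀ {m : ℕ} (hml : m ≤ l), ζ.edgePath hml e 0 = ζ.edgePath hml e ((ζ.graph l).len e) :=
      fun hml => congrArg (ζ.down hml) hclosed
    have hjK : j ≤ K i := hji.trans (hK i).le
    -- The image of the loop at the intermediate level is infinite, so it meets the interior of an
    -- edge and, being a simple closed path, covers it. That edge mingles with all edges of level
    -- `i`.
    obtain ⟨t, ht, htn⟩ : ∃ t ∈ Ico 0 ((ζ.graph l).len e),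
        ζ.edgePath hl e t ∉ (ζ.graph (K i)).naturalVertices := by
      by_contra! hcon
      exact (Ico_infinite hlen) (Finite.of_finite_image ((ζ.graph (K i)).finite_naturalVertices.subset
        (image_subset_iff.2 hcon)) (hinj hl hjK))
    obtain ⟨e', he'⟩ := exists_mem_openEdge htn
    have hsub := openEdge_subset_of_simple_closed (ζ.continuous_edgePath hl e) hlen (hcl hl)
      (hinj hl hjK) (Ico_subset_Icc_self ht) he'
    have hmeet : ∀ a, ∃ s ∈ Icc 0 ((ζ.graph l).len e),
        ζ.edgePath hil.le e s ∈ (ζ.graph i).openEdge a := by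
      intro a
      obtain ⟨_, ⟨x, hx, rfl⟩, hxa⟩ := hKm i e' a
      obtain ⟨s, hs, rfl⟩ := hsub hx
      refine ⟨s, hs, ?_⟩
      unfold edgePath at hxa ⊢
      rwa [ζ.down_down] at hxa
    -- The simple closed path in level `i`, which has one natural vertex, meets two different edges;
    -- this is impossible.
    obtain ⟨v⟩ := ζ.nonempty_vertices i
    obtain ⟨a, b, hab⟩ := exists_ne_edges v
    obtain ⟨s, hs, hsa⟩ := hmeet a
    obtain ⟨t, ht, htb⟩ := hmeet b
    exact hab (eq_of_simple_closed (ζ.continuous_edgePath hil.le e) (hcl hil.le) (hinj hil.le hji)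
      hs ht hsa htb)
  · push Not at hone
    obtain ⟨N, hN⟩ := hone
    -- Each passage from `l` to `K l` raises the smallest count by at least one. Starting at `max N
    -- (j + 1)` secures two natural vertices and an index beyond `j`.
    have hiter : ∀ c : ℕ, ∃ l, max N (j + 1) ≤ l ∧ ∀ e : (ζ.graph l).E, c ≤ ζ.optCount e := by
      intro c
      induction c with
      | zero => exact ⟨_, le_rfl, fun _ => Nat.zero_le _⟩
      | succ c ih =>
        obtain ⟨l, hl, hc⟩ := ih
        refine ⟨K l, hl.trans (hK l).le, fun e => ?_⟩
        obtain ⟨v, w, hvw⟩ := (hN l ((le_max_left _ _).trans hl)).exists_pair_ne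
        obtain ⟨e₁, e₂, e₃, h12, h13, h23⟩ := exists_three_edges hvw
        obtain ⟨e', he'⟩ := ζ.exists_optCount_lt hproper (hK l).le h12 h13 h23 (hKm l e)
        exact (hc e').trans_lt he'
    have hfin : {x : ζ.Level j | ζ.down (Nat.zero_le j) x ∈ ζ.opt}.Finite :=
      ζ.finite_preimage (Nat.zero_le j) hproper.finite_opt
    -- One more than the number of points of level `j` over optimal points, which bounds the count
    -- for any edge on which the map to level `j` is injective.
    obtain ⟨l, hl, hc⟩ := hiter ({x : ζ.Level j | ζ.down (Nat.zero_le j) x ∈ ζ.opt}.ncard + 1)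
    have hjl : j < l := (le_max_right _ _).trans hl
    refine ⟨l, hjl, fun e _ hemb => ?_⟩
    have hinj : InjOn (ζ.down hjl.le) ((ζ.graph l).closedEdge e) :=
      injOn_iff_injective.2 hemb.injective
    have hle : ζ.optCount e ≤ {x : ζ.Level j | ζ.down (Nat.zero_le j) x ∈ ζ.opt}.ncard := by
      refine ncard_le_ncard_of_injOn (ζ.down hjl.le) ?_ ?_ hfin
      · rintro x ⟨-, hx⟩
        change ζ.down _ (ζ.down _ x) ∈ ζ.opt
        rwa [ζ.down_down]
      · exact hinj.mono (inter_subset_left.trans (image_mono Ioo_subset_Icc_self))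
    have := hc e
    omega

end SplitSequence
end

theorem mainTheorem9 {n : ℕ} (ζ : SplitSequence n)
    (hproper : ζ.IsProper) (hstab : ζ.IsStabilized) :
    (ζ.IsExpanding →
      (¬ ∃ L : Set ζ.Solenoid, ζ.IsFinitePartialLeaf L) ∧
      ∀ μ : Set ζ.Solenoid → ℝ≥0, ζ.IsTransverseMeasure μ → ζ.IsNonAtomic μ) ∧
    (ζ.IsFullyMingling →
      ζ.IsExpanding ∧
      ∀ μ : Set ζ.Solenoid → ℝ≥0, ζ.IsTransverseMeasure μ → ζ.IsNonAtomic μ) := by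
  refine ⟨fun hexp => ⟨fun ⟨L, hL⟩ => ζ.not_isFinitePartialLeaf hproper hstab hexp L hL,
    fun μ hμ => ζ.isNonAtomic hproper hstab hexp hμ.1⟩, fun hm => ?_⟩
  have hexp := ζ.isExpanding_of_isFullyMingling hproper hm
  exact ⟨hexp, fun μ hμ => ζ.isNonAtomic hproper hstab hexp hμ.1⟩
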